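/- Let $\Omega\subset\mathbb{R}^3$ be a bounded domain with $C^\infty$ boundary and outward unit normal $\nu$, star-shaped about a point $x_0\in\Omega$ and convex in two orthogonal directions (i.e. for two orthogonal directions, every line parallel to one of them meets $\Omega$ in a convex set). Put $$\rho_0=\min_{x\in\partial\Omega}(x-x_0)\cdot\nu(x),\qquad d=\max_{x\in\overline\Omega}|x-x_0|,$$ and assume $\rho_0>0$. Let $a,b,c,k>0$, $q>\tfrac32$, $p>q$, and let $m\in(2,\tfrac{8}{5-p})$ if $p<5$, $m\in(2,\infty)$ if $p\ge5$. Write $s=p-1$ and $|\Omega|$ for the volume of $\Omega$. For $\epsilon_1,\epsilon_2>0$ set $$c_1=a(m-2)s|\Omega|+\frac{3m^2sk}{2\rho_0},\qquad c_2=\Big(as|\Omega|+\frac{3m^2sk}{4\rho_0}+\frac{5m^3s^2kd}{16\rho_0\epsilon_1}\Big)\frac{3^{3/2}}{\rho_0^{3/2}},$$ $$c_3=\Big(\frac d{\rho_0}+1\Big)^{3/2}\frac1{4\epsilon_2^3}\Big(2\sqrt2\,as|\Omega|+\frac{3\sqrt2\,m^2sk}{2\rho_0}+\frac{5\sqrt2\,m^3s^2kd}{8\rho_0\epsilon_1}\Big),$$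 $$c_4=\Big(\frac d{\rho_0}+1\Big)^{3/2}\epsilon_2\Big(\frac32\sqrt2\,as|\Omega|+\frac{9\sqrt2\,m^2sk}{8\rho_0}+\frac{15\sqrt2\,m^3s^2kd}{32\epsilon_1\rho_0}\Big)+\frac{5mdk\epsilon_1}{2\rho_0}-\frac c{ms},$$ $$\epsilon_3=\Big[\frac b{3c_2}(4ms-2q+2)|\Omega|^{\frac{1-q}{ms}}\Big]^{\frac{3ms}{4ms-2q+2}},\qquad c_5=c_2\,\frac{ms-2q+2}{4ms-2q+2}\,\epsilon_3^{-\frac{4ms-2q+2}{ms-2q+2}}+c_3 .$$ Let $0<\epsilon_1<\dfrac{2\rho_0c}{5m^2sdk}$. Then there is $\epsilon_2>0$ with $c_4\le0$, and for every $\epsilon_2>0$ with $c_4\le 0$ one has $c_1>0$, $c_5>0$ and the following holds. Let $g:[0,\infty)\to\mathbb{R}$ be continuous with $0\le g(\xi)\le k\xi^\beta$ for all $\xi\ge0$, where $\beta=\frac{m(p-1)}4-m+2$. Let $u_0\in C^{2+\alpha}(\Omega)\cap C^1(\overline\Omega)$ for some $0<\alpha<1$, $u_0>0$ in $\Omega$,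 and $\nabla u_0\cdot\nu=g(u_0)$ on $\partial\Omega$. Let $0<t^*<\infty$ and let $u\in C^{2,1}(\Omega\times(0,t^*))\cap C^{1,0}(\overline\Omega\times[0,t^*))$, positive in $\Omega\times[0,t^*)$, be a classical solution of $$\begin{cases}u_t=\Delta u^m+a\int_\Omega u^p-bu^q-c|\nabla\sqrt u|^2&\text{in }\Omega\times(0,t^*),\\ \nabla u\cdot\nu=g(u)&\text{on }\partial\Omega\times[0,t^*),\\ u(x,0)=u_0(x)&x\in\Omega,\end{cases}$$ which blows up in $L^{m(p-1)}(\Omega)$ at $t^*$, i.e. $\lim_{t\to t^*}\int_\Omega u(x,t)^{m(p-1)}\,dx=\infty$. Then $\varphi(0):=\int_\Omega u_0^{m(p-1)}\,dx>0$ and $$t^*\ \ge\ T:=\frac1{2c_1}\log\Big(1+\frac{c_1}{c_5}\,\varphi(0)^{-2}\Big);$$ in particular $[0,t^*)\supseteq[0,T)$. -/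

import Mathlib

open Set Filter Topology MeasureTheory
open scoped ContDiff NNReal InnerProductSpace

namespace PorousMedium

noncomputable section

/-- Three-dimensional Euclidean space. -/
abbrev E3 : Type := EuclideanSpace ℝ (Fin 3)

/-- `ψ` is a smooth function that describes `Ω` near the boundary point `x` as the sublevel set
`{ψ < 0}`, with nonvanishing gradient at `x`. -/
structure IsLocalDefiningFunction (Ω : Set E3) (x : E3) (ψ : E3 → ℝ) : Prop where
  contDiff : ContDiff ℝ ∞ ψ
  gradient_ne_zero : gradient ψ x ≠ 0
  eventually_mem_iff : ∀ᶠ y in 𝓝 x, (y ∈ Ω ↔ ψ y < 0)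

/-- The boundary of `Ω` is smooth (and `Ω` lies locally on one side of it). -/
def HasSmoothBoundary (Ω : Set E3) : Prop :=
  ∀ x ∈ frontier Ω, ∃ ψ : E3 → ℝ, IsLocalDefiningFunction Ω x ψ

/-- `ν` is the outward unit normal to `∂Ω` at the point `x`. -/
def IsOuterUnitNormal (Ω : Set E3) (x ν : E3) : Prop :=
  x ∈ frontier Ω ∧
    ∃ ψ : E3 → ℝ, IsLocalDefiningFunction Ω x ψ ∧ ν = ‖gradient ψ x‖⁻¹ • gradient ψ x

/-- `Ω` is convex in the direction `e`: it contains, with any two points of a line parallel to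
`e`, the segment between them. -/
def IsConvexInDirection (Ω : Set E3) (e : E3) : Prop :=
  ∀ x ∈ Ω, ∀ t : ℝ, x + t • e ∈ Ω → segment ℝ x (x + t • e) ⊆ Ω

/-- `Ω` is a bounded smooth domain, star-shaped about its point `x₀` and convex in two orthogonal
directions, with `ρ₀ = min_{∂Ω} (x - x₀) · ν`, which is positive, and
`d = max_{closure Ω} |x - x₀|`. -/
structure IsAdmissibleDomain (Ω : Set E3) (x₀ : E3) (ρ₀ d : ℝ) : Prop where
  isOpen : IsOpen Ω
  isConnected : IsConnected Ω
  isBounded : Bornology.IsBounded Ω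
  smoothBoundary : HasSmoothBoundary Ω
  mem : x₀ ∈ Ω
  starConvex : StarConvex ℝ x₀ Ω
  convexInDirections : ∃ e₁ e₂ : E3, e₁ ≠ 0 ∧ e₂ ≠ 0 ∧ ⟪e₁, e₂⟫_ℝ = 0 ∧
    IsConvexInDirection Ω e₁ ∧ IsConvexInDirection Ω e₂
  isLeast_rho : IsLeast {r : ℝ | ∃ x ν : E3, IsOuterUnitNormal Ω x ν ∧ r = ⟪x - x₀, ν⟫_ℝ} ρ₀
  rho_pos : 0 < ρ₀
  isGreatest_d : IsGreatest ((fun x : E3 => ‖x - x₀‖) '' closure Ω) d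

/-- `v` belongs to `C¹` of the closure of `Ω`, and `Dv` is its gradient, continuously extended up
to the boundary. -/
def IsC1OnClosure (Ω : Set E3) (v : E3 → ℝ) (Dv : E3 → E3) : Prop :=
  ContinuousOn v (closure Ω) ∧ ContinuousOn Dv (closure Ω) ∧
    ∀ x ∈ Ω, HasGradientAt v (Dv x) x

/-- `v` belongs to `C^{2+α}(Ω)`: its second derivative is locally Hölder continuous in the open
set `Ω`, with exponent `α`. -/
def IsC2Holder (Ω : Set E3) (α : ℝ≥0) (v : E3 → ℝ) : Prop :=
  ContDiffOn ℝ 2 v Ω ∧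
    ∀ x ∈ Ω, ∃ C : ℝ≥0, ∃ U ∈ 𝓝 x, HolderOnWith C α (fun y => iteratedFDeriv ℝ 2 v y) U

/-- `u` belongs to `C^{2,1}(Ω × (0,T))`. -/
structure IsC21 (Ω : Set E3) (T : ℝ) (u : E3 → ℝ → ℝ) : Prop where
  contDiffOn_space : ∀ t ∈ Ioo 0 T, ContDiffOn ℝ 2 (fun y => u y t) Ω
  differentiableAt_time : ∀ x ∈ Ω, ∀ t ∈ Ioo 0 T, DifferentiableAt ℝ (u x) t
  continuousOn : ContinuousOn (fun z : E3 × ℝ => u z.1 z.2) (Ω ×ˢ Ioo 0 T)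
  continuousOn_fderiv :
    ContinuousOn (fun z : E3 × ℝ => fderiv ℝ (fun y => u y z.2) z.1) (Ω ×ˢ Ioo 0 T)
  continuousOn_fderiv_two :
    ContinuousOn (fun z : E3 × ℝ => iteratedFDeriv ℝ 2 (fun y => u y z.2) z.1) (Ω ×ˢ Ioo 0 T)
  continuousOn_deriv : ContinuousOn (fun z : E3 × ℝ => deriv (u z.1) z.2) (Ω ×ˢ Ioo 0 T)

/-- `u` belongs to `C^{1,0}` of the product of the closure of `Ω` and `[0,T)`, and `Du` is its
spatial gradient, continuously extended up to the boundary of `Ω`. -/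
structure IsC10 (Ω : Set E3) (T : ℝ) (u : E3 → ℝ → ℝ) (Du : E3 → ℝ → E3) : Prop where
  continuousOn : ContinuousOn (fun z : E3 × ℝ => u z.1 z.2) (closure Ω ×ˢ Ico 0 T)
  continuousOn_gradient : ContinuousOn (fun z : E3 × ℝ => Du z.1 z.2) (closure Ω ×ˢ Ico 0 T)
  hasGradientAt : ∀ t ∈ Ico 0 T, ∀ x ∈ Ω, HasGradientAt (fun y => u y t) (Du x t) x

/-- `u` is a (positive) classical solution on `[0,T)` of
`u_t = Δ(u^m) + a ∫_Ω u^p - b u^q - c |∇√u|²` in `Ω`, `∇u · ν = g(u)` on `∂Ω`, `u(·,0) = u₀`. -/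
def IsClassicalSolution (Ω : Set E3) (a b c m p q : ℝ) (g : ℝ → ℝ) (u₀ : E3 → ℝ) (T : ℝ)
    (u : E3 → ℝ → ℝ) : Prop :=
  (∀ x ∈ Ω, ∀ t ∈ Ico 0 T, 0 < u x t) ∧
  IsC21 Ω T u ∧
  (∀ x ∈ Ω, ∀ t ∈ Ioo 0 T,
    deriv (u x) t =
      Laplacian.laplacian (fun y => u y t ^ m) x + a * (∫ y in Ω, u y t ^ p) - b * u x t ^ q
        - c * ‖gradient (fun y => √(u y t)) x‖ ^ 2) ∧
  (∃ Du : E3 → ℝ → E3, IsC10 Ω T u Du ∧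
    ∀ x ν : E3, IsOuterUnitNormal Ω x ν → ∀ t ∈ Ico 0 T, ⟪Du x t, ν⟫_ℝ = g (u x t)) ∧
  (∀ x ∈ Ω, u x 0 = u₀ x)

/-- `V` blows up in the `L^r(Ω)` norm at the time `T`. -/
def BlowsUpInLr (Ω : Set E3) (r T : ℝ) (V : E3 → ℝ → ℝ) : Prop :=
  Tendsto (fun t => ∫ x in Ω, V x t ^ r) (𝓝[<] T) atTop

/-- The initial datum `u₀` is positive, of class `C^{2+α}(Ω) ∩ C¹(closure Ω)` for some
`0 < α < 1`, and compatible with the boundary condition. -/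
def IsAdmissibleDatum (Ω : Set E3) (g : ℝ → ℝ) (u₀ : E3 → ℝ) : Prop :=
  (∀ x ∈ Ω, 0 < u₀ x) ∧
  (∃ α : ℝ≥0, 0 < α ∧ α < 1 ∧ IsC2Holder Ω α u₀) ∧
  (∃ Du₀ : E3 → E3, IsC1OnClosure Ω u₀ Du₀ ∧
    ∀ x ν : E3, IsOuterUnitNormal Ω x ν → ⟪Du₀ x, ν⟫_ℝ = g (u₀ x))

/-! Below `s` stands for `p - 1` and `vol` for the volume of `Ω`. -/

/-- The constant `c₁`. -/
def c₁ (a k m s vol ρ₀ : ℝ) : ℝ :=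
  a * (m - 2) * s * vol + 3 * m ^ 2 * s * k / (2 * ρ₀)

/-- The constant `c₂`. -/
def c₂ (a k m s vol ρ₀ d ε₁ : ℝ) : ℝ :=
  (a * s * vol + 3 * m ^ 2 * s * k / (4 * ρ₀) + 5 * m ^ 3 * s ^ 2 * k * d / (16 * ρ₀ * ε₁))
    * ((3 : ℝ) ^ (3 / 2 : ℝ) / ρ₀ ^ (3 / 2 : ℝ))

/-- The constant `c₃`. -/
def c₃ (a k m s vol ρ₀ d ε₁ ε₂ : ℝ) : ℝ :=
  (d / ρ₀ + 1) ^ (3 / 2 : ℝ) * (1 / (4 * ε₂ ^ 3)) *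
    (2 * √2 * a * s * vol + 3 * √2 * m ^ 2 * s * k / (2 * ρ₀)
      + 5 * √2 * m ^ 3 * s ^ 2 * k * d / (8 * ρ₀ * ε₁))

/-- The constant `c₄`. -/
def c₄ (a c k m s vol ρ₀ d ε₁ ε₂ : ℝ) : ℝ :=
  (d / ρ₀ + 1) ^ (3 / 2 : ℝ) * ε₂ *
    (3 / 2 * √2 * a * s * vol + 9 * √2 * m ^ 2 * s * k / (8 * ρ₀)
      + 15 * √2 * m ^ 3 * s ^ 2 * k * d / (32 * ε₁ * ρ₀))
    + 5 * m * d * k * ε₁ / (2 * ρ₀) - c / (m * s)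

/-- The constant `ε₃`. -/
def ε₃ (a b k m q s vol ρ₀ d ε₁ : ℝ) : ℝ :=
  (b / (3 * c₂ a k m s vol ρ₀ d ε₁) * (4 * m * s - 2 * q + 2) * vol ^ ((1 - q) / (m * s)))
    ^ (3 * m * s / (4 * m * s - 2 * q + 2))

/-- The constant `c₅`. -/
def c₅ (a b k m q s vol ρ₀ d ε₁ ε₂ : ℝ) : ℝ :=
  c₂ a k m s vol ρ₀ d ε₁ * ((m * s - 2 * q + 2) / (4 * m * s - 2 * q + 2))
      * ε₃ a b k m q s vol ρ₀ d ε₁ ^ (-((4 * m * s - 2 * q + 2) / (m * s - 2 * q + 2)))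
    + c₃ a k m s vol ρ₀ d ε₁ ε₂

end

end PorousMedium

/-! Write r = ms, φ(t) = ∫ u^r, X = ∫ u^{3r/2}, and let D = ∫ |∇u^{r/2}|² be the Dirichlet integral.
The theorem follows from the differential inequality φ' ≤ c₁φ + c₅φ³. It is of Bernoulli type, so
(φ⁻² + c₅/c₁)e^{2c₁t} is nondecreasing; at blow-up φ⁻² → 0, and solving for the time gives the bound
(`bernoulli_le`, `bernoulli_lower_bound`).

To get it, test the equation with r u^{r-1}. Diffusion contributes a term of good sign, which is
dropped, and a boundary flux. By the choice of β the flux is at most a multiple of ∫_{∂Ω} u^{5r/4}.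
The divergence theorem for w(x - x₀) gives ρ₀∫_{∂Ω} w ≤ 3∫w + d∫|∇w|, which moves the flux inside;
AM-GM, and Young with ε₁, then leave φ, X and D. The nonlocal source is bounded by φ and X through
Chebyshev's inequality and interpolation. A Payne-Schaefer inequality (`integral_rpow_le_payne`,
then `setIntegral_rpow_le_sobolev`) bounds X by φ^{3/2}, φ³ and a multiple of ε₂D. The total
coefficient of D is c₄ ≤ 0. Jensen applied to the absorption term -b u^q produces a negative power
of φ that swallows φ^{3/2} up to a cubic remainder (`young_absorb`). All this is assembled in
`IsAdmissibleDomain.exists_energy_estimate`.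

A classical solution is only C¹ in space up to the boundary, and its time derivative is not
controlled there, so no surface integral is ever taken. Instead the energy carries a cutoff η with
∇η concentrated near ∂Ω and antiparallel to the normal of a nearby boundary point; ∫ |∇η| w plays
the part of ∫_{∂Ω} w. Such η are functions of the gauge of Ω about x₀: its gradient is normal to the
boundary, and Euler's relation together with ρ₀ gives the radial comparison needed for the
divergence theorem (`IsAdmissibleDomain.exists_gauge`, `IsAdmissibleDomain.exists_cutoff`). The
errors are uniform on [0,τ] with τ < t*, and they vanish as the cutoffs tend to 1
(`IsClassicalSolution.energy_le`). -/

namespace PorousMedium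

noncomputable section

/-! ### Differentiability of the gauge of a star-shaped set -/

section Gauge

variable {E : Type*} [NormedAddCommGroup E] [InnerProductSpace ℝ E] {S : Set E}

theorem gauge_lt_one_iff_of_starConvex (ho : IsOpen S) (h0 : (0 : E) ∈ S)
    (hs : StarConvex ℝ 0 S) {x : E} : gauge S x < 1 ↔ x ∈ S := by
  refine ⟨fun h => ?_, gauge_lt_one_of_mem_of_isOpen ho⟩
  obtain ⟨b, hb0, hb1, y, hy, rfl⟩ := exists_lt_of_gauge_lt (absorbent_nhds_zero (ho.mem_nhds h0)) h
  exact hs.smul_mem hy hb0.le hb1.le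

theorem inv_smul_mem_iff_gauge_lt (ho : IsOpen S) (h0 : (0 : E) ∈ S)
    (hs : StarConvex ℝ 0 S) {x : E} {r : ℝ} (hr : 0 < r) : r⁻¹ • x ∈ S ↔ gauge S x < r := by
  rw [← gauge_lt_one_iff_of_starConvex ho h0 hs, gauge_smul_of_nonneg (inv_nonneg.2 hr.le),
    smul_eq_mul, inv_mul_lt_iff₀ hr, mul_one]

/-- The points r⁻¹y with r ↓ 1 have gauge below 1, hence lie in S and converge to y; y itself is
excluded since its gauge is not below 1. -/
theorem mem_frontier_of_gauge_eq_one_of_starConvex (ho : IsOpen S) (h0 : (0 : E) ∈ S)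
    (hs : StarConvex ℝ 0 S) {y : E} (hy : gauge S y = 1) : y ∈ frontier S := by
  rw [ho.frontier_eq]
  refine ⟨?_, fun h => ?_⟩
  · have ht : Tendsto (fun r : ℝ => r⁻¹ • y) (𝓝[>] 1) (𝓝 y) := by
      have : ContinuousAt (fun r : ℝ => r⁻¹ • y) 1 := by fun_prop (disch := norm_num)
      simpa using this.tendsto.mono_left nhdsWithin_le_nhds
    refine mem_closure_of_tendsto ht ?_
    filter_upwards [self_mem_nhdsWithin] with r hr
    have hr : 1 < r := hr
    rw [inv_smul_mem_iff_gauge_lt ho h0 hs (by linarith), hy]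
    exact hr
  · rw [← gauge_lt_one_iff_of_starConvex ho h0 hs] at h
    linarith

variable [CompleteSpace E]

/-- The sublevel sets of the gauge are dilates of S, so the gauge of x is below r exactly when
ψ(r⁻¹x) < 0 (for x near y and r near 1). Testing r = 1 + ⟪n, x - y⟫ ± ε‖x - y‖ with n = w/⟪w, y⟫
traps the gauge between two values, which is the little-o estimate; no implicit function theorem is
needed. -/
theorem hasGradientAt_gauge (ho : IsOpen S) (h0 : (0 : E) ∈ S) (hs : StarConvex ℝ 0 S)
    {y w : E} {ψ : E → ℝ} (hy : gauge S y = 1) (hψ : HasGradientAt ψ w y)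
    (hS : ∀ᶠ z in 𝓝 y, (z ∈ S ↔ ψ z < 0)) (hw : 0 < ⟪w, y⟫_ℝ) :
    HasGradientAt (gauge S) ((⟪w, y⟫_ℝ)⁻¹ • w) y := by
  have hfr := mem_frontier_of_gauge_eq_one_of_starConvex ho h0 hs hy
  have hψy : ψ y = 0 := by
    rw [ho.frontier_eq] at hfr
    refine le_antisymm ?_ (not_lt.1 fun h => hfr.2 (hS.self_of_nhds.2 h))
    by_contra! hpos
    have h1 : ∀ᶠ z in 𝓝 y, 0 < ψ z := hψ.continuousAt.eventually (lt_mem_nhds hpos)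
    obtain ⟨z, hz, hzS⟩ := mem_closure_iff_frequently.1 hfr.1 |>.and_eventually (h1.and hS) |>.exists
    exact absurd (hzS.2.1 hz) (not_lt.2 hzS.1.le)
  have hn : ⟪(⟪w, y⟫_ℝ)⁻¹ • w, y⟫_ℝ = 1 := by
    rw [real_inner_smul_left, inv_mul_cancel₀ hw.ne']
  set n := (⟪w, y⟫_ℝ)⁻¹ • w with hndef
  have hwn : ∀ z, ⟪w, z⟫_ℝ = ⟪w, y⟫_ℝ * ⟪n, z⟫_ℝ := fun z => by
    rw [hndef, real_inner_smul_left, mul_inv_cancel_left₀ hw.ne']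
  rw [hasGradientAt_iff_isLittleO] at hψ ⊢
  rw [Asymptotics.isLittleO_iff] at hψ ⊢
  intro ε hε
  have key : ∀ e : ℝ, e ≠ 0 → ∀ᶠ x in 𝓝 y, x ≠ y →
      0 < 1 + ⟪n, x - y⟫_ℝ + e * ‖x - y‖ ∧
      ((1 + ⟪n, x - y⟫_ℝ + e * ‖x - y‖)⁻¹ • x ∈ S ↔ 0 < e) := by
    intro e he
    set r : E → ℝ := fun x => 1 + ⟪n, x - y⟫_ℝ + e * ‖x - y‖ with hr
    have hrc : Continuous r := by fun_prop
    have hry : r y = 1 := by simp [hr]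
    have hr0 : ∀ᶠ x in 𝓝 y, 0 < r x := by
      have := hrc.continuousAt.eventually (lt_mem_nhds (show (0 : ℝ) < r y by rw [hry]; norm_num))
      exact this
    have hzt : Tendsto (fun x => (r x)⁻¹ • x) (𝓝 y) (𝓝 y) := by
      have : ContinuousAt (fun x => (r x)⁻¹ • x) y :=
        (hrc.continuousAt.inv₀ (by rw [hry]; norm_num)).smul continuousAt_id
      simpa [hry] using this.tendsto
    set C := 1 + (‖n‖ + |e|) * ‖y‖ with hC
    have hCpos : 0 < C := by positivity
    -- This tolerance in the expansion of ψ makes its error at most half of the main term, so the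
    -- sign of ψ at r⁻¹x is opposite to that of e.
    have hc : 0 < |e| * ⟪w, y⟫_ℝ / (2 * C) := by positivity
    filter_upwards [hr0, hzt.eventually (hψ hc), hzt.eventually hS] with x hx0 hxψ hxS hxy
    refine ⟨hx0, hxS.trans ?_⟩
    have hpos : 0 < ‖x - y‖ := norm_pos_iff.2 (sub_ne_zero.2 hxy)
    have hdiff : (r x)⁻¹ • x - y
        = (r x)⁻¹ • ((x - y) - (⟪n, x - y⟫_ℝ + e * ‖x - y‖) • y) := by
      rw [smul_sub, smul_sub, smul_smul]
      have : (r x)⁻¹ * (⟪n, x - y⟫_ℝ + e * ‖x - y‖) = 1 - (r x)⁻¹ := by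
        field_simp; simp only [hr]; ring
      rw [this, sub_smul, one_smul]; abel
    have hin : ⟪w, (r x)⁻¹ • x - y⟫_ℝ = -((r x)⁻¹ * ⟪w, y⟫_ℝ * e * ‖x - y‖) := by
      rw [hdiff, real_inner_smul_right, inner_sub_right, real_inner_smul_right, hwn (x - y)]
      ring
    have hnorm : ‖(r x)⁻¹ • x - y‖ ≤ (r x)⁻¹ * (C * ‖x - y‖) := by
      rw [hdiff, norm_smul, Real.norm_of_nonneg (inv_nonneg.2 hx0.le)]
      refine mul_le_mul_of_nonneg_left ?_ (inv_nonneg.2 hx0.le)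
      have h1 := abs_real_inner_le_norm n (x - y)
      calc ‖(x - y) - (⟪n, x - y⟫_ℝ + e * ‖x - y‖) • y‖
          ≤ ‖x - y‖ + |⟪n, x - y⟫_ℝ + e * ‖x - y‖| * ‖y‖ := by
            refine (norm_sub_le _ _).trans ?_
            rw [norm_smul, Real.norm_eq_abs]
        _ ≤ ‖x - y‖ + (‖n‖ * ‖x - y‖ + |e| * ‖x - y‖) * ‖y‖ := by
            gcongr
            refine (abs_add_le _ _).trans ?_
            rw [abs_mul, abs_norm]
            gcongr
        _ = C * ‖x - y‖ := by rw [hC]; ring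
    have hest : |ψ ((r x)⁻¹ • x) + (r x)⁻¹ * ⟪w, y⟫_ℝ * e * ‖x - y‖|
        ≤ (r x)⁻¹ * ⟪w, y⟫_ℝ * |e| * ‖x - y‖ / 2 := by
      have := hxψ
      rw [hψy, hin, sub_zero, sub_neg_eq_add, Real.norm_eq_abs] at this
      refine this.trans ((mul_le_mul_of_nonneg_left hnorm hc.le).trans (le_of_eq ?_))
      field_simp
    have hp : 0 < (r x)⁻¹ * ⟪w, y⟫_ℝ * ‖x - y‖ := by positivity
    rw [abs_le] at hest
    constructor
    · intro hneg
      by_contra! hle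
      have hlt : e < 0 := lt_of_le_of_ne hle he
      rw [abs_of_neg hlt] at hest
      nlinarith [hest.1, mul_pos hp (neg_pos.2 hlt)]
    · intro hlt
      rw [abs_of_pos hlt] at hest
      nlinarith [hest.2, mul_pos hp hlt]
  filter_upwards [key ε hε.ne', key (-ε) (neg_ne_zero.2 hε.ne')] with x h1 h2
  rcases eq_or_ne x y with rfl | hxy
  · simp
  obtain ⟨h1p, h1⟩ := h1 hxy
  obtain ⟨h2p, h2⟩ := h2 hxy
  rw [inv_smul_mem_iff_gauge_lt ho h0 hs h1p] at h1
  rw [inv_smul_mem_iff_gauge_lt ho h0 hs h2p] at h2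
  have h1' := h1.2 hε
  have h2' : ¬ _ := fun h => absurd (h2.1 h) (by linarith)
  rw [hy, Real.norm_eq_abs, abs_le]
  constructor <;> linarith

/-- A function homogeneous of degree 1 has a gradient homogeneous of degree 0: differentiate N = r
N(r⁻¹ ·). It transports gradients from the unit level set to the whole ray. -/
theorem hasGradientAt_of_homogeneous {N : E → ℝ}
    (hN : ∀ (r : ℝ) (x : E), 0 ≤ r → N (r • x) = r * N x) {x v : E} {r : ℝ} (hr : 0 < r)
    (h : HasGradientAt N v (r⁻¹ • x)) : HasGradientAt N v x := by
  rw [hasGradientAt_iff_hasFDerivAt] at h ⊢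
  have h1 : HasFDerivAt (fun z : E => r⁻¹ • z) (r⁻¹ • ContinuousLinearMap.id ℝ E) x :=
    (ContinuousLinearMap.id ℝ E).hasFDerivAt.const_smul r⁻¹
  have h2 := (h.comp x h1).const_mul r
  have e1 : (fun z => r * (N ∘ fun z : E => r⁻¹ • z) z) = N := by
    funext z
    simp only [Function.comp]
    rw [hN _ _ (inv_nonneg.2 hr.le), mul_inv_cancel_left₀ hr.ne']
  rw [e1] at h2
  refine h2.congr_fderiv ?_
  ext z
  simp [hr.ne']

/-- The gauge of a bounded open star-shaped set with smooth boundary, transversal to the radial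
direction, is continuously differentiable away from the origin. -/
theorem exists_gradient_gauge (ho : IsOpen S) (h0 : (0 : E) ∈ S) (hs : StarConvex ℝ 0 S)
    (hb : Bornology.IsBounded S)
    (H : ∀ y ∈ frontier S, ∃ ψ : E → ℝ, ContDiff ℝ ∞ ψ ∧ (∀ᶠ z in 𝓝 y, (z ∈ S ↔ ψ z < 0)) ∧
      0 < ⟪gradient ψ y, y⟫_ℝ) {x : E} (hx : x ≠ 0) :
    ContinuousAt (gradient (gauge S)) x ∧ ∃ ψ : E → ℝ, ContDiff ℝ ∞ ψ ∧
      (∀ᶠ z in 𝓝 ((gauge S x)⁻¹ • x), (z ∈ S ↔ ψ z < 0)) ∧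
      0 < ⟪gradient ψ ((gauge S x)⁻¹ • x), (gauge S x)⁻¹ • x⟫_ℝ ∧
      HasGradientAt (gauge S)
        ((⟪gradient ψ ((gauge S x)⁻¹ • x), (gauge S x)⁻¹ • x⟫_ℝ)⁻¹ •
          gradient ψ ((gauge S x)⁻¹ • x)) x := by
  have habs := absorbent_nhds_zero (𝕜 := ℝ) (ho.mem_nhds h0)
  have hvb := (NormedSpace.isVonNBounded_iff ℝ).2 hb
  have hpos : ∀ z : E, z ≠ 0 → 0 < gauge S z := fun z hz => (gauge_pos habs hvb).2 hz
  have hhom : ∀ (r : ℝ) (z : E), 0 ≤ r → gauge S (r • z) = r * gauge S z := fun r z hr => by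
    rw [gauge_smul_of_nonneg hr, smul_eq_mul]
  have hone : ∀ z : E, z ≠ 0 → gauge S ((gauge S z)⁻¹ • z) = 1 := fun z hz => by
    rw [hhom _ _ (inv_nonneg.2 (hpos z hz).le), inv_mul_cancel₀ (hpos z hz).ne']
  obtain ⟨ψ, hψ, hψS, hψp⟩ := H _ (mem_frontier_of_gauge_eq_one_of_starConvex ho h0 hs (hone x hx))
  have hdiff : ∀ z, HasGradientAt ψ (gradient ψ z) z := fun z =>
    (hψ.differentiable (by simp) z).hasGradientAt
  have hgc : Continuous (gradient ψ) := by
    have : gradient ψ = fun z => (InnerProductSpace.toDual ℝ E).symm (fderiv ℝ ψ z) := rfl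
    rw [this]
    exact (InnerProductSpace.toDual ℝ E).symm.continuous.comp (hψ.continuous_fderiv (by simp))
  set G : E → E := fun z => (⟪gradient ψ z, z⟫_ℝ)⁻¹ • gradient ψ z with hG
  -- Stated for all z with ψ fixed: one defining function serves every point near x, so the gradient
  -- is locally given by the continuous formula G.
  have hbase : ∀ z : E, z ≠ 0 → (∀ᶠ z' in 𝓝 ((gauge S z)⁻¹ • z), (z' ∈ S ↔ ψ z' < 0)) →
      0 < ⟪gradient ψ ((gauge S z)⁻¹ • z), (gauge S z)⁻¹ • z⟫_ℝ →
      HasGradientAt (gauge S) (G ((gauge S z)⁻¹ • z)) z := fun z hz h1 h2 =>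
    hasGradientAt_of_homogeneous hhom (hpos z hz)
      (hasGradientAt_gauge ho h0 hs (hone z hz) (hdiff _) h1 h2)
  have hmain := hbase x hx hψS hψp
  refine ⟨?_, ψ, hψ, hψS, hψp, hmain⟩
  have hpt : ContinuousAt (fun z => (gauge S z)⁻¹ • z) x :=
    (hmain.continuousAt.inv₀ (hpos x hx).ne').smul continuousAt_id
  have hGc : ContinuousAt (fun z => G ((gauge S z)⁻¹ • z)) x := by
    have : ContinuousAt G ((gauge S x)⁻¹ • x) :=
      ((hgc.inner continuous_id).continuousAt.inv₀ hψp.ne').smul hgc.continuousAt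
    exact ContinuousAt.comp (f := fun z => (gauge S z)⁻¹ • z) this hpt
  refine hGc.congr ?_
  have hposc : ∀ᶠ z in 𝓝 ((gauge S x)⁻¹ • x), 0 < ⟪gradient ψ z, z⟫_ℝ :=
    (hgc.inner continuous_id).continuousAt.eventually (lt_mem_nhds hψp)
  filter_upwards [isOpen_ne.mem_nhds hx, hpt.eventually hψS.eventually_nhds,
    hpt.eventually hposc] with z hz h1 h2
  exact (hbase z hz h1 h2).gradient.symm

end Gauge

end

end PorousMedium

/-! ### Gauge and boundary cutoffs of an admissible domain -/

namespace PorousMedium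

noncomputable section

variable {Ω : Set E3} {x₀ : E3} {ρ₀ d : ℝ}

/-- The inequality ρ₀ ≤ (x - x₀)·ν cleared of the normalisation. It says that rays from x₀ cross the
boundary transversally, which makes the gauge differentiable and bounds its gradient by 1/ρ₀. -/
theorem IsAdmissibleDomain.rho_mul_norm_le (hΩ : IsAdmissibleDomain Ω x₀ ρ₀ d) {x : E3}
    {ψ : E3 → ℝ} (hx : x ∈ frontier Ω) (hψ : IsLocalDefiningFunction Ω x ψ) :
    ρ₀ * ‖gradient ψ x‖ ≤ ⟪gradient ψ x, x - x₀⟫_ℝ := by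
  have h := hΩ.isLeast_rho.2 ⟨x, _, ⟨hx, ψ, hψ, rfl⟩, rfl⟩
  have hp : 0 < ‖gradient ψ x‖ := norm_pos_iff.2 hψ.gradient_ne_zero
  rw [real_inner_smul_right, real_inner_comm, ← div_eq_inv_mul, le_div_iff₀ hp] at h
  exact h

theorem gradient_comp_const_add (ψ : E3 → ℝ) (v y : E3) :
    gradient (fun z => ψ (v + z)) y = gradient ψ (v + y) := by
  simp only [gradient, fderiv_comp_add_left]

/-- The gauge of an admissible domain with respect to its center. -/
theorem IsAdmissibleDomain.exists_gauge (hΩ : IsAdmissibleDomain Ω x₀ ρ₀ d) :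
    ∃ (N : E3 → ℝ) (DN : E3 → E3), Continuous N ∧ N x₀ = 0 ∧ (∀ x, N x < 1 ↔ x ∈ Ω) ∧
      ∀ x, x ≠ x₀ → 0 < N x ∧ HasGradientAt N (DN x) x ∧ ContDiffAt ℝ 1 N x ∧
        ⟪DN x, x - x₀⟫_ℝ = N x ∧ ρ₀ * ‖DN x‖ ≤ 1 ∧
        IsOuterUnitNormal Ω (x₀ + (N x)⁻¹ • (x - x₀)) (‖DN x‖⁻¹ • DN x) := by
  set S : Set E3 := (fun y => x₀ + y) ⁻¹' Ω with hS
  have ho : IsOpen S := hΩ.isOpen.preimage (by fun_prop)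
  have h0 : (0 : E3) ∈ S := by simpa [hS] using hΩ.mem
  have hs : StarConvex ℝ 0 S := by
    intro y hy a b ha hb hab
    have := hΩ.starConvex hy ha hb hab
    simp only [hS, mem_preimage]
    convert this using 1
    rw [smul_add, ← add_assoc (a • x₀), ← add_smul, hab, one_smul, smul_zero, zero_add]
  have hb : Bornology.IsBounded S := by
    have : S = (fun y => y - x₀) '' Ω := by
      ext y
      constructor
      · intro h
        exact ⟨x₀ + y, h, by simp⟩
      · rintro ⟨z, hz, rfl⟩
        simpa [hS] using hz
    rw [this]
    exact (IsometryEquiv.subRight x₀).isometry.lipschitz.isBounded_image hΩ.isBounded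
  have hfr : ∀ y, y ∈ frontier S ↔ x₀ + y ∈ frontier Ω := fun y => by
    have := (Homeomorph.addLeft x₀).preimage_frontier Ω
    have h2 : (Homeomorph.addLeft x₀) ⁻¹' Ω = S := rfl
    rw [h2] at this
    rw [← this]; rfl
  have htrans : ∀ y : E3, Tendsto (fun z => x₀ + z) (𝓝 y) (𝓝 (x₀ + y)) := fun y =>
    (by fun_prop : Continuous fun z : E3 => x₀ + z).tendsto y
  have htrans' : ∀ y : E3, Tendsto (fun z => -x₀ + z) (𝓝 (x₀ + y)) (𝓝 y) := fun y => by
    have := (by fun_prop : Continuous fun z : E3 => -x₀ + z).tendsto (x₀ + y)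
    simpa using this
  have H : ∀ y ∈ frontier S, ∃ ψ : E3 → ℝ, ContDiff ℝ ∞ ψ ∧ (∀ᶠ z in 𝓝 y, (z ∈ S ↔ ψ z < 0)) ∧
      0 < ⟪gradient ψ y, y⟫_ℝ := by
    intro y hy
    have hy' := (hfr y).1 hy
    obtain ⟨ψ, hψ⟩ := hΩ.smoothBoundary _ hy'
    refine ⟨fun z => ψ (x₀ + z), hψ.contDiff.comp (by fun_prop),
      (htrans y).eventually hψ.eventually_mem_iff, ?_⟩
    rw [gradient_comp_const_add]
    have := hΩ.rho_mul_norm_le hy' hψ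
    rw [add_sub_cancel_left] at this
    exact (mul_pos hΩ.rho_pos (norm_pos_iff.2 hψ.gradient_ne_zero)).trans_le this
  have habs := absorbent_nhds_zero (𝕜 := ℝ) (ho.mem_nhds h0)
  have hvb := (NormedSpace.isVonNBounded_iff ℝ).2 hb
  have hpos : ∀ z : E3, z ≠ 0 → 0 < gauge S z := fun z hz => (gauge_pos habs hvb).2 hz
  have hgrad : ∀ x, x - x₀ ≠ 0 → HasGradientAt (fun z => gauge S (z - x₀))
      (gradient (gauge S) (x - x₀)) x := by
    intro x hx
    obtain ⟨-, ψ, -, -, -, hg⟩ := exists_gradient_gauge ho h0 hs hb H hx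
    rw [hg.gradient, hasGradientAt_iff_hasFDerivAt]
    exact hg.hasFDerivAt.comp x ((hasFDerivAt_id x).sub_const x₀)
  refine ⟨fun x => gauge S (x - x₀), fun x => gradient (gauge S) (x - x₀), ?_, by simp, ?_, ?_⟩
  · rw [continuous_iff_continuousAt]
    intro x
    by_cases hx : x - x₀ = 0
    · refine ContinuousAt.comp (g := gauge S) (f := fun x => x - x₀) (x := x) ?_ (by fun_prop)
      rw [hx]
      exact continuousAt_gauge_zero (ho.mem_nhds h0)
    · exact (hgrad x hx).continuousAt
  · intro x
    rw [gauge_lt_one_iff_of_starConvex ho h0 hs]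
    simp [hS]
  · intro x hx
    have hx' : x - x₀ ≠ 0 := sub_ne_zero.2 hx
    obtain ⟨-, ψ, hψ, hψS, hp, hg⟩ := exists_gradient_gauge ho h0 hs hb H hx'
    have hNp := hpos _ hx'
    set r := gauge S (x - x₀) with hr
    set y := r⁻¹ • (x - x₀) with hy
    have hyS : x₀ + y ∈ frontier Ω := (hfr y).1
      (mem_frontier_of_gauge_eq_one_of_starConvex ho h0 hs (by
        rw [hy, gauge_smul_of_nonneg (inv_nonneg.2 hNp.le), smul_eq_mul, ← hr,
          inv_mul_cancel₀ hNp.ne']))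
    have hwne : gradient ψ y ≠ 0 := fun h => by simp [h] at hp
    have hgr : gradient (fun z => ψ (-x₀ + z)) (x₀ + y) = gradient ψ y := by
      rw [gradient_comp_const_add]; simp
    have hloc : IsLocalDefiningFunction Ω (x₀ + y) (fun z => ψ (-x₀ + z)) := by
      refine ⟨hψ.comp (by fun_prop), by rwa [hgr], ?_⟩
      filter_upwards [(htrans' y).eventually hψS] with z hz
      rw [← hz]; simp [hS]
    have hρ := hΩ.rho_mul_norm_le hyS hloc
    rw [hgr, add_sub_cancel_left] at hρ
    have hDN : gradient (gauge S) (x - x₀) = (⟪gradient ψ y, y⟫_ℝ)⁻¹ • gradient ψ y := hg.gradient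
    have hnorm : ‖gradient (gauge S) (x - x₀)‖ = (⟪gradient ψ y, y⟫_ℝ)⁻¹ * ‖gradient ψ y‖ := by
      rw [hDN, norm_smul, Real.norm_of_nonneg (inv_nonneg.2 hp.le)]
    refine ⟨hNp, hgrad x hx', ?_, ?_, ?_, ?_⟩
    · rw [contDiffAt_one_iff]
      refine ⟨fun z => InnerProductSpace.toDual ℝ E3 (gradient (gauge S) (z - x₀)), {x₀}ᶜ,
        isOpen_compl_singleton.mem_nhds hx, ?_, fun z hz =>
          (hgrad z (sub_ne_zero.2 hz)).hasFDerivAt⟩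
      refine (InnerProductSpace.toDual ℝ E3).continuous.comp_continuousOn fun z hz => ?_
      have hc := (exists_gradient_gauge ho h0 hs hb H (sub_ne_zero.2 hz)).1
      exact (ContinuousAt.comp (f := fun z => z - x₀) hc (by fun_prop)).continuousWithinAt
    -- Euler's relation for the 1-homogeneous gauge, read off from the explicit gradient.
    · have : x - x₀ = r • y := by rw [hy, smul_inv_smul₀ hNp.ne']
      have e : ⟪gradient ψ y, x - x₀⟫_ℝ = r * ⟪gradient ψ y, y⟫_ℝ := by
        rw [← real_inner_smul_right, ← this]
      simp only
      rw [hDN, ← hr, real_inner_smul_left, e, mul_left_comm, inv_mul_cancel₀ hp.ne', mul_one]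
    · rw [hnorm, mul_left_comm, ← div_eq_inv_mul, div_le_one hp]
      exact hρ
    · refine ⟨hyS, _, hloc, ?_⟩
      simp only
      rw [hgr, hnorm, hDN, smul_smul, mul_inv, inv_inv]
      congr 1
      field_simp

/-- A smooth cutoff function of the domain whose gradient is supported near the boundary, is almost
normal to it, and is controlled by its radial component. -/
structure IsBoundaryCutoff (Ω : Set E3) (x₀ : E3) (ρ₀ δ : ℝ) (η : E3 → ℝ) : Prop where
  contDiff : ContDiff ℝ 1 η
  hasCompactSupport : HasCompactSupport η
  tsupport_subset : tsupport η ⊆ Ω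
  nonneg : ∀ x, 0 ≤ η x
  le_one : ∀ x, η x ≤ 1
  exists_normal : ∀ x, gradient η x ≠ 0 → ∃ y ν, IsOuterUnitNormal Ω y ν ∧ ‖x - y‖ ≤ δ ∧
    gradient η x = -(‖gradient η x‖ • ν)
  norm_gradient_le : ∀ x, ρ₀ * ‖gradient η x‖ ≤ (1 + δ) * -⟪gradient η x, x - x₀⟫_ℝ

theorem IsBoundaryCutoff.mono {δ δ' : ℝ} {η : E3 → ℝ} (hρ : 0 < ρ₀) (hδ : 0 ≤ δ)
    (h : IsBoundaryCutoff Ω x₀ ρ₀ δ η) (hle : δ ≤ δ') : IsBoundaryCutoff Ω x₀ ρ₀ δ' η where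
  __ := h
  exists_normal x hx := by
    obtain ⟨y, ν, h1, h2, h3⟩ := h.exists_normal x hx
    exact ⟨y, ν, h1, h2.trans hle, h3⟩
  norm_gradient_le x := by
    have h1 := h.norm_gradient_le x
    have h2 : 0 ≤ ρ₀ * ‖gradient η x‖ := by positivity
    -- The sign of the radial component is forced by the inequality itself, since its left side is
    -- nonnegative and 1 + δ > 0.
    have h3 : 0 ≤ -⟪gradient η x, x - x₀⟫_ℝ := by
      by_contra! hneg
      nlinarith
    nlinarith

theorem IsAdmissibleDomain.norm_sub_le (hΩ : IsAdmissibleDomain Ω x₀ ρ₀ d) {x : E3}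
    (hx : x ∈ closure Ω) : ‖x - x₀‖ ≤ d :=
  hΩ.isGreatest_d.2 ⟨x, hx, rfl⟩

theorem IsAdmissibleDomain.d_nonneg (hΩ : IsAdmissibleDomain Ω x₀ ρ₀ d) : 0 ≤ d :=
  (norm_nonneg _).trans (hΩ.norm_sub_le (subset_closure hΩ.mem))

/-- Take η = χ(N) with N the gauge and χ falling from 1 at 1 - 2ε to 0 at 1 - ε. Then ∇η = χ'(N)∇N
is a nonpositive multiple of the normal at the radial projection of x, which is at distance at most
2εd from x. Euler's relation and ρ₀‖∇N‖ ≤ 1 give the radial comparison. -/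
theorem IsAdmissibleDomain.exists_family (hΩ : IsAdmissibleDomain Ω x₀ ρ₀ d) :
    ∃ η : ℝ → E3 → ℝ, (∀ ε, 0 < ε → ε ≤ 1 / 4 →
        IsBoundaryCutoff Ω x₀ ρ₀ (max (4 * ε) (2 * d * ε)) (η ε)) ∧
      ∀ x ∈ Ω, ∀ᶠ ε in 𝓝[>] 0, η ε x = 1 := by
  obtain ⟨N, DN, hNc, hN0, hN1, hN⟩ := hΩ.exists_gauge
  have hNnn : ∀ x, 0 ≤ N x := fun x => by
    rcases eq_or_ne x x₀ with rfl | hx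
    · exact hN0.ge
    · exact (hN x hx).1.le
  set χ : ℝ → ℝ → ℝ := fun ε r => Real.smoothTransition ((1 - r) / ε - 1) with hχ
  have hχs : ∀ ε, ContDiff ℝ 1 (χ ε) := fun ε =>
    Real.smoothTransition.contDiff.comp (by fun_prop)
  have hχone : ∀ ε r, 0 < ε → r ≤ 1 - 2 * ε → χ ε r = 1 := fun ε r hε hr => by
    apply Real.smoothTransition.one_of_one_le
    rw [le_sub_iff_add_le, le_div_iff₀ hε]; linarith
  have hχzero : ∀ ε r, 0 < ε → 1 - ε ≤ r → χ ε r = 0 := fun ε r hε hr => by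
    apply Real.smoothTransition.zero_of_nonpos
    rw [sub_nonpos, div_le_one hε]; linarith
  have hχanti : ∀ ε, 0 < ε → Antitone (χ ε) := fun ε hε r s hrs => by
    apply Real.smoothTransition.monotone
    gcongr
  refine ⟨fun ε x => χ ε (N x), fun ε hε hε4 => ?_, fun x hx => ?_⟩
  swap
  · have hlt := (hN1 x).2 hx
    filter_upwards [Ioo_mem_nhdsGT (show (0 : ℝ) < (1 - N x) / 2 by linarith)] with ε hε
    exact hχone _ _ hε.1 (by linarith [hε.2])
  have hgr : ∀ x, x ≠ x₀ →
      HasGradientAt (fun x => χ ε (N x)) (deriv (χ ε) (N x) • DN x) x := by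
    intro x hx
    have h1 := ((hχs ε).differentiable one_ne_zero (N x)).hasDerivAt
    have h2 := h1.comp_hasFDerivAt x (hN x hx).2.1.hasFDerivAt
    rw [hasGradientAt_iff_hasFDerivAt, map_smul]
    exact h2
  have hnear : (fun x => χ ε (N x)) =ᶠ[𝓝 x₀] fun _ => 1 := by
    filter_upwards [hNc.continuousAt.eventually (gt_mem_nhds (show N x₀ < 1 - 2 * ε by
      rw [hN0]; linarith))] with x hx
    exact hχone _ _ hε (le_of_lt hx)
  have hgr0 : gradient (fun x => χ ε (N x)) x₀ = 0 := by
    rw [hnear.gradient_eq]; simp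
  have hk : ∀ r, deriv (χ ε) r ≤ 0 := fun r => (hχanti ε hε).deriv_nonpos
  have hk0 : ∀ r, deriv (χ ε) r ≠ 0 → 1 - 2 * ε ≤ r ∧ r ≤ 1 - ε := by
    intro r hr
    constructor
    · by_contra! hlt
      apply hr
      have : χ ε =ᶠ[𝓝 r] fun _ => 1 := by
        filter_upwards [gt_mem_nhds hlt] with s hs using hχone _ _ hε hs.le
      rw [this.deriv_eq]; simp
    · by_contra! hlt
      apply hr
      have : χ ε =ᶠ[𝓝 r] fun _ => 0 := by
        filter_upwards [lt_mem_nhds hlt] with s hs using hχzero _ _ hε hs.le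
      rw [this.deriv_eq]; simp
  have hsub : tsupport (fun x => χ ε (N x)) ⊆ {x | N x ≤ 1 - ε} := by
    refine closure_minimal (fun x hx => ?_) (isClosed_le hNc continuous_const)
    by_contra! hlt
    exact hx (hχzero _ _ hε (not_le.1 hlt).le)
  have hsubΩ : tsupport (fun x => χ ε (N x)) ⊆ Ω := fun x hx =>
    (hN1 x).1 (by have : N x ≤ 1 - ε := hsub hx; linarith)
  refine ⟨?_, ?_, hsubΩ, fun x => Real.smoothTransition.nonneg _,
    fun x => Real.smoothTransition.le_one _, ?_, ?_⟩
  · rw [contDiff_iff_contDiffAt]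
    intro x
    rcases eq_or_ne x x₀ with rfl | hx
    · exact contDiffAt_const.congr_of_eventuallyEq hnear
    · exact (hχs ε).contDiffAt.comp x (hN x hx).2.2.1
  · exact Metric.isCompact_of_isClosed_isBounded (isClosed_tsupport _)
      (hΩ.isBounded.subset hsubΩ)
  · intro x hx
    have hxne : x ≠ x₀ := fun h => hx (h ▸ hgr0)
    obtain ⟨hNp, -, -, hE, hρ, hν⟩ := hN x hxne
    rw [(hgr x hxne).gradient] at hx ⊢
    have hk1 : deriv (χ ε) (N x) ≠ 0 := fun h => hx (by rw [h, zero_smul])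
    obtain ⟨hlo, hhi⟩ := hk0 _ hk1
    refine ⟨_, _, hν, ?_, ?_⟩
    · have hd := hΩ.norm_sub_le (frontier_subset_closure hν.1)
      rw [add_sub_cancel_left] at hd
      have : x - (x₀ + (N x)⁻¹ • (x - x₀)) = (N x - 1) • ((N x)⁻¹ • (x - x₀)) := by
        rw [sub_smul, one_smul, smul_inv_smul₀ hNp.ne']; abel
      rw [this, norm_smul, Real.norm_eq_abs, abs_of_nonpos (by linarith)]
      refine le_trans ?_ (le_max_right _ _)
      have := hΩ.d_nonneg
      nlinarith [norm_nonneg ((N x)⁻¹ • (x - x₀))]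
    · have hDN : ‖DN x‖ ≠ 0 := by
        intro h
        rw [norm_eq_zero] at h
        rw [h, inner_zero_left] at hE
        exact hNp.ne hE
      rw [norm_smul, Real.norm_eq_abs, abs_of_nonpos (hk _), smul_smul, mul_assoc,
        mul_inv_cancel₀ hDN, mul_one, neg_smul, neg_neg]
  · intro x
    rcases eq_or_ne x x₀ with rfl | hx
    · rw [hgr0]; simp
    obtain ⟨hNp, -, -, hE, hρ, hν⟩ := hN x hx
    rw [(hgr x hx).gradient, norm_smul, real_inner_smul_left, hE, Real.norm_eq_abs,
      abs_of_nonpos (hk _)]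
    by_cases hk1 : deriv (χ ε) (N x) = 0
    · simp [hk1]
    have hlo := (hk0 _ hk1).1
    have hneg := neg_nonneg.2 (hk (N x))
    -- On the support of χ' one has N ≥ 1 - 2ε, and (1 + 4ε)(1 - 2ε) ≥ 1 precisely because ε ≤ 1/4;
    -- this fixes the entry 4ε of δ.
    have h1 : 1 ≤ (1 + max (4 * ε) (2 * d * ε)) * N x := by
      have h2 : (1 + 4 * ε) * (1 - 2 * ε) ≤ (1 + max (4 * ε) (2 * d * ε)) * N x := by
        gcongr
        · linarith
        · exact le_max_left _ _
      nlinarith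
    calc ρ₀ * (-deriv (χ ε) (N x) * ‖DN x‖) = -deriv (χ ε) (N x) * (ρ₀ * ‖DN x‖) := by ring
      _ ≤ -deriv (χ ε) (N x) * ((1 + max (4 * ε) (2 * d * ε)) * N x) := by
        exact mul_le_mul_of_nonneg_left (hρ.trans h1) hneg
      _ = _ := by ring

/-- There are boundary cutoffs arbitrarily close to the indicator function of the domain. -/
theorem IsAdmissibleDomain.exists_cutoff (hΩ : IsAdmissibleDomain Ω x₀ ρ₀ d) {δ : ℝ} (hδ : 0 < δ) :
    ∃ η : E3 → ℝ, IsBoundaryCutoff Ω x₀ ρ₀ δ η ∧ ∫ x in Ω, (1 - η x) ≤ δ := by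
  obtain ⟨η, hη, hη1⟩ := hΩ.exists_family
  have hfin : IsFiniteMeasure (volume.restrict Ω) :=
    ⟨by simpa using hΩ.isBounded.measure_lt_top⟩
  have hsmall : ∀ᶠ ε : ℝ in 𝓝[>] 0, 0 < ε ∧ ε ≤ 1 / 4 := by
    filter_upwards [Ioc_mem_nhdsGT (show (0 : ℝ) < 1 / 4 by norm_num)] with ε hε using hε
  have hlim : Tendsto (fun ε => ∫ x in Ω, (1 - η ε x)) (𝓝[>] 0) (𝓝 (∫ x in Ω, (0 : ℝ))) := by
    refine tendsto_integral_filter_of_dominated_convergence (fun _ => 1) ?_ ?_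
      (integrable_const _) ?_
    · filter_upwards [hsmall] with ε hε
      exact (continuous_const.sub (hη ε hε.1 hε.2).contDiff.continuous).aestronglyMeasurable
    · filter_upwards [hsmall] with ε hε
      refine Eventually.of_forall fun x => ?_
      have := (hη ε hε.1 hε.2).nonneg x
      have := (hη ε hε.1 hε.2).le_one x
      rw [Real.norm_eq_abs, abs_le]
      constructor <;> linarith
    · filter_upwards [ae_restrict_mem hΩ.isOpen.measurableSet] with x hx
      refine tendsto_const_nhds.congr' ?_
      filter_upwards [hη1 x hx] with ε hε
      rw [hε, sub_self]
  rw [integral_zero] at hlim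
  have hm : Tendsto (fun ε : ℝ => max (4 * ε) (2 * d * ε)) (𝓝[>] 0) (𝓝 0) := by
    have : Continuous fun ε : ℝ => max (4 * ε) (2 * d * ε) := by fun_prop
    simpa using (this.tendsto 0).mono_left nhdsWithin_le_nhds
  obtain ⟨ε, ⟨hε, hε4⟩, h1, h2⟩ := (hsmall.and ((hlim.eventually (gt_mem_nhds hδ)).and
    (hm.eventually (gt_mem_nhds hδ)))).exists
  exact ⟨η ε, (hη ε hε hε4).mono hΩ.rho_pos (by positivity) h2.le, h1.le⟩

end

end PorousMedium

/-! ### The Gagliardo-Nirenberg inequality in three dimensions -/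

namespace PorousMedium

noncomputable section

/-- The value v(x) is the integral of v' from the left and minus the integral from the right. Adding
both halves gains the factor 2 behind the Sobolev constant 1/2. -/
theorem two_mul_enorm_le_lintegral_deriv {v : ℝ → ℝ} (hv : ContDiff ℝ 1 v)
    (hc : HasCompactSupport v) (x : ℝ) : 2 * ‖v x‖ₑ ≤ ∫⁻ y, ‖deriv v y‖ₑ := by
  have h1 : ‖v x‖ₑ ≤ ∫⁻ y in Iic x, ‖deriv v y‖ₑ := by
    rw [← hc.integral_Iic_deriv_eq hv x]
    exact enorm_integral_le_lintegral_enorm _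
  have h2 : ‖v x‖ₑ ≤ ∫⁻ y in Ioi x, ‖deriv v y‖ₑ := by
    rw [← enorm_neg, ← hc.integral_Ioi_deriv_eq hv x]
    exact enorm_integral_le_lintegral_enorm _
  rw [two_mul, ← lintegral_add_compl _ (measurableSet_Iic (a := x)), compl_Iic]
  exact add_le_add h1 h2

open Finset in
/-- The Gagliardo-Nirenberg inequality `‖f‖_{3/2} ≤ (1/2) ‖∇f‖₁` in three dimensions. -/
theorem lintegral_rpow_le_lintegral_fderiv {f : E3 → ℝ} (hf : ContDiff ℝ 1 f)
    (hc : HasCompactSupport f) :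
    ∫⁻ x, ‖f x‖ₑ ^ (3 / 2 : ℝ) ≤ (2⁻¹ * ∫⁻ x, ‖fderiv ℝ f x‖ₑ) ^ (3 / 2 : ℝ) := by
  set e : (Fin 3 → ℝ) ≃L[ℝ] E3 := (EuclideanSpace.equiv (Fin 3) ℝ).symm with he
  have hme : MeasurePreserving e volume volume :=
    PiLp.volume_preserving_toLp (Fin 3)
  have hemb : MeasurableEmbedding e := e.toHomeomorph.measurableEmbedding
  rw [← hme.lintegral_comp_emb hemb, ← hme.lintegral_comp_emb hemb]
  have hderiv : ∀ (x : Fin 3 → ℝ) (i : Fin 3) (y : ℝ),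
      ‖deriv (fun s => f (e (Function.update x i s))) y‖ₑ
        ≤ ‖fderiv ℝ f (e (Function.update x i y))‖ₑ := by
    intro x i y
    have h1 := e.hasFDerivAt.comp_hasDerivAt y (hasDerivAt_update x i y)
    have h2 := ((hf.differentiable one_ne_zero) _).hasFDerivAt.comp_hasDerivAt y h1
    have h3 : deriv (fun s => f (e (Function.update x i s))) y
        = fderiv ℝ f (e (Function.update x i y)) (e (Pi.single i 1)) := h2.deriv
    rw [h3]
    refine (ContinuousLinearMap.le_opENorm _ _).trans ?_
    have : ‖e (Pi.single i 1)‖ₑ = 1 := by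
      have : e (Pi.single i (1 : ℝ)) = EuclideanSpace.single i (1 : ℝ) := rfl
      rw [this, ← ofReal_norm]; simp
    rw [this, mul_one]
  have hline : ∀ (x : Fin 3 → ℝ) (i : Fin 3),
      ‖f (e x)‖ₑ ≤ ∫⁻ y, 2⁻¹ * ‖fderiv ℝ f (e (Function.update x i y))‖ₑ := by
    intro x i
    rw [lintegral_const_mul' _ _ (by simp)]
    have hup : ContDiff ℝ 1 (fun s => f (e (Function.update x i s))) :=
      hf.comp (e.contDiff.comp (contDiff_update 1 x i))
    have hcs : HasCompactSupport (fun s => f (e (Function.update x i s))) :=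
      (hc.comp_homeomorph e.toHomeomorph).comp_isClosedEmbedding (isClosedEmbedding_update x i)
    have := two_mul_enorm_le_lintegral_deriv hup hcs (x i)
    rw [Function.update_eq_self] at this
    rw [← one_mul ‖f (e x)‖ₑ, ← ENNReal.inv_mul_cancel (a := 2) (by simp) (by simp), mul_assoc]
    gcongr
    exact this.trans (lintegral_mono fun y => hderiv x i y)
  have hconj : Real.HolderConjugate (#(univ : Finset (Fin 3))) (3 / 2 : ℝ) := by
    rw [Real.holderConjugate_iff]
    simp
    norm_num
  -- Split |f|^{3/2} into three factors |f|^{1/2} and bound each by the integral along one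
  -- coordinate line; the Loomis-Whitney type inequality for such products finishes.
  calc ∫⁻ x, ‖f (e x)‖ₑ ^ (3 / 2 : ℝ)
      = ∫⁻ x, ∏ _i : Fin 3, ‖f (e x)‖ₑ ^ (1 / (#(univ : Finset (Fin 3)) - 1 : ℝ)) := by
        congr! 2 with x
        rw [prod_const, ← ENNReal.rpow_natCast, ← ENNReal.rpow_mul]
        simp
        norm_num
    _ ≤ ∫⁻ x, ∏ i : Fin 3, (∫⁻ y, 2⁻¹ * ‖fderiv ℝ f (e (Function.update x i y))‖ₑ) ^
          (1 / (#(univ : Finset (Fin 3)) - 1 : ℝ)) := by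
        gcongr with x i
        · simp
        · exact hline x i
    _ ≤ (∫⁻ x, 2⁻¹ * ‖fderiv ℝ f (e x)‖ₑ) ^ (3 / 2 : ℝ) := by
        apply lintegral_prod_lintegral_pow_le _ hconj
        have : Continuous (fderiv ℝ f) := hf.continuous_fderiv one_ne_zero
        fun_prop
    _ = _ := by rw [lintegral_const_mul' _ _ (by simp)]

theorem norm_gradient_eq (f : E3 → ℝ) (x : E3) : ‖gradient f x‖ = ‖fderiv ℝ f x‖ := by
  simp [gradient]

theorem continuous_gradient {f : E3 → ℝ} (hf : ContDiff ℝ 1 f) : Continuous (gradient f) :=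
  (InnerProductSpace.toDual ℝ E3).symm.continuous.comp (hf.continuous_fderiv one_ne_zero)

theorem hasCompactSupport_gradient {f : E3 → ℝ} (hc : HasCompactSupport f) :
    HasCompactSupport (gradient f) :=
  (hc.fderiv (𝕜 := ℝ)).comp_left (g := (InnerProductSpace.toDual ℝ E3).symm) (map_zero _)

theorem integral_rpow_le_integral_gradient {f : E3 → ℝ} (hf : ContDiff ℝ 1 f)
    (hc : HasCompactSupport f) (h0 : ∀ x, 0 ≤ f x) :
    ∫ x, f x ^ (3 / 2 : ℝ) ≤ (2⁻¹ * ∫ x, ‖gradient f x‖) ^ (3 / 2 : ℝ) := by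
  have hint : Integrable (fun x => ‖gradient f x‖) :=
    ((continuous_gradient hf).integrable_of_hasCompactSupport (hasCompactSupport_gradient hc)).norm
  have h1 : ∫⁻ x, ‖fderiv ℝ f x‖ₑ = ENNReal.ofReal (∫ x, ‖gradient f x‖) := by
    rw [ofReal_integral_eq_lintegral_ofReal hint (Eventually.of_forall fun x => norm_nonneg _)]
    refine lintegral_congr fun x => ?_
    rw [norm_gradient_eq, ofReal_norm]
  have hnn : 0 ≤ ∫ x, ‖gradient f x‖ := integral_nonneg fun x => norm_nonneg _
  have h2 := lintegral_rpow_le_lintegral_fderiv hf hc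
  have h3 : (2⁻¹ * ∫⁻ x, ‖fderiv ℝ f x‖ₑ) ^ (3 / 2 : ℝ)
      = ENNReal.ofReal ((2⁻¹ * ∫ x, ‖gradient f x‖) ^ (3 / 2 : ℝ)) := by
    rw [h1, ← ENNReal.ofReal_rpow_of_nonneg (by positivity) (by norm_num),
      ENNReal.ofReal_mul (by norm_num), ENNReal.ofReal_inv_of_pos (by norm_num)]
    simp
  rw [h3] at h2
  rw [integral_eq_lintegral_of_nonneg_ae
    (Eventually.of_forall fun x => Real.rpow_nonneg (h0 x) _)
    (hf.continuous.rpow_const fun x => Or.inr (by norm_num)).aestronglyMeasurable]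
  refine ENNReal.toReal_le_of_le_ofReal (by positivity) (le_trans (le_of_eq ?_) h2)
  refine lintegral_congr fun x => ?_
  rw [← ENNReal.ofReal_rpow_of_nonneg (h0 x) (by norm_num), Real.enorm_eq_ofReal (h0 x)]

end

end PorousMedium

/-! ### Integration by parts against cutoffs and the Payne-Schaefer inequality -/

namespace PorousMedium

noncomputable section

variable {Ω : Set E3} {x₀ : E3} {ρ₀ d δ : ℝ} {η : E3 → ℝ}

/-- Extension by zero: near a point off the support of ζ the product vanishes identically, so f
needs no regularity outside U. -/
theorem continuous_mul_of_tsupport_subset {X : Type*} [TopologicalSpace X] {U : Set X}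
    (hU : IsOpen U) {ζ f : X → ℝ} (hζ : Continuous ζ) (hs : tsupport ζ ⊆ U)
    (hf : ContinuousOn f U) : Continuous fun x => ζ x * f x := by
  rw [continuous_iff_continuousAt]
  intro x
  by_cases hx : x ∈ tsupport ζ
  · exact hζ.continuousAt.mul (hf.continuousAt (hU.mem_nhds (hs hx)))
  · have : (fun x => ζ x * f x) =ᶠ[𝓝 x] fun _ => 0 := by
      filter_upwards [notMem_tsupport_iff_eventuallyEq.1 hx] with y hy
      rw [hy]; simp
    exact continuousAt_const.congr this.symm

theorem integrable_mul_of_tsupport_subset (hΩ : IsOpen Ω) {ζ f : E3 → ℝ} (hζ : Continuous ζ)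
    (hc : HasCompactSupport ζ) (hs : tsupport ζ ⊆ Ω) (hf : ContinuousOn f Ω) :
    Integrable fun x => ζ x * f x :=
  (continuous_mul_of_tsupport_subset hΩ hζ hs hf).integrable_of_hasCompactSupport hc.mul_right

theorem contDiff_mul_of_tsupport_subset (hΩ : IsOpen Ω) {ζ f : E3 → ℝ} (hζ : ContDiff ℝ 1 ζ)
    (hs : tsupport ζ ⊆ Ω) (hf : ContDiffOn ℝ 1 f Ω) : ContDiff ℝ 1 fun x => ζ x * f x := by
  rw [contDiff_iff_contDiffAt]
  intro x
  by_cases hx : x ∈ tsupport ζ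
  · exact hζ.contDiffAt.mul (hf.contDiffAt (hΩ.mem_nhds (hs hx)))
  · have : (fun x => ζ x * f x) =ᶠ[𝓝 x] fun _ => 0 := by
      filter_upwards [notMem_tsupport_iff_eventuallyEq.1 hx] with y hy
      rw [hy]; simp
    exact contDiffAt_const.congr_of_eventuallyEq this

theorem continuousOn_gradient (hΩ : IsOpen Ω) {f : E3 → ℝ} (hf : ContDiffOn ℝ 1 f Ω) :
    ContinuousOn (gradient f) Ω :=
  (InnerProductSpace.toDual ℝ E3).symm.continuous.comp_continuousOn
    (hf.continuousOn_fderiv_of_isOpen hΩ le_rfl)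

theorem setIntegral_eq_integral_of_tsupport_subset {ζ f : E3 → ℝ} (hs : tsupport ζ ⊆ Ω) :
    ∫ x in Ω, ζ x * f x = ∫ x, ζ x * f x :=
  setIntegral_eq_integral_of_forall_compl_eq_zero fun x hx => by
    rw [image_eq_zero_of_notMem_tsupport fun h => hx (hs h), zero_mul]

theorem integral_mul_fderiv_eq_neg (hΩ : IsOpen Ω) {ζ g : E3 → ℝ} (hζ : ContDiff ℝ 1 ζ)
    (hc : HasCompactSupport ζ) (hs : tsupport ζ ⊆ Ω) (hg : ContDiffOn ℝ 1 g Ω) (v : E3) :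
    ∫ x in Ω, ζ x * fderiv ℝ g x v = -∫ x in Ω, fderiv ℝ ζ x v * g x := by
  have hs' : tsupport (fun x => fderiv ℝ ζ x v) ⊆ Ω := (tsupport_fderiv_apply_subset ℝ v).trans hs
  have hc' : HasCompactSupport (fun x => fderiv ℝ ζ x v) := hc.fderiv_apply (𝕜 := ℝ) v
  have hcont : Continuous (fun x => fderiv ℝ ζ x v) :=
    (hζ.continuous_fderiv one_ne_zero).clm_apply continuous_const
  have hgv : ContinuousOn (fun x => fderiv ℝ g x v) Ω :=
    (hg.continuousOn_fderiv_of_isOpen hΩ le_rfl).clm_apply continuousOn_const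
  rw [setIntegral_eq_integral_of_tsupport_subset hs,
    setIntegral_eq_integral_of_tsupport_subset hs']
  refine integral_mul_fderiv_eq_neg_fderiv_mul_of_integrable
    (integrable_mul_of_tsupport_subset hΩ hcont hc' hs' hg.continuousOn)
    (integrable_mul_of_tsupport_subset hΩ hζ.continuous hc hs hgv)
    (integrable_mul_of_tsupport_subset hΩ hζ.continuous hc hs hg.continuousOn)
    (fun x _ => hζ.differentiable one_ne_zero x)
    (fun x hx => (hg.contDiffAt (hΩ.mem_nhds (hs hx))).differentiableAt one_ne_zero)

theorem integrableOn_mul_of_tsupport_subset (hΩ : IsOpen Ω) {ζ f : E3 → ℝ} (hζ : Continuous ζ)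
    (hc : HasCompactSupport ζ) (hs : tsupport ζ ⊆ Ω) (hf : ContinuousOn f Ω) :
    IntegrableOn (fun x => ζ x * f x) Ω :=
  (integrable_mul_of_tsupport_subset hΩ hζ hc hs hf).integrableOn

/-- Green's identity against a compactly supported function. -/
theorem integral_mul_laplacian_eq (hΩ : IsOpen Ω) {ζ V : E3 → ℝ} (hζ : ContDiff ℝ 1 ζ)
    (hc : HasCompactSupport ζ) (hs : tsupport ζ ⊆ Ω) (hV : ContDiffOn ℝ 2 V Ω) :
    ∫ x in Ω, ζ x * Laplacian.laplacian V x = -∫ x in Ω, ⟪gradient ζ x, gradient V x⟫_ℝ := by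
  set b := EuclideanSpace.basisFun (Fin 3) ℝ with hb
  have hV1 : ContDiffOn ℝ 1 (fderiv ℝ V) Ω := hV.fderiv_of_isOpen hΩ (by norm_num)
  have hcomp : ∀ i, ContDiffOn ℝ 1 (fun y => fderiv ℝ V y (b i)) Ω := fun i =>
    hV1.clm_apply contDiffOn_const
  have hlap : ∀ x ∈ Ω, Laplacian.laplacian V x
      = ∑ i, fderiv ℝ (fun y => fderiv ℝ V y (b i)) x (b i) := by
    intro x hx
    rw [InnerProductSpace.laplacian_eq_iteratedFDeriv_orthonormalBasis V b]
    refine Finset.sum_congr rfl fun i _ => ?_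
    rw [iteratedFDeriv_two_apply]
    have hd : DifferentiableAt ℝ (fderiv ℝ V) x :=
      (hV1.contDiffAt (hΩ.mem_nhds hx)).differentiableAt one_ne_zero
    rw [fderiv_clm_apply hd (differentiableAt_const _)]
    simp
  have hin : ∀ x, ⟪gradient ζ x, gradient V x⟫_ℝ
      = ∑ i, fderiv ℝ ζ x (b i) * fderiv ℝ V x (b i) := by
    intro x
    rw [← b.sum_inner_mul_inner]
    refine Finset.sum_congr rfl fun i _ => ?_
    rw [inner_gradient_left, real_inner_comm, inner_gradient_left]
  have e1 : ∫ x in Ω, ζ x * Laplacian.laplacian V x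
      = ∫ x in Ω, ∑ i, ζ x * fderiv ℝ (fun y => fderiv ℝ V y (b i)) x (b i) :=
    setIntegral_congr_fun hΩ.measurableSet fun x hx => by
      simp only [hlap x hx, Finset.mul_sum]
  simp only [e1, hin]
  rw [integral_finsetSum, integral_finsetSum, ← Finset.sum_neg_distrib]
  · exact Finset.sum_congr rfl fun i _ => integral_mul_fderiv_eq_neg hΩ hζ hc hs (hcomp i) (b i)
  · intro i _
    refine integrableOn_mul_of_tsupport_subset hΩ
      ((hζ.continuous_fderiv one_ne_zero).clm_apply continuous_const)
      (hc.fderiv_apply (𝕜 := ℝ) _) ((tsupport_fderiv_apply_subset ℝ _).trans hs)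
      (hcomp i).continuousOn
  · intro i _
    exact integrableOn_mul_of_tsupport_subset hΩ hζ.continuous hc hs
      (((hcomp i).continuousOn_fderiv_of_isOpen hΩ le_rfl).clm_apply continuousOn_const)

/-- The divergence theorem for the field `w (x - x₀)` against a compactly supported function. -/
theorem integral_radial_eq (hΩ : IsOpen Ω) {ζ w : E3 → ℝ} (hζ : ContDiff ℝ 1 ζ)
    (hc : HasCompactSupport ζ) (hs : tsupport ζ ⊆ Ω) (hw : ContDiffOn ℝ 1 w Ω) (x₀ : E3) :
    ∫ x in Ω, -⟪gradient ζ x, x - x₀⟫_ℝ * w x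
      = ∫ x in Ω, ζ x * (3 * w x + ⟪gradient w x, x - x₀⟫_ℝ) := by
  set b := EuclideanSpace.basisFun (Fin 3) ℝ with hb
  have hl : ∀ i, ContDiff ℝ 1 fun x : E3 => ⟪b i, x - x₀⟫_ℝ := fun i =>
    contDiff_const.inner ℝ (contDiff_id.sub contDiff_const)
  have hg : ∀ i, ContDiffOn ℝ 1 (fun x => ⟪b i, x - x₀⟫_ℝ * w x) Ω := fun i =>
    (hl i).contDiffOn.mul hw
  have hin : ∀ (f : E3 → ℝ) (x : E3), ⟪gradient f x, x - x₀⟫_ℝ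
      = ∑ i, fderiv ℝ f x (b i) * ⟪b i, x - x₀⟫_ℝ := by
    intro f x
    rw [← b.sum_inner_mul_inner]
    refine Finset.sum_congr rfl fun i _ => ?_
    rw [inner_gradient_left]
  have hd : ∀ i, ∀ x ∈ Ω, fderiv ℝ (fun x => ⟪b i, x - x₀⟫_ℝ * w x) x (b i)
      = w x + fderiv ℝ w x (b i) * ⟪b i, x - x₀⟫_ℝ := by
    intro i x hx
    have hwd := (hw.contDiffAt (hΩ.mem_nhds hx)).differentiableAt one_ne_zero
    have hld : HasFDerivAt (fun x : E3 => ⟪b i, x - x₀⟫_ℝ) (innerSL ℝ (b i)) x :=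
      (innerSL ℝ (b i)).hasFDerivAt.comp x ((hasFDerivAt_id x).sub_const x₀)
    have hone : ⟪b i, b i⟫_ℝ = 1 := by simp
    have hmul : HasFDerivAt (fun x => ⟪b i, x - x₀⟫_ℝ * w x) _ x := hld.mul hwd.hasFDerivAt
    rw [hmul.fderiv]
    simp only [add_apply, smul_apply, innerSL_apply_apply,
      smul_eq_mul, hone]
    ring
  have e1 : ∫ x in Ω, ζ x * (3 * w x + ⟪gradient w x, x - x₀⟫_ℝ)
      = ∫ x in Ω, ∑ i, ζ x * fderiv ℝ (fun x => ⟪b i, x - x₀⟫_ℝ * w x) x (b i) := by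
    refine setIntegral_congr_fun hΩ.measurableSet fun x hx => ?_
    simp only [hin]
    rw [← Finset.mul_sum, Finset.sum_congr rfl fun i _ => hd i x hx, Finset.sum_add_distrib]
    simp
  have e2 : ∀ x, -⟪gradient ζ x, x - x₀⟫_ℝ * w x
      = -∑ i, fderiv ℝ ζ x (b i) * (⟪b i, x - x₀⟫_ℝ * w x) := fun x => by
    rw [hin, neg_mul, Finset.sum_mul]
    simp only [mul_assoc]
  simp only [e1, e2]
  rw [integral_neg, integral_finsetSum, integral_finsetSum, ← Finset.sum_neg_distrib]
  · exact Finset.sum_congr rfl fun i _ =>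
      (integral_mul_fderiv_eq_neg hΩ hζ hc hs (hg i) (b i)).symm
  · intro i _
    exact integrableOn_mul_of_tsupport_subset hΩ hζ.continuous hc hs
      (((hg i).continuousOn_fderiv_of_isOpen hΩ le_rfl).clm_apply continuousOn_const)
  · intro i _
    exact integrableOn_mul_of_tsupport_subset hΩ
      ((hζ.continuous_fderiv one_ne_zero).clm_apply continuous_const)
      (hc.fderiv_apply (𝕜 := ℝ) _) ((tsupport_fderiv_apply_subset ℝ _).trans hs)
      (hg i).continuousOn

theorem tsupport_gradient_subset (f : E3 → ℝ) : tsupport (gradient f) ⊆ tsupport f := by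
  refine (closure_mono ?_).trans (tsupport_fderiv_subset ℝ (f := f))
  intro x hx h
  exact hx (by simp [gradient, h])

theorem IsBoundaryCutoff.integrableOn_gradient_mul (hΩ : IsOpen Ω)
    (hη : IsBoundaryCutoff Ω x₀ ρ₀ δ η) {w : E3 → ℝ} (hw : ContinuousOn w Ω) :
    IntegrableOn (fun x => ‖gradient η x‖ * w x) Ω := by
  have hsn : Function.support (fun x => ‖gradient η x‖) = Function.support (gradient η) := by
    ext x; simp
  refine integrableOn_mul_of_tsupport_subset hΩ (continuous_gradient hη.contDiff).norm
    (hasCompactSupport_gradient hη.hasCompactSupport).norm ?_ hw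
  rw [tsupport, hsn]
  exact (tsupport_gradient_subset η).trans hη.tsupport_subset

/-- The boundary integral of `w`, in cutoff form, is controlled by interior integrals. -/
theorem IsBoundaryCutoff.integral_gradient_mul_le (hΩ : IsAdmissibleDomain Ω x₀ ρ₀ d)
    (hη : IsBoundaryCutoff Ω x₀ ρ₀ δ η) (hδ : 0 ≤ δ) {w : E3 → ℝ} (hw : ContDiffOn ℝ 1 w Ω)
    (hw0 : ∀ x ∈ Ω, 0 ≤ w x) :
    ρ₀ * ∫ x in Ω, ‖gradient η x‖ * w x
      ≤ (1 + δ) * (3 * (∫ x in Ω, η x * w x) + d * ∫ x in Ω, η x * ‖gradient w x‖) := by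
  have hgw := continuousOn_gradient hΩ.isOpen hw
  have hint : ∀ f : E3 → ℝ, ContinuousOn f Ω → IntegrableOn (fun x => η x * f x) Ω := fun f hf =>
    integrableOn_mul_of_tsupport_subset hΩ.isOpen hη.contDiff.continuous hη.hasCompactSupport
      hη.tsupport_subset hf
  have hdc : ContinuousOn (fun x => x - x₀) Ω := by fun_prop
  -- The cutoff analogue of ρ₀ ≤ (x - x₀)·ν on the boundary; the factor 1 + δ is the price of
  -- replacing the boundary by a thin layer.
  have h1 : ρ₀ * ∫ x in Ω, ‖gradient η x‖ * w x
      ≤ (1 + δ) * ∫ x in Ω, -⟪gradient η x, x - x₀⟫_ℝ * w x := by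
    rw [← integral_const_mul, ← integral_const_mul]
    refine setIntegral_mono_on ((hη.integrableOn_gradient_mul hΩ.isOpen hw.continuousOn).const_mul _)
      (Integrable.const_mul ?_ _) hΩ.isOpen.measurableSet fun x hx => ?_
    · refine integrableOn_mul_of_tsupport_subset (ζ := fun x => -⟪gradient η x, x - x₀⟫_ℝ)
        hΩ.isOpen ?_ ?_ ?_ hw.continuousOn
      · have := continuous_gradient hη.contDiff
        fun_prop
      · refine (hasCompactSupport_gradient hη.hasCompactSupport).mono fun x hx h => hx ?_
        simp [h]
      · refine (closure_mono ?_).trans ((tsupport_gradient_subset η).trans hη.tsupport_subset)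
        intro x hx h
        exact hx (by simp [h])
    · have := mul_le_mul_of_nonneg_right (hη.norm_gradient_le x) (hw0 x hx)
      linarith
  refine h1.trans (mul_le_mul_of_nonneg_left ?_ (by linarith))
  rw [integral_radial_eq hΩ.isOpen hη.contDiff hη.hasCompactSupport hη.tsupport_subset hw,
    ← integral_const_mul, ← integral_const_mul, ← integral_add ((hint _ hw.continuousOn).const_mul _)
    ((hint _ hgw.norm).const_mul _)]
  refine setIntegral_mono_on (hint _ ((hw.continuousOn.const_mul _).add (hgw.inner hdc)))
    (((hint _ hw.continuousOn).const_mul _).add ((hint _ hgw.norm).const_mul _))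
    hΩ.isOpen.measurableSet fun x hx => ?_
  have h2 : ⟪gradient w x, x - x₀⟫_ℝ ≤ d * ‖gradient w x‖ := by
    refine (real_inner_le_norm _ _).trans ?_
    rw [mul_comm]
    gcongr
    exact hΩ.norm_sub_le (subset_closure hx)
  have := mul_le_mul_of_nonneg_left h2 (hη.nonneg x)
  linarith

theorem isFiniteMeasure_restrict (hΩ : IsAdmissibleDomain Ω x₀ ρ₀ d) :
    IsFiniteMeasure (volume.restrict Ω) :=
  ⟨by simpa using hΩ.isBounded.measure_lt_top⟩

theorem integrableOn_of_bounded (hΩ : IsAdmissibleDomain Ω x₀ ρ₀ d) {f : E3 → ℝ}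
    (hf : ContinuousOn f Ω) {M : ℝ} (hM : ∀ x ∈ Ω, |f x| ≤ M) : IntegrableOn f Ω := by
  have := isFiniteMeasure_restrict hΩ
  refine Integrable.of_bound (hf.aestronglyMeasurable hΩ.isOpen.measurableSet) M ?_
  filter_upwards [ae_restrict_mem hΩ.isOpen.measurableSet] with x hx using hM x hx

/-- The Sobolev-type inequality of Payne and Schaefer. -/
theorem integral_rpow_le_payne (hΩ : IsAdmissibleDomain Ω x₀ ρ₀ d) {w : E3 → ℝ}
    (hw : ContDiffOn ℝ 1 w Ω) (hw0 : ∀ x ∈ Ω, 0 ≤ w x) {M : ℝ} (hM : ∀ x ∈ Ω, w x ≤ M)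
    (hM' : ∀ x ∈ Ω, ‖gradient w x‖ ≤ M) :
    ∫ x in Ω, w x ^ (3 / 2 : ℝ) ≤ (3 / (2 * ρ₀) * (∫ x in Ω, w x)
      + 1 / 2 * (d / ρ₀ + 1) * ∫ x in Ω, ‖gradient w x‖) ^ (3 / 2 : ℝ) := by
  have hρ := hΩ.rho_pos
  have hd := hΩ.d_nonneg
  have hgw := continuousOn_gradient hΩ.isOpen hw
  have hmeas := hΩ.isOpen.measurableSet
  have hM0 : 0 ≤ M := (hw0 _ hΩ.mem).trans (hM _ hΩ.mem)
  have hwi : IntegrableOn w Ω := integrableOn_of_bounded hΩ hw.continuousOn fun x hx => by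
    rw [abs_of_nonneg (hw0 x hx)]; exact hM x hx
  have hgi : IntegrableOn (fun x => ‖gradient w x‖) Ω :=
    integrableOn_of_bounded hΩ hgw.norm fun x hx => by
      rw [abs_of_nonneg (norm_nonneg _)]; exact hM' x hx
  have hpc : ContinuousOn (fun x => w x ^ (3 / 2 : ℝ)) Ω :=
    hw.continuousOn.rpow_const fun x _ => Or.inr (by norm_num)
  have hpi : IntegrableOn (fun x => w x ^ (3 / 2 : ℝ)) Ω :=
    integrableOn_of_bounded hΩ hpc (M := M ^ (3 / 2 : ℝ)) fun x hx => by
      rw [abs_of_nonneg (Real.rpow_nonneg (hw0 x hx) _)]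
      exact Real.rpow_le_rpow (hw0 x hx) (hM x hx) (by norm_num)
  set A := ∫ x in Ω, w x with hA
  set B := ∫ x in Ω, ‖gradient w x‖ with hB
  have hA0 : 0 ≤ A := setIntegral_nonneg hmeas hw0
  have hB0 : 0 ≤ B := integral_nonneg fun x => norm_nonneg _
  -- Apply the whole-space inequality to ηw. Its gradient splits into η∇w and w∇η; the second piece
  -- is the boundary layer already estimated by interior integrals.
  have key : ∀ δ : ℝ, 0 < δ → ∫ x in Ω, w x ^ (3 / 2 : ℝ)
      ≤ (2⁻¹ * (B + (1 + δ) / ρ₀ * (3 * A + d * B))) ^ (3 / 2 : ℝ)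
        + 2 * M ^ (3 / 2 : ℝ) * δ := by
    intro δ hδ
    obtain ⟨η, hη, hηδ⟩ := hΩ.exists_cutoff hδ
    have hηi : IntegrableOn (fun x => 1 - η x) Ω :=
      integrableOn_of_bounded hΩ (M := 1)
        (continuousOn_const.sub hη.contDiff.continuous.continuousOn) fun x _ => by
        rw [abs_of_nonneg (sub_nonneg.2 (hη.le_one x))]; linarith [hη.nonneg x]
    have hint : ∀ f : E3 → ℝ, ContinuousOn f Ω → IntegrableOn (fun x => η x * f x) Ω :=
      fun f hf => integrableOn_mul_of_tsupport_subset hΩ.isOpen hη.contDiff.continuous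
        hη.hasCompactSupport hη.tsupport_subset hf
    set f : E3 → ℝ := fun x => η x * w x with hf
    have hfC : ContDiff ℝ 1 f := contDiff_mul_of_tsupport_subset hΩ.isOpen hη.contDiff
      hη.tsupport_subset hw
    have hfc : HasCompactSupport f := hη.hasCompactSupport.mul_right
    have hfz : ∀ x, x ∉ Ω → f x = 0 := fun x hx => by
      simp only [hf]
      rw [image_eq_zero_of_notMem_tsupport fun h => hx (hη.tsupport_subset h), zero_mul]
    have hf0 : ∀ x, 0 ≤ f x := fun x => by
      by_cases hx : x ∈ Ω
      · exact mul_nonneg (hη.nonneg x) (hw0 x hx)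
      · exact (hfz x hx).ge
    have hfs : tsupport f ⊆ Ω := by
      refine (closure_mono ?_).trans hη.tsupport_subset
      intro x hx h
      exact hx (by simp [hf, h])
    have hGN := integral_rpow_le_integral_gradient hfC hfc hf0
    have e1 : ∫ x in Ω, f x ^ (3 / 2 : ℝ) = ∫ x, f x ^ (3 / 2 : ℝ) :=
      setIntegral_eq_integral_of_forall_compl_eq_zero fun x hx => by
        rw [hfz x hx, Real.zero_rpow (by norm_num)]
    have e2 : ∫ x in Ω, ‖gradient f x‖ = ∫ x, ‖gradient f x‖ :=
      setIntegral_eq_integral_of_forall_compl_eq_zero fun x hx => by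
        rw [image_eq_zero_of_notMem_tsupport fun h => hx (hfs (tsupport_gradient_subset f h)),
          norm_zero]
    have hgradf : ∀ x ∈ Ω, ‖gradient f x‖ ≤ η x * ‖gradient w x‖ + ‖gradient η x‖ * w x := by
      intro x hx
      have h1 := (hη.contDiff.differentiable one_ne_zero x)
      have h2 := (hw.contDiffAt (hΩ.isOpen.mem_nhds hx)).differentiableAt one_ne_zero
      simp only [norm_gradient_eq]
      have : fderiv ℝ f x = η x • fderiv ℝ w x + w x • fderiv ℝ η x :=
        (h1.hasFDerivAt.mul h2.hasFDerivAt).fderiv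
      rw [this]
      refine (norm_add_le _ _).trans ?_
      rw [norm_smul, norm_smul, Real.norm_of_nonneg (hη.nonneg x),
        Real.norm_of_nonneg (hw0 x hx), mul_comm (w x)]
    have hgη := hη.integrableOn_gradient_mul hΩ.isOpen hw.continuousOn
    have hle1 : ∫ x in Ω, η x * w x ≤ A :=
      setIntegral_mono_on (hint _ hw.continuousOn) hwi hmeas fun x hx =>
        mul_le_of_le_one_left (hw0 x hx) (hη.le_one x)
    have hle2 : ∫ x in Ω, η x * ‖gradient w x‖ ≤ B :=
      setIntegral_mono_on (hint _ hgw.norm) hgi hmeas fun x hx =>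
        mul_le_of_le_one_left (norm_nonneg _) (hη.le_one x)
    have hbd := hη.integral_gradient_mul_le hΩ hδ.le hw hw0
    have hgrad_le : ∫ x, ‖gradient f x‖ ≤ B + (1 + δ) / ρ₀ * (3 * A + d * B) := by
      rw [← e2]
      calc ∫ x in Ω, ‖gradient f x‖
          ≤ ∫ x in Ω, (η x * ‖gradient w x‖ + ‖gradient η x‖ * w x) := by
            refine setIntegral_mono_on ?_ ((hint _ hgw.norm).add hgη) hmeas hgradf
            exact ((continuous_gradient hfC).integrable_of_hasCompactSupport
              (hasCompactSupport_gradient hfc)).norm.integrableOn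
        _ = (∫ x in Ω, η x * ‖gradient w x‖) + ∫ x in Ω, ‖gradient η x‖ * w x :=
            integral_add (hint _ hgw.norm) hgη
        _ ≤ B + (1 + δ) / ρ₀ * (3 * A + d * B) := by
            refine add_le_add hle2 ?_
            rw [div_mul_eq_mul_div, le_div_iff₀' hρ]
            refine hbd.trans ?_
            gcongr
    have hlow : ∫ x in Ω, w x ^ (3 / 2 : ℝ)
        ≤ (∫ x in Ω, f x ^ (3 / 2 : ℝ)) + 2 * M ^ (3 / 2 : ℝ) * δ := by
      have hfi : IntegrableOn (fun x => f x ^ (3 / 2 : ℝ)) Ω :=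
        integrableOn_of_bounded hΩ (M := M ^ (3 / 2 : ℝ))
          (hfC.continuous.continuousOn.rpow_const fun x _ => Or.inr (by norm_num)) fun x hx => by
          rw [abs_of_nonneg (Real.rpow_nonneg (hf0 x) _)]
          refine Real.rpow_le_rpow (hf0 x) ?_ (by norm_num)
          exact (mul_le_of_le_one_left (hw0 x hx) (hη.le_one x)).trans (hM x hx)
      calc ∫ x in Ω, w x ^ (3 / 2 : ℝ)
          ≤ ∫ x in Ω, (f x ^ (3 / 2 : ℝ) + 2 * M ^ (3 / 2 : ℝ) * (1 - η x)) := by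
            refine setIntegral_mono_on hpi (hfi.add (hηi.const_mul _)) hmeas fun x hx => ?_
            have h1 : f x ^ (3 / 2 : ℝ) = η x ^ (3 / 2 : ℝ) * w x ^ (3 / 2 : ℝ) :=
              Real.mul_rpow (hη.nonneg x) (hw0 x hx)
            have h2 : η x ^ 2 ≤ η x ^ (3 / 2 : ℝ) := by
              rw [← Real.rpow_natCast]
              exact Real.rpow_le_rpow_of_exponent_ge' (hη.nonneg x) (hη.le_one x) (by norm_num)
                (by norm_num)
            -- From 1 - η^{3/2} ≤ 1 - η² = (1 - η)(1 + η); hence the constant 2 in the error.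
            have h3 : 1 - η x ^ (3 / 2 : ℝ) ≤ 2 * (1 - η x) := by nlinarith [sq_nonneg (1 - η x)]
            have h4 : w x ^ (3 / 2 : ℝ) ≤ M ^ (3 / 2 : ℝ) :=
              Real.rpow_le_rpow (hw0 x hx) (hM x hx) (by norm_num)
            have h5 : 0 ≤ w x ^ (3 / 2 : ℝ) := Real.rpow_nonneg (hw0 x hx) _
            rw [h1]
            have h6 := sub_nonneg.2 (hη.le_one x)
            nlinarith [mul_le_mul_of_nonneg_left h3 h5,
              mul_le_mul_of_nonneg_right h4 (mul_nonneg two_pos.le h6)]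
        _ = (∫ x in Ω, f x ^ (3 / 2 : ℝ)) + 2 * M ^ (3 / 2 : ℝ) * ∫ x in Ω, (1 - η x) := by
            rw [integral_add hfi (hηi.const_mul _), integral_const_mul]
        _ ≤ _ := by gcongr
    refine hlow.trans (add_le_add_left ?_ _)
    rw [e1]
    refine hGN.trans ?_
    have : 0 ≤ ∫ x, ‖gradient f x‖ := integral_nonneg fun x => norm_nonneg _
    gcongr
  -- As δ → 0 the base becomes (B + (3A + dB)/ρ₀)/2, which regroups into the stated constants.
  have hlim : Tendsto (fun δ : ℝ => (2⁻¹ * (B + (1 + δ) / ρ₀ * (3 * A + d * B))) ^ (3 / 2 : ℝ)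
      + 2 * M ^ (3 / 2 : ℝ) * δ) (𝓝[>] 0)
      (𝓝 ((2⁻¹ * (B + (1 + 0) / ρ₀ * (3 * A + d * B))) ^ (3 / 2 : ℝ)
        + 2 * M ^ (3 / 2 : ℝ) * 0)) := by
    have : Continuous fun δ : ℝ => (2⁻¹ * (B + (1 + δ) / ρ₀ * (3 * A + d * B))) ^ (3 / 2 : ℝ)
        + 2 * M ^ (3 / 2 : ℝ) * δ :=
      ((by fun_prop : Continuous fun δ : ℝ => 2⁻¹ * (B + (1 + δ) / ρ₀ * (3 * A + d * B))).rpow_const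
        fun _ => Or.inr (by norm_num)).add (by fun_prop)
    exact (this.tendsto 0).mono_left nhdsWithin_le_nhds
  have hfin := ge_of_tendsto hlim (by
    filter_upwards [self_mem_nhdsWithin] with δ hδ using key δ hδ)
  refine hfin.trans (le_of_eq ?_)
  rw [mul_zero, add_zero, add_zero]
  congr 1
  field_simp
  ring

end

end PorousMedium

/-! ### Integral and pointwise inequalities -/

namespace PorousMedium

noncomputable section

section Inequalities

variable {α : Type*} [MeasurableSpace α] {μ : Measure α} {s : Set α}

/-- Cauchy-Schwarz inequality in the form `H² ≤ F G ⟹ (∫ H)² ≤ ∫ F ∫ G`. -/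
theorem sq_setIntegral_le (hs : MeasurableSet s) {F G H : α → ℝ} (hF : IntegrableOn F s μ)
    (hG : IntegrableOn G s μ) (hH : IntegrableOn H s μ) (hF0 : ∀ x ∈ s, 0 ≤ F x)
    (hG0 : ∀ x ∈ s, 0 ≤ G x) (h : ∀ x ∈ s, H x ^ 2 ≤ F x * G x) :
    (∫ x in s, H x ∂μ) ^ 2 ≤ (∫ x in s, F x ∂μ) * ∫ x in s, G x ∂μ := by
  -- The quadratic l ↦ ∫ (l²F + 2lH + G) is nonnegative, so its discriminant is not positive.
  -- Pointwise, F times the integrand dominates (lF + H)²; where F = 0, also H = 0.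
  have key : ∀ l : ℝ, 0 ≤ (∫ x in s, F x ∂μ) * (l * l) + (2 * ∫ x in s, H x ∂μ) * l
      + ∫ x in s, G x ∂μ := by
    intro l
    have e : (∫ x in s, F x ∂μ) * (l * l) + (2 * ∫ x in s, H x ∂μ) * l + ∫ x in s, G x ∂μ
        = ∫ x in s, ((l * l) * F x + (2 * l) * H x + G x) ∂μ := by
      have hFH : IntegrableOn (fun x => (l * l) * F x + (2 * l) * H x) s μ :=
        (hF.const_mul _).add (hH.const_mul _)
      rw [integral_add hFH hG,
        integral_add (hF.const_mul _) (hH.const_mul _), integral_const_mul, integral_const_mul]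
      ring
    rw [e]
    refine setIntegral_nonneg hs fun x hx => ?_
    have h1 := h x hx
    rcases (hF0 x hx).eq_or_lt with h0 | h0
    · rw [← h0, zero_mul] at h1
      have : H x = 0 := by nlinarith
      rw [this, ← h0]
      linarith [hG0 x hx]
    · refine nonneg_of_mul_nonneg_right (a := F x) ?_ h0
      nlinarith [sq_nonneg (l * F x + H x)]
  have := discrim_le_zero key
  rw [discrim] at this
  linarith

/-- Chebyshev's integral inequality for functions that vary together. -/
theorem setIntegral_mul_setIntegral_le (hs : MeasurableSet s) (hμ : μ s ≠ ⊤) {f g : α → ℝ}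
    (hf : IntegrableOn f s μ) (hg : IntegrableOn g s μ)
    (hfg : IntegrableOn (fun x => f x * g x) s μ)
    (h : ∀ x ∈ s, ∀ y ∈ s, 0 ≤ (f x - f y) * (g x - g y)) :
    (∫ x in s, f x ∂μ) * (∫ x in s, g x ∂μ) ≤ μ.real s * ∫ x in s, f x * g x ∂μ := by
  set A := ∫ x in s, f x ∂μ
  set B := ∫ x in s, g x ∂μ
  set C := ∫ x in s, f x * g x ∂μ
  have hc : ∀ k : ℝ, IntegrableOn (fun _ => k) s μ := fun k => integrableOn_const hμ
  have hcI : ∀ k : ℝ, ∫ _ in s, k ∂μ = μ.real s * k := fun k => by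
    rw [setIntegral_const, smul_eq_mul]
  -- Integrate (f x - f y)(g x - g y) ≥ 0 in x with y fixed, and afterwards in y; this avoids the
  -- product measure.
  have h1 : ∀ y ∈ s, g y * A + f y * B ≤ C + μ.real s * (f y * g y) := by
    intro y hy
    have e : C + μ.real s * (f y * g y) - (g y * A + f y * B)
        = ∫ x in s, (f x * g x + f y * g y - (g y * f x + f y * g x)) ∂μ := by
      have hi1 : IntegrableOn (fun x => f x * g x + f y * g y) s μ := hfg.add (hc _)
      have hi2 : IntegrableOn (fun x => g y * f x + f y * g x) s μ :=
        (hf.const_mul _).add (hg.const_mul _)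
      rw [integral_sub hi1 hi2,
        integral_add hfg (hc _), integral_add (hf.const_mul _) (hg.const_mul _),
        hcI, integral_const_mul, integral_const_mul]
    have : 0 ≤ C + μ.real s * (f y * g y) - (g y * A + f y * B) := by
      rw [e]
      refine setIntegral_nonneg hs fun x hx => ?_
      linarith [h x hx y hy]
    linarith
  have h2 : ∫ y in s, (A * g y + B * f y) ∂μ ≤ ∫ y in s, (C + μ.real s * (f y * g y)) ∂μ :=
    setIntegral_mono_on ((hg.const_mul _).add (hf.const_mul _)) ((hc _).add (hfg.const_mul _)) hs
      fun y hy => by linarith [h1 y hy]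
  rw [integral_add (hg.const_mul _) (hf.const_mul _), integral_add (hc _) (hfg.const_mul _),
    integral_const_mul, integral_const_mul, integral_const_mul, hcI] at h2
  change A * B + B * A ≤ μ.real s * C + μ.real s * C at h2
  linarith

/-- Jensen's inequality for t ↦ t^κ and the normalised measure, with the volume factors cleared. -/
theorem rpow_setIntegral_le (hs : MeasurableSet s) (hμ : μ s ≠ ⊤) (hμ0 : μ s ≠ 0) {f : α → ℝ}
    {κ : ℝ} (hκ : 1 ≤ κ) (hf : IntegrableOn f s μ) (hfκ : IntegrableOn (fun x => f x ^ κ) s μ)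
    (h0 : ∀ x ∈ s, 0 ≤ f x) :
    μ.real s ^ (1 - κ) * (∫ x in s, f x ∂μ) ^ κ ≤ ∫ x in s, f x ^ κ ∂μ := by
  have hpos : 0 < μ.real s := ENNReal.toReal_pos hμ0 hμ
  have hI : 0 ≤ ∫ x in s, f x ∂μ := setIntegral_nonneg hs h0
  have hJ := (convexOn_rpow hκ).map_set_average_le
    (continuousOn_id.rpow_const fun x _ => Or.inr (by linarith)) isClosed_Ici hμ0 hμ
    ((ae_restrict_mem hs).mono h0) hf hfκ
  rw [setAverage_eq, setAverage_eq, smul_eq_mul, smul_eq_mul] at hJ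
  rw [Real.mul_rpow (by positivity) hI, Real.inv_rpow hpos.le] at hJ
  calc μ.real s ^ (1 - κ) * (∫ x in s, f x ∂μ) ^ κ
      = μ.real s * ((μ.real s ^ κ)⁻¹ * (∫ x in s, f x ∂μ) ^ κ) := by
        rw [Real.rpow_sub hpos, Real.rpow_one]; ring
    _ ≤ μ.real s * ((μ.real s)⁻¹ * ∫ x in s, f x ^ κ ∂μ) := by gcongr
    _ = _ := by rw [mul_inv_cancel_left₀ hpos.ne']

end Inequalities

/-- AM-GM: 5r/4 is the midpoint of r and 3r/2. The growth exponent β is tuned so that the boundary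
flux carries this power. -/
theorem rpow_le_half_add {x r : ℝ} (hx : 0 < x) :
    x ^ (5 * r / 4) ≤ 1 / 2 * (x ^ r + x ^ (3 * r / 2)) := by
  have h1 : x ^ (5 * r / 4) = (x ^ (r / 2)) * x ^ (3 * r / 4) := by
    rw [← Real.rpow_add hx]; ring_nf
  have h2 : x ^ r = (x ^ (r / 2)) ^ 2 := by
    rw [← Real.rpow_natCast, ← Real.rpow_mul hx.le]; norm_num
  have h3 : x ^ (3 * r / 2) = (x ^ (3 * r / 4)) ^ 2 := by
    rw [← Real.rpow_natCast, ← Real.rpow_mul hx.le]; congr 1; push_cast; ring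
  rw [h1, h2, h3]
  nlinarith [sq_nonneg (x ^ (r / 2) - x ^ (3 * r / 4))]

/-- Weighted AM-GM: ms + s is the combination of ms and 3ms/2 with weights 1 - 2/m and 2/m, whence
the coefficient m - 2 in c₁. -/
theorem rpow_add_le_convex {x m s : ℝ} (hx : 0 < x) (hm : 2 < m) :
    x ^ (m * s + s) ≤ (1 - 2 / m) * x ^ (m * s) + 2 / m * x ^ (3 * (m * s) / 2) := by
  have hm0 : 0 < m := by linarith
  have h := Real.geom_mean_le_arith_mean2_weighted (w₁ := 1 - 2 / m) (w₂ := 2 / m)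
    (by rw [sub_nonneg, div_le_one hm0]; exact hm.le) (by positivity)
    (Real.rpow_nonneg hx.le (m * s)) (Real.rpow_nonneg hx.le (3 * (m * s) / 2)) (by ring)
  rw [← Real.rpow_mul hx.le, ← Real.rpow_mul hx.le, ← Real.rpow_add hx] at h
  refine (le_of_eq ?_).trans h
  congr 1
  field_simp
  ring

/-- Young's inequality with exponents `4` and `4/3`. -/
theorem young_four {x y ε : ℝ} (hx : 0 ≤ x) (hy : 0 ≤ y) (hε : 0 < ε) :
    x ^ (3 / 4 : ℝ) * y ^ (3 / 4 : ℝ) ≤ x ^ 3 / (4 * ε ^ 3) + 3 / 4 * ε * y := by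
  -- In the geometric mean of (x/ε)³ and εy with weights 1/4 and 3/4 the powers of ε cancel.
  have h := Real.geom_mean_le_arith_mean2_weighted (w₁ := 1 / 4) (w₂ := 3 / 4)
    (by norm_num) (by norm_num) (p₁ := (x / ε) ^ 3) (p₂ := ε * y) (by positivity) (by positivity)
    (by norm_num)
  have e : ((x / ε) ^ 3) ^ (1 / 4 : ℝ) * (ε * y) ^ (3 / 4 : ℝ)
      = x ^ (3 / 4 : ℝ) * y ^ (3 / 4 : ℝ) := by
    rw [← Real.rpow_natCast, ← Real.rpow_mul (by positivity), Real.div_rpow hx hε.le,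
      Real.mul_rpow hε.le hy]
    norm_num
    have : ε ^ (3 / 4 : ℝ) ≠ 0 := (Real.rpow_pos_of_pos hε _).ne'
    field_simp
  rw [e] at h
  refine h.trans (le_of_eq ?_)
  field_simp

/-- Midpoint convexity of t ↦ t^{3/2}, multiplied by 2^{3/2}. -/
theorem add_rpow_three_halves_le {x y : ℝ} (hx : 0 ≤ x) (hy : 0 ≤ y) :
    (x + y) ^ (3 / 2 : ℝ) ≤ √2 * (x ^ (3 / 2 : ℝ) + y ^ (3 / 2 : ℝ)) := by
  have h := (convexOn_rpow (show (1 : ℝ) ≤ 3 / 2 by norm_num)).2 (mem_Ici.2 hx) (mem_Ici.2 hy)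
    (show (0 : ℝ) ≤ 1 / 2 by norm_num) (show (0 : ℝ) ≤ 1 / 2 by norm_num) (by norm_num)
  simp only [smul_eq_mul] at h
  rw [← mul_add, Real.mul_rpow (by norm_num) (by positivity), ← mul_add] at h
  have e : (1 / 2 : ℝ) ^ (3 / 2 : ℝ) = 1 / (2 * √2) := by
    rw [Real.div_rpow (by norm_num) (by norm_num), Real.one_rpow, Real.sqrt_eq_rpow]
    congr 1
    conv_rhs => rw [← Real.rpow_one_add' (by norm_num) (by norm_num)]
    norm_num
  rw [e, div_mul_eq_mul_div, one_mul, div_le_iff₀ (by positivity)] at h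
  linarith

theorem rpow_three_halves_eq {x : ℝ} (hx : 0 ≤ x) : x ^ (3 / 2 : ℝ) = x * √x := by
  rw [Real.sqrt_eq_rpow, ← Real.rpow_one_add' hx (by norm_num)]
  norm_num

/-- A Lipschitz bound for t^{3/2} on [0, M]. It allows a full gradient integral to be replaced by
its cutoff version at a cost linear in the error. -/
theorem rpow_three_halves_le_add {x y e M : ℝ} (hx : 0 ≤ x) (hxM : x ≤ M) (hy : 0 ≤ y)
    (he : 0 ≤ e) (h : x ≤ y + e) : x ^ (3 / 2 : ℝ) ≤ y ^ (3 / 2 : ℝ) + 2 * √M * e := by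
  have hsM : √x ≤ √M := Real.sqrt_le_sqrt hxM
  rcases le_total x y with hxy | hxy
  · have := Real.rpow_le_rpow hx hxy (show (0 : ℝ) ≤ 3 / 2 by norm_num)
    have : 0 ≤ 2 * √M * e := by positivity
    linarith
  rw [rpow_three_halves_eq hx, rpow_three_halves_eq hy]
  have hs : √y ≤ √x := Real.sqrt_le_sqrt hxy
  have h0 := Real.sqrt_nonneg y
  have hx2 := Real.mul_self_sqrt hx
  have hy2 := Real.mul_self_sqrt hy
  set p := √x
  set q := √y
  have h1 : p * p * p - q * q * q ≤ 2 * p * (p * p - q * q) := by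
    -- This product is exactly the difference of the two sides of the claim.
    have : 0 ≤ (p - q) * (p * p + p * q - q * q) :=
      mul_nonneg (by linarith) (by nlinarith)
    nlinarith
  have h2 : p * p - q * q ≤ e := by linarith
  have h3 : 2 * p * (p * p - q * q) ≤ 2 * √M * e :=
    mul_le_mul (by linarith) h2 (by nlinarith) (by positivity)
  rw [← hx2, ← hy2]
  linarith

end

end PorousMedium

/-! ### The energy identity with a cutoff -/

namespace PorousMedium

noncomputable section

variable {Ω : Set E3} {x₀ : E3} {ρ₀ d δ : ℝ} {η : E3 → ℝ}

theorem hasGradientAt_rpow {v : E3 → ℝ} {x : E3} (hv : DifferentiableAt ℝ v x) (hx : 0 < v x)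
    (r : ℝ) :
    HasGradientAt (fun y => v y ^ r) ((r * v x ^ (r - 1)) • gradient v x) x := by
  rw [hasGradientAt_iff_hasFDerivAt, map_smul, toDual_gradient]
  exact hv.hasFDerivAt.rpow_const (Or.inl hx.ne')

theorem sq_norm_gradient_sqrt {v : E3 → ℝ} {x : E3} (hv : DifferentiableAt ℝ v x) (hx : 0 < v x) :
    ‖gradient (fun y => √(v y)) x‖ ^ 2 = ‖gradient v x‖ ^ 2 / (4 * v x) := by
  have h := hv.hasFDerivAt.sqrt hx.ne'
  rw [norm_gradient_eq, norm_gradient_eq, h.fderiv, norm_smul, mul_pow, Real.norm_eq_abs, sq_abs,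
    div_pow, mul_pow, Real.sq_sqrt hx.le]
  ring

theorem continuousOn_laplacian (hΩ : IsOpen Ω) {V : E3 → ℝ} (hV : ContDiffOn ℝ 2 V Ω) :
    ContinuousOn (Laplacian.laplacian V) Ω := by
  set b := EuclideanSpace.basisFun (Fin 3) ℝ with hb
  have hV1 : ContDiffOn ℝ 1 (fderiv ℝ V) Ω := hV.fderiv_of_isOpen hΩ (by norm_num)
  have hV2 : ContinuousOn (fderiv ℝ (fderiv ℝ V)) Ω := hV1.continuousOn_fderiv_of_isOpen hΩ le_rfl
  rw [InnerProductSpace.laplacian_eq_iteratedFDeriv_orthonormalBasis V b]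
  refine continuousOn_finsetSum _ fun i _ => ?_
  simp only [iteratedFDeriv_two_apply]
  exact (hV2.clm_apply continuousOn_const).clm_apply continuousOn_const

theorem IsBoundaryCutoff.integrableOn_mul (hη : IsBoundaryCutoff Ω x₀ ρ₀ δ η) (hΩ : IsOpen Ω)
    {f : E3 → ℝ} (hf : ContinuousOn f Ω) : IntegrableOn (fun x => η x * f x) Ω :=
  integrableOn_mul_of_tsupport_subset hΩ hη.contDiff.continuous hη.hasCompactSupport
    hη.tsupport_subset hf

theorem IsBoundaryCutoff.integrableOn_one_sub (hη : IsBoundaryCutoff Ω x₀ ρ₀ δ η)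
    (hΩ : IsAdmissibleDomain Ω x₀ ρ₀ d) : IntegrableOn (fun x => 1 - η x) Ω :=
  integrableOn_of_bounded hΩ (M := 1)
    (continuousOn_const.sub hη.contDiff.continuous.continuousOn) fun x _ => by
    rw [abs_of_nonneg (sub_nonneg.2 (hη.le_one x))]; linarith [hη.nonneg x]

theorem IsBoundaryCutoff.setIntegral_mul_le (hη : IsBoundaryCutoff Ω x₀ ρ₀ δ η) (hΩ : IsOpen Ω)
    {f : E3 → ℝ} (hf : ContinuousOn f Ω) (hfi : IntegrableOn f Ω) (h0 : ∀ x ∈ Ω, 0 ≤ f x) :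
    ∫ x in Ω, η x * f x ≤ ∫ x in Ω, f x :=
  setIntegral_mono_on (hη.integrableOn_mul hΩ hf) hfi hΩ.measurableSet fun x hx =>
    mul_le_of_le_one_left (h0 x hx) (hη.le_one x)

theorem IsBoundaryCutoff.setIntegral_le_add (hη : IsBoundaryCutoff Ω x₀ ρ₀ δ η)
    (hΩ : IsAdmissibleDomain Ω x₀ ρ₀ d) {θ : ℝ} (hθ : ∫ x in Ω, (1 - η x) ≤ θ)
    {f : E3 → ℝ} (hf : ContinuousOn f Ω) {K : ℝ} (hK : 0 ≤ K)
    (h : ∀ x ∈ Ω, |f x| ≤ K) :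
    ∫ x in Ω, f x ≤ (∫ x in Ω, η x * f x) + K * θ := by
  have hi := hη.integrableOn_mul hΩ.isOpen hf
  have h1 := hη.integrableOn_one_sub hΩ
  calc ∫ x in Ω, f x ≤ ∫ x in Ω, (η x * f x + K * (1 - η x)) := by
        refine setIntegral_mono_on (integrableOn_of_bounded hΩ hf h) (hi.add (h1.const_mul _))
          hΩ.isOpen.measurableSet fun x hx => ?_
        have h2 := sub_nonneg.2 (hη.le_one x)
        have h3 := (le_abs_self _).trans (h x hx)
        nlinarith [mul_le_mul_of_nonneg_right h3 h2]
    _ = (∫ x in Ω, η x * f x) + K * ∫ x in Ω, (1 - η x) := by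
        rw [integral_add hi (h1.const_mul _), integral_const_mul]
    _ ≤ _ := by gcongr

/-- Integration by parts in the energy identity; the boundary flux is bounded by `hflux`. -/
theorem IsBoundaryCutoff.energy_le (hη : IsBoundaryCutoff Ω x₀ ρ₀ δ η)
    (hΩ : IsAdmissibleDomain Ω x₀ ρ₀ d) (hδ : 0 ≤ δ) {v : E3 → ℝ} (hv : ContDiffOn ℝ 2 v Ω)
    (hpos : ∀ x ∈ Ω, 0 < v x) {a b c k m q r κ P : ℝ} (hm : 0 ≤ m) (hr : 1 ≤ r)
    (hk : 0 ≤ k) (hκ : 0 ≤ κ)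
    (hflux : ∀ x ∈ Ω, -(m * v x ^ (r + m - 2)) * ⟪gradient η x, gradient v x⟫_ℝ
      ≤ ‖gradient η x‖ * (m * k * v x ^ (5 * r / 4) + κ)) :
    ∫ x in Ω, η x * (r * v x ^ (r - 1) * (Laplacian.laplacian (fun y => v y ^ m) x + a * P
        - b * v x ^ q - c * ‖gradient (fun y => √(v y)) x‖ ^ 2))
      ≤ r * ((1 + δ) / ρ₀ * (m * k * (3 * (∫ x in Ω, η x * v x ^ (5 * r / 4))
            + d * ∫ x in Ω, η x * ‖gradient (fun y => v y ^ (5 * r / 4)) x‖)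
            + 3 * κ * ∫ x in Ω, η x * 1)
          + a * P * (∫ x in Ω, η x * v x ^ (r - 1)) - b * (∫ x in Ω, η x * v x ^ (r - 1 + q))
          - c / 4 * ∫ x in Ω, η x * (v x ^ (r - 2) * ‖gradient v x‖ ^ 2)) := by
  have ho := hΩ.isOpen
  have hmeas := ho.measurableSet
  have hρ := hΩ.rho_pos
  have hvC1 : ContDiffOn ℝ 1 v Ω := hv.of_le (by norm_num)
  have hvd : ∀ x ∈ Ω, DifferentiableAt ℝ v x := fun x hx =>
    (hvC1.contDiffAt (ho.mem_nhds hx)).differentiableAt one_ne_zero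
  have hpow1 : ∀ t : ℝ, ContDiffOn ℝ 1 (fun x => v x ^ t) Ω := fun t =>
    hvC1.rpow_const_of_ne fun x hx => (hpos x hx).ne'
  have hpow2 : ContDiffOn ℝ 2 (fun x => v x ^ m) Ω :=
    hv.rpow_const_of_ne fun x hx => (hpos x hx).ne'
  have hpc : ∀ t : ℝ, ContinuousOn (fun x => v x ^ t) Ω := fun t => (hpow1 t).continuousOn
  have hgv := continuousOn_gradient ho hvC1
  have hlapc := continuousOn_laplacian ho hpow2
  have hI := fun {f : E3 → ℝ} (hf : ContinuousOn f Ω) => hη.integrableOn_mul ho hf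
  set ζ : E3 → ℝ := fun x => η x * v x ^ (r - 1) with hζ
  have hζC : ContDiff ℝ 1 ζ :=
    contDiff_mul_of_tsupport_subset ho hη.contDiff hη.tsupport_subset (hpow1 _)
  have hζc : HasCompactSupport ζ := hη.hasCompactSupport.mul_right
  have hζs : tsupport ζ ⊆ Ω := by
    refine (closure_mono ?_).trans hη.tsupport_subset
    intro x hx h
    exact hx (by simp [hζ, h])
  have hgreen := integral_mul_laplacian_eq ho hζC hζc hζs hpow2
  -- The first summand lives in the boundary layer and is the flux; the second is nonnegative
  -- because r ≥ 1, so after the sign change in Green's identity it can be discarded.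
  have hin : ∀ x ∈ Ω, ⟪gradient ζ x, gradient (fun y => v y ^ m) x⟫_ℝ
      = m * v x ^ (r + m - 2) * ⟪gradient η x, gradient v x⟫_ℝ
        + η x * ((r - 1) * v x ^ (r - 2) * (m * v x ^ (m - 1)) * ‖gradient v x‖ ^ 2) := by
    intro x hx
    have hp := hpos x hx
    have g1 : gradient ζ x = v x ^ (r - 1) • gradient η x
        + (η x * ((r - 1) * v x ^ (r - 2))) • gradient v x := by
      have h1 := ((hη.contDiff.differentiable one_ne_zero) x).hasGradientAt.hasFDerivAt
      have h2 := (hasGradientAt_rpow (hvd x hx) hp (r - 1)).hasFDerivAt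
      refine HasGradientAt.gradient ?_
      rw [hasGradientAt_iff_hasFDerivAt]
      refine (h1.mul h2).congr_fderiv ?_
      rw [map_add, map_smul, map_smul, map_smul, smul_smul, add_comm]
      ring_nf
    rw [g1, (hasGradientAt_rpow (hvd x hx) hp m).gradient, inner_add_left, real_inner_smul_left,
      real_inner_smul_left, real_inner_smul_right, real_inner_smul_right,
      real_inner_self_eq_norm_sq]
    have : v x ^ (r + m - 2) = v x ^ (r - 1) * v x ^ (m - 1) := by
      rw [← Real.rpow_add hp]; ring_nf
    rw [this]
    ring
  have hflux_int : -∫ x in Ω, ⟪gradient ζ x, gradient (fun y => v y ^ m) x⟫_ℝ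
      ≤ m * k * (∫ x in Ω, ‖gradient η x‖ * v x ^ (5 * r / 4))
        + κ * ∫ x in Ω, ‖gradient η x‖ * 1 := by
    have i1 := hη.integrableOn_gradient_mul ho (hpc (5 * r / 4))
    have i2 := hη.integrableOn_gradient_mul ho (continuousOn_const (c := (1 : ℝ)))
    rw [← integral_neg, ← integral_const_mul, ← integral_const_mul,
      ← integral_add (i1.const_mul _) (i2.const_mul _)]
    refine setIntegral_mono_on ?_ ((i1.const_mul _).add (i2.const_mul _)) hmeas fun x hx => ?_
    · refine Integrable.neg ?_
      have hcont : ContinuousOn (gradient fun y => v y ^ m) Ω := continuousOn_gradient ho (hpow1 m)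
      have hcs : IntegrableOn (fun x => ∑ i, ⟪gradient ζ x, EuclideanSpace.basisFun (Fin 3) ℝ i⟫_ℝ
          * ⟪EuclideanSpace.basisFun (Fin 3) ℝ i, gradient (fun y => v y ^ m) x⟫_ℝ) Ω := by
        refine integrable_finsetSum _ fun i _ => ?_
        refine integrableOn_mul_of_tsupport_subset ho
          (ζ := fun x => ⟪gradient ζ x, EuclideanSpace.basisFun (Fin 3) ℝ i⟫_ℝ) ?_ ?_ ?_
          (continuousOn_const.inner hcont)
        · exact (continuous_gradient hζC).inner continuous_const
        · refine (hasCompactSupport_gradient hζc).mono fun x hx h => hx ?_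
          simp [h]
        · refine (closure_mono ?_).trans ((tsupport_gradient_subset ζ).trans hζs)
          intro x hx h
          exact hx (by simp [h])
      simpa only [OrthonormalBasis.sum_inner_mul_inner, IntegrableOn] using hcs
    · rw [hin x hx]
      have h1 := hflux x hx
      have hp := hpos x hx
      have h2 : 0 ≤ η x * ((r - 1) * v x ^ (r - 2) * (m * v x ^ (m - 1)) * ‖gradient v x‖ ^ 2) := by
        have := hη.nonneg x
        have := sub_nonneg.2 hr
        positivity
      linarith
  have hb1 := hη.integral_gradient_mul_le hΩ hδ (hpow1 (5 * r / 4))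
    fun x hx => Real.rpow_nonneg (hpos x hx).le _
  -- With w = 1 this bounds the total mass of ‖∇η‖, a substitute for the surface area, which
  -- controls the error κ.
  have hb2 := hη.integral_gradient_mul_le hΩ hδ (contDiffOn_const (c := (1 : ℝ)))
    fun x _ => zero_le_one
  have e0 : ∀ x, gradient (fun _ : E3 => (1 : ℝ)) x = 0 := fun x => by simp
  simp only [e0, norm_zero, mul_zero, integral_zero, add_zero] at hb2
  -- The coefficient c/4 comes from |∇√v|² = |∇v|²/(4v), which also lowers the power r - 1 to r - 2.
  have hsplit : ∫ x in Ω, η x * (r * v x ^ (r - 1) * (Laplacian.laplacian (fun y => v y ^ m) x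
        + a * P - b * v x ^ q - c * ‖gradient (fun y => √(v y)) x‖ ^ 2))
      = r * ((∫ x in Ω, ζ x * Laplacian.laplacian (fun y => v y ^ m) x)
        + a * P * (∫ x in Ω, η x * v x ^ (r - 1)) - b * (∫ x in Ω, η x * v x ^ (r - 1 + q))
        - c / 4 * ∫ x in Ω, η x * (v x ^ (r - 2) * ‖gradient v x‖ ^ 2)) := by
    have j1 : IntegrableOn (fun x => ζ x * Laplacian.laplacian (fun y => v y ^ m) x) Ω :=
      integrableOn_mul_of_tsupport_subset ho hζC.continuous hζc hζs hlapc
    have j2 := (hI (hpc (r - 1))).const_mul (a * P)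
    have j3 := (hI (hpc (r - 1 + q))).const_mul b
    have j4 : IntegrableOn (fun x => c / 4 * (η x * (v x ^ (r - 2) * ‖gradient v x‖ ^ 2))) Ω :=
      (hI ((hpc (r - 2)).mul (hgv.norm.pow 2))).const_mul (c / 4)
    have j12 : IntegrableOn (fun x => ζ x * Laplacian.laplacian (fun y => v y ^ m) x
        + a * P * (η x * v x ^ (r - 1))) Ω := j1.add j2
    have j123 : IntegrableOn (fun x => ζ x * Laplacian.laplacian (fun y => v y ^ m) x
        + a * P * (η x * v x ^ (r - 1)) - b * (η x * v x ^ (r - 1 + q))) Ω := j12.sub j3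
    rw [← integral_const_mul (a * P), ← integral_const_mul b, ← integral_const_mul (c / 4),
      ← integral_add j1 j2, ← integral_sub j12 j3, ← integral_sub j123 j4,
      ← integral_const_mul]
    refine setIntegral_congr_fun hmeas fun x hx => ?_
    have hp := hpos x hx
    simp only [hζ]
    rw [sq_norm_gradient_sqrt (hvd x hx) hp, Real.rpow_add hp (r - 1) q,
      show r - 1 = (r - 2) + 1 by ring, Real.rpow_add hp (r - 2) 1, Real.rpow_one]
    field_simp
  rw [hsplit, hgreen]
  have hr0 : 0 ≤ r := by linarith
  refine mul_le_mul_of_nonneg_left ?_ hr0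
  have hmk : 0 ≤ m * k := mul_nonneg hm hk
  have hb1' : ∫ x in Ω, ‖gradient η x‖ * v x ^ (5 * r / 4)
      ≤ (1 + δ) / ρ₀ * (3 * (∫ x in Ω, η x * v x ^ (5 * r / 4))
        + d * ∫ x in Ω, η x * ‖gradient (fun y => v y ^ (5 * r / 4)) x‖) := by
    rw [div_mul_eq_mul_div, le_div_iff₀' hρ]; exact hb1
  have hb2' : ∫ x in Ω, ‖gradient η x‖ * 1 ≤ (1 + δ) / ρ₀ * (3 * ∫ x in Ω, η x * 1) := by
    rw [div_mul_eq_mul_div, le_div_iff₀' hρ]; exact hb2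
  have h1 := mul_le_mul_of_nonneg_left hb1' hmk
  have h2 := mul_le_mul_of_nonneg_left hb2' hκ
  linarith

end

end PorousMedium

/-! ### Sobolev and Young estimates for powers of the solution -/

namespace PorousMedium

noncomputable section

variable {Ω : Set E3} {x₀ : E3} {ρ₀ d δ : ℝ} {η : E3 → ℝ}

theorem two_rpow_three_halves : (2 : ℝ) ^ (3 / 2 : ℝ) = 2 * √2 :=
  rpow_three_halves_eq zero_le_two

theorem four_rpow_three_quarters : (4 : ℝ) ^ (3 / 4 : ℝ) = 2 * √2 := by
  rw [← two_rpow_three_halves, show (4 : ℝ) = 2 ^ (2 : ℝ) by norm_num, ← Real.rpow_mul zero_le_two]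
  norm_num

theorem norm_gradient_rpow {v : E3 → ℝ} {x : E3} (hv : DifferentiableAt ℝ v x) (hx : 0 < v x)
    {r : ℝ} (hr : 0 ≤ r) :
    ‖gradient (fun y => v y ^ r) x‖ = r * v x ^ (r - 1) * ‖gradient v x‖ := by
  rw [(hasGradientAt_rpow hv hx r).gradient, norm_smul, Real.norm_of_nonneg (by positivity)]

theorem norm_gradient_rpow_le {v : E3 → ℝ} {x : E3} (hv : DifferentiableAt ℝ v x) (hx : 0 < v x)
    {r M : ℝ} (hr : 1 ≤ r) (hM : v x ≤ M) (hM' : ‖gradient v x‖ ≤ M) :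
    ‖gradient (fun y => v y ^ r) x‖ ≤ r * M ^ r := by
  have hM0 : 0 < M := hx.trans_le hM
  rw [norm_gradient_rpow hv hx (by linarith), mul_assoc]
  have h1 : v x ^ (r - 1) ≤ M ^ (r - 1) := Real.rpow_le_rpow hx.le hM (by linarith)
  have h2 : M ^ r = M ^ (r - 1) * M := by
    rw [← Real.rpow_add_one hM0.ne']; ring_nf
  rw [h2]
  have : 0 ≤ r := by linarith
  gcongr

/-- Cauchy-Schwarz after writing |∇v^r| = 2 v^{r/2}|∇v^{r/2}|. The cutoff stays in the Dirichlet
integral to keep it finite: v may vanish at the boundary and r - 2 may be negative. -/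
theorem setIntegral_rpow_gradient_le (hη : IsBoundaryCutoff Ω x₀ ρ₀ δ η)
    (hΩ : IsAdmissibleDomain Ω x₀ ρ₀ d)
    {v : E3 → ℝ} (hv : ContDiffOn ℝ 1 v Ω) (hpos : ∀ x ∈ Ω, 0 < v x) {M r : ℝ} (hr : 1 ≤ r)
    (hM : ∀ x ∈ Ω, v x ≤ M) :
    (∫ x in Ω, η x * ‖gradient (fun y => v y ^ r) x‖) ^ 2
      ≤ 4 * (∫ x in Ω, v x ^ r)
        * (r ^ 2 / 4 * ∫ x in Ω, η x * (v x ^ (r - 2) * ‖gradient v x‖ ^ 2)) := by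
  have ho := hΩ.isOpen
  have hmeas := ho.measurableSet
  have hvd : ∀ x ∈ Ω, DifferentiableAt ℝ v x := fun x hx =>
    (hv.contDiffAt (ho.mem_nhds hx)).differentiableAt one_ne_zero
  have hpC : ∀ t : ℝ, ContDiffOn ℝ 1 (fun x => v x ^ t) Ω := fun t =>
    hv.rpow_const_of_ne fun x hx => (hpos x hx).ne'
  have hgv := continuousOn_gradient ho hv
  have hφi : IntegrableOn (fun x => v x ^ r) Ω :=
    integrableOn_of_bounded hΩ (hpC r).continuousOn (M := M ^ r) fun x hx => by
      rw [abs_of_nonneg (Real.rpow_nonneg (hpos x hx).le _)]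
      exact Real.rpow_le_rpow (hpos x hx).le (hM x hx) (by linarith)
  have hGc : ContinuousOn (fun x => v x ^ (r - 2) * ‖gradient v x‖ ^ 2) Ω :=
    (hpC (r - 2)).continuousOn.mul (hgv.norm.pow 2)
  have hGi := hη.integrableOn_mul ho hGc
  have hG0 : 0 ≤ ∫ x in Ω, η x * (v x ^ (r - 2) * ‖gradient v x‖ ^ 2) :=
    setIntegral_nonneg hmeas fun x hx => by
      have := hη.nonneg x
      have := hpos x hx
      positivity
  have hle := hη.setIntegral_mul_le ho (hpC r).continuousOn hφi
    fun x hx => Real.rpow_nonneg (hpos x hx).le _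
  have hcs := sq_setIntegral_le (μ := volume) hmeas (hη.integrableOn_mul ho (hpC r).continuousOn)
    (hGi.const_mul (r ^ 2)) (hη.integrableOn_mul ho (continuousOn_gradient ho (hpC r)).norm)
    (fun x hx => mul_nonneg (hη.nonneg x) (Real.rpow_nonneg (hpos x hx).le _))
    (fun x hx => by
      have := hη.nonneg x
      have := hpos x hx
      positivity)
    (fun x hx => by
      have hp := hpos x hx
      rw [norm_gradient_rpow (hvd x hx) hp (by linarith)]
      have e : v x ^ r * v x ^ (r - 2) = (v x ^ (r - 1)) ^ 2 := by
        rw [← Real.rpow_add hp, ← Real.rpow_natCast, ← Real.rpow_mul hp.le]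
        congr 1
        push_cast
        ring
      refine le_of_eq ?_
      linear_combination (-(η x ^ 2 * r ^ 2 * ‖gradient v x‖ ^ 2)) * e)
  rw [integral_const_mul] at hcs
  refine hcs.trans ?_
  have : 0 ≤ r ^ 2 * ∫ x in Ω, η x * (v x ^ (r - 2) * ‖gradient v x‖ ^ 2) := by positivity
  nlinarith [mul_le_mul_of_nonneg_right hle this]

/-- The Sobolev-type inequality for `v ^ (3 r / 2)`, with the Dirichlet integral of `v ^ (r / 2)`
weighted by a cutoff function. -/
theorem setIntegral_rpow_le_sobolev (hη : IsBoundaryCutoff Ω x₀ ρ₀ δ η)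
    (hΩ : IsAdmissibleDomain Ω x₀ ρ₀ d) (hδ : 0 ≤ δ) (hηδ : ∫ x in Ω, (1 - η x) ≤ δ)
    {v : E3 → ℝ} (hv : ContDiffOn ℝ 1 v Ω) (hpos : ∀ x ∈ Ω, 0 < v x) {M r ε : ℝ} (hr : 1 ≤ r)
    (hM : ∀ x ∈ Ω, v x ≤ M) (hM' : ∀ x ∈ Ω, ‖gradient v x‖ ≤ M) (hε : 0 < ε) :
    ∫ x in Ω, v x ^ (3 * r / 2) ≤
      1 / 2 * (3 ^ (3 / 2 : ℝ) / ρ₀ ^ (3 / 2 : ℝ)) * (∫ x in Ω, v x ^ r) ^ (3 / 2 : ℝ)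
      + √2 * (d / ρ₀ + 1) ^ (3 / 2 : ℝ) * ((∫ x in Ω, v x ^ r) ^ 3 / (4 * ε ^ 3)
        + 3 / 4 * ε * (r ^ 2 / 4 * ∫ x in Ω, η x * (v x ^ (r - 2) * ‖gradient v x‖ ^ 2)))
      + (d / ρ₀ + 1) ^ (3 / 2 : ℝ) * √(volume.real Ω * (r * M ^ r)) * (r * M ^ r) * δ := by
  have ho := hΩ.isOpen
  have hmeas := ho.measurableSet
  have hρ := hΩ.rho_pos
  have hd := hΩ.d_nonneg
  have hM0 : 0 < M := (hpos _ hΩ.mem).trans_le (hM _ hΩ.mem)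
  have hvd : ∀ x ∈ Ω, DifferentiableAt ℝ v x := fun x hx =>
    (hv.contDiffAt (ho.mem_nhds hx)).differentiableAt one_ne_zero
  have hw : ContDiffOn ℝ 1 (fun x => v x ^ r) Ω :=
    hv.rpow_const_of_ne fun x hx => (hpos x hx).ne'
  have hMr : 0 < M ^ r := Real.rpow_pos_of_pos hM0 r
  have hw0 : ∀ x ∈ Ω, 0 ≤ v x ^ r := fun x hx => Real.rpow_nonneg (hpos x hx).le _
  have hwM : ∀ x ∈ Ω, v x ^ r ≤ r * M ^ r := fun x hx =>
    (Real.rpow_le_rpow (hpos x hx).le (hM x hx) (by linarith)).trans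
      (le_mul_of_one_le_left hMr.le hr)
  have hgM : ∀ x ∈ Ω, ‖gradient (fun y => v y ^ r) x‖ ≤ r * M ^ r := fun x hx =>
    norm_gradient_rpow_le (hvd x hx) (hpos x hx) hr (hM x hx) (hM' x hx)
  have hpayne := integral_rpow_le_payne hΩ hw hw0 hwM hgM
  have e1 : ∫ x in Ω, v x ^ (3 * r / 2) = ∫ x in Ω, (v x ^ r) ^ (3 / 2 : ℝ) :=
    setIntegral_congr_fun hmeas fun x hx => by
      rw [← Real.rpow_mul (hpos x hx).le]
      ring_nf
  rw [e1]
  refine hpayne.trans ?_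
  have hgc := (continuousOn_gradient ho hw).norm
  have hJη := hη.setIntegral_le_add hΩ hηδ hgc (K := r * M ^ r) (by positivity) fun x hx => by
    rw [abs_of_nonneg (norm_nonneg _)]; exact hgM x hx
  have hJ0 : 0 ≤ ∫ x in Ω, ‖gradient (fun y => v y ^ r) x‖ := integral_nonneg fun x => norm_nonneg _
  have hJη0 : 0 ≤ ∫ x in Ω, η x * ‖gradient (fun y => v y ^ r) x‖ :=
    integral_nonneg fun x => mul_nonneg (hη.nonneg x) (norm_nonneg _)
  have hJM : ∫ x in Ω, ‖gradient (fun y => v y ^ r) x‖ ≤ volume.real Ω * (r * M ^ r) := by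
    have := norm_setIntegral_le_of_norm_le_const (μ := volume) (s := Ω)
      (f := fun x => ‖gradient (fun y => v y ^ r) x‖) (C := r * M ^ r)
      hΩ.isBounded.measure_lt_top fun x hx => by
        rw [norm_norm]; exact hgM x hx
    rw [mul_comm]
    exact (le_abs_self _).trans this
  have hφ0 : 0 ≤ ∫ x in Ω, v x ^ r := setIntegral_nonneg hmeas hw0
  have hg0 : 0 ≤ r ^ 2 / 4 * ∫ x in Ω, η x * (v x ^ (r - 2) * ‖gradient v x‖ ^ 2) :=
    mul_nonneg (by positivity) (setIntegral_nonneg hmeas fun x hx => by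
      have := hη.nonneg x
      have := hpos x hx
      positivity)
  have hcs := setIntegral_rpow_gradient_le hη hΩ hv hpos hr hM
  set φ := ∫ x in Ω, v x ^ r
  set J := ∫ x in Ω, ‖gradient (fun y => v y ^ r) x‖
  set Jη := ∫ x in Ω, η x * ‖gradient (fun y => v y ^ r) x‖
  set g := r ^ 2 / 4 * ∫ x in Ω, η x * (v x ^ (r - 2) * ‖gradient v x‖ ^ 2)
  -- The Payne-Schaefer bound involves the full gradient integral, whereas Cauchy-Schwarz controls
  -- only the cutoff one; the difference is of order δ.
  have hJ32 := rpow_three_halves_le_add hJ0 hJM hJη0 (by positivity) hJη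
  have hJη32 : Jη ^ (3 / 2 : ℝ) ≤ 2 * √2 * (φ ^ 3 / (4 * ε ^ 3) + 3 / 4 * ε * g) := by
    calc Jη ^ (3 / 2 : ℝ) = (Jη ^ 2) ^ (3 / 4 : ℝ) := by
          rw [← Real.rpow_natCast, ← Real.rpow_mul hJη0]; norm_num
      _ ≤ (4 * φ * g) ^ (3 / 4 : ℝ) := Real.rpow_le_rpow (sq_nonneg _) hcs (by norm_num)
      _ = 2 * √2 * (φ ^ (3 / 4 : ℝ) * g ^ (3 / 4 : ℝ)) := by
          rw [Real.mul_rpow (by positivity) hg0, Real.mul_rpow (by norm_num) hφ0,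
            four_rpow_three_quarters, mul_assoc]
      _ ≤ _ := by
          gcongr
          exact young_four hφ0 hg0 hε
  have hA1 : (3 / (2 * ρ₀) * φ) ^ (3 / 2 : ℝ)
      = 1 / (2 * √2) * (3 ^ (3 / 2 : ℝ) / ρ₀ ^ (3 / 2 : ℝ)) * φ ^ (3 / 2 : ℝ) := by
    rw [Real.mul_rpow (by positivity) hφ0, Real.div_rpow (by norm_num) (by positivity),
      Real.mul_rpow (by norm_num) hρ.le, two_rpow_three_halves]
    ring
  have hA2 : (1 / 2 * (d / ρ₀ + 1) * J) ^ (3 / 2 : ℝ)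
      = 1 / (2 * √2) * (d / ρ₀ + 1) ^ (3 / 2 : ℝ) * J ^ (3 / 2 : ℝ) := by
    rw [Real.mul_rpow (by positivity) hJ0, Real.mul_rpow (by norm_num) (by positivity),
      Real.div_rpow (by norm_num) (by norm_num), Real.one_rpow, two_rpow_three_halves]
  refine (add_rpow_three_halves_le (by positivity) (by positivity)).trans ?_
  rw [hA1, hA2]
  have hs2 : 0 < √(2 : ℝ) := by positivity
  have hD : 0 ≤ (d / ρ₀ + 1) ^ (3 / 2 : ℝ) := by positivity
  have hfin := mul_le_mul_of_nonneg_left (hJ32.trans (add_le_add_left hJη32 _)) hD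
  have e2 : √2 * (1 / (2 * √2) * (3 ^ (3 / 2 : ℝ) / ρ₀ ^ (3 / 2 : ℝ)) * φ ^ (3 / 2 : ℝ)
        + 1 / (2 * √2) * (d / ρ₀ + 1) ^ (3 / 2 : ℝ) * J ^ (3 / 2 : ℝ))
      = 1 / 2 * (3 ^ (3 / 2 : ℝ) / ρ₀ ^ (3 / 2 : ℝ)) * φ ^ (3 / 2 : ℝ)
        + 1 / 2 * ((d / ρ₀ + 1) ^ (3 / 2 : ℝ) * J ^ (3 / 2 : ℝ)) := by
    field_simp
  rw [e2]
  linarith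

/-- Young's inequality that absorbs the power `3/2` into the dissipative power and the cube. -/
theorem young_absorb {b C φ L q r : ℝ} (hb : 0 < b) (hC : 0 < C) (hL : 0 < L) (hφ : 0 < φ)
    (hr : 0 < r) (hq : 1 < q) (hqr : 2 * q < r + 2) :
    C * φ ^ (3 / 2 : ℝ) ≤ r * b * (L * φ ^ ((r + q - 1) / r))
      + C * ((r - 2 * q + 2) / (4 * r - 2 * q + 2))
        * ((b / (3 * C) * (4 * r - 2 * q + 2) * L) ^ (3 * r / (4 * r - 2 * q + 2)))
          ^ (-((4 * r - 2 * q + 2) / (r - 2 * q + 2))) * φ ^ 3 := by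
  set N := 4 * r - 2 * q + 2 with hN
  set n := r - 2 * q + 2 with hn
  have hNp : 0 < N := by linarith
  have hnp : 0 < n := by linarith
  -- Chosen so that C · (3r/N) · E = r b L, which makes the first Young term equal to the
  -- dissipation.
  set E := b / (3 * C) * N * L with hE
  have hEp : 0 < E := by positivity
  clear_value E
  have hsum : 3 * r / N + n / N = 1 := by
    rw [← add_div, div_eq_one_iff_eq hNp.ne']; simp only [hN, hn]; ring
  -- These weights make the powers (r + q - 1)/r and 3 of φ combine to 3/2; the factor E^{3r/N} in
  -- the first point is cancelled by its inverse from the second.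
  have h := Real.geom_mean_le_arith_mean2_weighted (w₁ := 3 * r / N) (w₂ := n / N)
    (by positivity) (by positivity) (p₁ := E * φ ^ ((r + q - 1) / r))
    (p₂ := (E ^ (3 * r / N)) ^ (-(N / n)) * φ ^ (3 : ℝ)) (by positivity) (by positivity) hsum
  have e : (E * φ ^ ((r + q - 1) / r)) ^ (3 * r / N)
      * ((E ^ (3 * r / N)) ^ (-(N / n)) * φ ^ (3 : ℝ)) ^ (n / N) = φ ^ (3 / 2 : ℝ) := by
    rw [Real.mul_rpow hEp.le (by positivity), Real.mul_rpow (by positivity) (by positivity),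
      ← Real.rpow_mul (by positivity : 0 ≤ E ^ (3 * r / N)), ← Real.rpow_mul hφ.le,
      ← Real.rpow_mul hφ.le]
    have h1 : -(N / n) * (n / N) = -1 := by field_simp
    rw [h1, Real.rpow_neg_one]
    have h2 : φ ^ ((r + q - 1) / r * (3 * r / N)) * φ ^ (3 * (n / N)) = φ ^ (3 / 2 : ℝ) := by
      rw [← Real.rpow_add hφ]
      congr 1
      field_simp
      simp only [hN, hn]
      ring
    have h3 : E ^ (3 * r / N) ≠ 0 := (Real.rpow_pos_of_pos hEp _).ne'
    rw [← h2]
    field_simp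
  rw [e] at h
  have h' := mul_le_mul_of_nonneg_left h hC.le
  refine h'.trans (le_of_eq ?_)
  rw [show φ ^ (3 : ℝ) = φ ^ 3 from by norm_cast]
  have e3 : C * (3 * r / N * (E * φ ^ ((r + q - 1) / r)))
      = r * b * (L * φ ^ ((r + q - 1) / r)) := by
    simp only [hE]
    field_simp
  rw [mul_add, e3]
  ring

end

end PorousMedium

/-! ### The constants and the differential inequality -/

namespace PorousMedium

noncomputable section

variable {Ω : Set E3} {x₀ : E3} {ρ₀ d : ℝ}

theorem IsAdmissibleDomain.volume_pos (hΩ : IsAdmissibleDomain Ω x₀ ρ₀ d) : 0 < volume.real Ω :=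
  ENNReal.toReal_pos (hΩ.isOpen.measure_pos volume ⟨_, hΩ.mem⟩).ne'
    hΩ.isBounded.measure_lt_top.ne

theorem IsAdmissibleDomain.d_pos (hΩ : IsAdmissibleDomain Ω x₀ ρ₀ d) : 0 < d := by
  obtain ⟨x, ν, ⟨hx, ψ, hψ, rfl⟩, h⟩ := hΩ.isLeast_rho.1
  have h1 := hΩ.rho_pos
  have h2 := hΩ.norm_sub_le (frontier_subset_closure hx)
  refine lt_of_lt_of_le ?_ h2
  rw [norm_pos_iff]
  intro h0
  rw [h0, inner_zero_left] at h
  linarith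

section Constants

variable {a b c k m q s vol ε₁ ε₂ : ℝ}

theorem c₁_pos (ha : 0 < a) (hk : 0 < k) (hm : 2 < m) (hs : 0 < s) (hv : 0 < vol)
    (hρ : 0 < ρ₀) : 0 < c₁ a k m s vol ρ₀ := by
  have : 0 < m - 2 := by linarith
  have : 0 < m := by linarith
  unfold c₁
  positivity

theorem c₂_pos (ha : 0 < a) (hk : 0 < k) (hm : 2 < m) (hs : 0 < s) (hv : 0 < vol)
    (hρ : 0 < ρ₀) (hd : 0 < d) (hε : 0 < ε₁) : 0 < c₂ a k m s vol ρ₀ d ε₁ := by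
  have : 0 < m := by linarith
  unfold c₂
  positivity

theorem c₃_pos (ha : 0 < a) (hk : 0 < k) (hm : 2 < m) (hs : 0 < s) (hv : 0 < vol)
    (hρ : 0 < ρ₀) (hd : 0 < d) (hε : 0 < ε₁) (hε₂ : 0 < ε₂) :
    0 < c₃ a k m s vol ρ₀ d ε₁ ε₂ := by
  have : 0 < m := by linarith
  unfold c₃
  positivity

theorem c₅_pos (ha : 0 < a) (hb : 0 < b) (hk : 0 < k) (hm : 2 < m) (hs : 0 < s) (hv : 0 < vol)
    (hρ : 0 < ρ₀) (hd : 0 < d) (hε : 0 < ε₁) (hε₂ : 0 < ε₂) (hq : q < s + 1) :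
    0 < c₅ a b k m q s vol ρ₀ d ε₁ ε₂ := by
  have h2 := c₂_pos ha hk hm hs hv hρ hd hε
  have h3 := c₃_pos ha hk hm hs hv hρ hd hε hε₂
  have hms : 2 * s < m * s := by nlinarith
  -- Here m > 2 and p > q combine: ms > 2s > 2q - 2.
  have h4 : 0 < m * s - 2 * q + 2 := by linarith
  have h5 : 0 < 4 * m * s - 2 * q + 2 := by nlinarith
  have h6 : 0 < ε₃ a b k m q s vol ρ₀ d ε₁ := by
    unfold ε₃
    positivity
  unfold c₅
  positivity

/-- As a function of ε₂, c₄ is affine, Aε₂ - B with A > 0, and the upper bound on ε₁ says exactly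
that B > 0. The root B/A is taken. -/
theorem exists_c₄_nonpos (ha : 0 < a) (hk : 0 < k) (hm : 2 < m) (hs : 0 < s)
    (hv : 0 < vol) (hρ : 0 < ρ₀) (hd : 0 < d) (hε : 0 < ε₁)
    (hε' : ε₁ < 2 * ρ₀ * c / (5 * m ^ 2 * s * d * k)) :
    ∃ ε₂ : ℝ, 0 < ε₂ ∧ c₄ a c k m s vol ρ₀ d ε₁ ε₂ ≤ 0 := by
  have hm0 : 0 < m := by linarith
  set A := (d / ρ₀ + 1) ^ (3 / 2 : ℝ) *
    (3 / 2 * √2 * a * s * vol + 9 * √2 * m ^ 2 * s * k / (8 * ρ₀)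
      + 15 * √2 * m ^ 3 * s ^ 2 * k * d / (32 * ε₁ * ρ₀)) with hA
  have hAp : 0 < A := by positivity
  set B := c / (m * s) - 5 * m * d * k * ε₁ / (2 * ρ₀) with hB
  have hBp : 0 < B := by
    rw [lt_div_iff₀ (by positivity)] at hε'
    rw [hB, sub_pos, div_lt_div_iff₀ (by positivity) (by positivity)]
    nlinarith
  refine ⟨B / A, by positivity, ?_⟩
  have : c₄ a c k m s vol ρ₀ d ε₁ (B / A) = A * (B / A) - B := by
    simp only [c₄, hB, hA]; ring
  rw [this, mul_div_cancel₀ _ hAp.ne', sub_self]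

end Constants

set_option maxHeartbeats 1600000 in
/-- The differential inequality for the weighted energy, at a fixed time. -/
theorem IsAdmissibleDomain.exists_energy_estimate (hΩ : IsAdmissibleDomain Ω x₀ ρ₀ d)
    {a b c k m p q ε₁ ε₂ M : ℝ} (ha : 0 < a) (hb : 0 < b) (hk : 0 < k)
    (hq : 3 / 2 < q) (hpq : q < p) (hm : 2 < m) (hM0 : 0 < M) (hε₁ : 0 < ε₁) (hε₂ : 0 < ε₂)
    (hc₄ : c₄ a c k m (p - 1) (volume.real Ω) ρ₀ d ε₁ ε₂ ≤ 0) :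
    ∃ C : ℝ, 0 ≤ C ∧ ∀ (v : E3 → ℝ) (η : E3 → ℝ) (δ κ : ℝ), ContDiffOn ℝ 2 v Ω →
      (∀ x ∈ Ω, 0 < v x) → (∀ x ∈ Ω, v x ≤ M) → (∀ x ∈ Ω, ‖gradient v x‖ ≤ M) →
      0 ≤ δ → δ ≤ 1 → 0 ≤ κ → IsBoundaryCutoff Ω x₀ ρ₀ δ η → ∫ x in Ω, (1 - η x) ≤ δ →
      (∀ x ∈ Ω, -(m * v x ^ (m * (p - 1) + m - 2)) * ⟪gradient η x, gradient v x⟫_ℝ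
        ≤ ‖gradient η x‖ * (m * k * v x ^ (5 * (m * (p - 1)) / 4) + κ)) →
      ∫ x in Ω, η x * (m * (p - 1) * v x ^ (m * (p - 1) - 1) *
          (Laplacian.laplacian (fun y => v y ^ m) x + a * (∫ y in Ω, v y ^ p)
            - b * v x ^ q - c * ‖gradient (fun y => √(v y)) x‖ ^ 2))
        ≤ c₁ a k m (p - 1) (volume.real Ω) ρ₀ * (∫ x in Ω, v x ^ (m * (p - 1)))
          + c₅ a b k m q (p - 1) (volume.real Ω) ρ₀ d ε₁ ε₂
            * (∫ x in Ω, v x ^ (m * (p - 1))) ^ 3 + C * (δ + κ) := by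
  have ho := hΩ.isOpen
  have hmeas := ho.measurableSet
  have hρ := hΩ.rho_pos
  have hd := hΩ.d_pos
  have hV := hΩ.volume_pos
  have hμ : volume Ω ≠ ⊤ := hΩ.isBounded.measure_lt_top.ne
  have hμ0 : volume Ω ≠ 0 := (ho.measure_pos volume ⟨_, hΩ.mem⟩).ne'
  obtain ⟨s, rfl⟩ : ∃ s, p = s + 1 := ⟨p - 1, by ring⟩
  rw [add_sub_cancel_right] at hc₄ ⊢
  have hs : 1 / 2 < s := by linarith
  have hs0 : 0 < s := by linarith
  have hm0 : 0 < m := by linarith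
  set r := m * s with hr
  have hr2 : 2 * s < r := by rw [hr]; nlinarith
  have hr1 : 1 ≤ r := by linarith
  have hr0 : 0 < r := by linarith
  set V := volume.real Ω with hVdef
  set D := (d / ρ₀ + 1) ^ (3 / 2 : ℝ) with hD
  have hDp : 0 < D := by positivity
  -- The total coefficient of X = ∫ v^{3r/2}, from the nonlocal source and both boundary terms. The
  -- constants c₂, c₃ and the ε₂-part of c₄ are KX times the Sobolev coefficients.
  set KX := 2 * a * s * V + 3 * m ^ 2 * s * k / (2 * ρ₀)
    + 5 * m ^ 3 * s ^ 2 * k * d / (8 * ρ₀ * ε₁) with hKX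
  have hKXp : 0 < KX := by positivity
  set C1 := m * k / ρ₀ * (3 * (V * M ^ (5 * r / 4)) + d * (V * (5 * r / 4 * M ^ (5 * r / 4))))
    with hC1
  set C2 := D * √(V * (r * M ^ r)) * (r * M ^ r) with hC2
  have hC1p : 0 ≤ C1 := by positivity
  have hC2p : 0 ≤ C2 := by positivity
  -- The error constant depends on v only through the bound M, hence is uniform over all times and
  -- all cutoffs.
  refine ⟨r * C1 + r * (6 * V / ρ₀) + r * (b * M ^ (r - 1 + q)) + KX * C2, by positivity, ?_⟩
  intro v η δ κ hv hpos hM hM' hδ hδ1 hκ hη hηδ hflux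
  have hvC1 : ContDiffOn ℝ 1 v Ω := hv.of_le (by norm_num)
  have hvd : ∀ x ∈ Ω, DifferentiableAt ℝ v x := fun x hx =>
    (hvC1.contDiffAt (ho.mem_nhds hx)).differentiableAt one_ne_zero
  have hpC : ∀ t : ℝ, ContDiffOn ℝ 1 (fun x => v x ^ t) Ω := fun t =>
    hvC1.rpow_const_of_ne fun x hx => (hpos x hx).ne'
  have hpc : ∀ t : ℝ, ContinuousOn (fun x => v x ^ t) Ω := fun t => (hpC t).continuousOn
  have hp0 : ∀ t : ℝ, ∀ x ∈ Ω, 0 ≤ v x ^ t := fun t x hx => Real.rpow_nonneg (hpos x hx).le _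
  have hpM : ∀ t : ℝ, 0 ≤ t → ∀ x ∈ Ω, v x ^ t ≤ M ^ t := fun t ht x hx =>
    Real.rpow_le_rpow (hpos x hx).le (hM x hx) ht
  have hpMa : ∀ t : ℝ, 0 ≤ t → ∀ x ∈ Ω, |v x ^ t| ≤ M ^ t := fun t ht x hx => by
    rw [abs_of_nonneg (hp0 t x hx)]; exact hpM t ht x hx
  have hpi : ∀ t : ℝ, 0 ≤ t → IntegrableOn (fun x => v x ^ t) Ω := fun t ht =>
    integrableOn_of_bounded hΩ (hpc t) (hpMa t ht)
  have hpI0 : ∀ t : ℝ, 0 ≤ ∫ x in Ω, v x ^ t := fun t => setIntegral_nonneg hmeas (hp0 t)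
  have hconst : ∀ K : ℝ, ∫ _ in Ω, K = V * K := fun K => by
    rw [setIntegral_const, smul_eq_mul]
  have hconsti : ∀ K : ℝ, IntegrableOn (fun _ : E3 => K) Ω := fun K => integrableOn_const hμ
  have hgv := continuousOn_gradient ho hvC1
  have hφpos : 0 < ∫ x in Ω, v x ^ r := by
    rw [setIntegral_pos_iff_support_of_nonneg_ae
      ((ae_restrict_mem hmeas).mono fun x hx => hp0 r x hx) (hpi r hr0.le)]
    have : Function.support (fun x => v x ^ r) ∩ Ω = Ω :=
      inter_eq_right.2 fun x hx => (Real.rpow_pos_of_pos (hpos x hx) r).ne'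
    rw [this]
    exact ho.measure_pos volume ⟨_, hΩ.mem⟩
  have hE := hη.energy_le hΩ hδ hv hpos (a := a) (b := b) (c := c) (q := q)
    (P := ∫ y in Ω, v y ^ (s + 1)) hm0.le hr1 hk.le hκ hflux
  have hX := setIntegral_rpow_le_sobolev hη hΩ hδ hηδ hvC1 hpos hr1 hM hM' hε₂
  -- boundary terms
  have hW : ∫ x in Ω, η x * v x ^ (5 * r / 4)
      ≤ 1 / 2 * ((∫ x in Ω, v x ^ r) + ∫ x in Ω, v x ^ (3 * r / 2)) := by
    refine (hη.setIntegral_mul_le ho (hpc _) (hpi _ (by positivity)) (hp0 _)).trans ?_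
    rw [← integral_add (hpi _ hr0.le) (hpi _ (by positivity)), ← integral_const_mul]
    exact setIntegral_mono_on (hpi _ (by positivity))
      (((hpi _ hr0.le).add (hpi _ (by positivity))).const_mul _) hmeas fun x hx =>
      rpow_le_half_add (hpos x hx)
  -- A crude bound suffices here, because it is used only where the integral is multiplied by δ.
  have hWb : ∫ x in Ω, η x * v x ^ (5 * r / 4) ≤ V * M ^ (5 * r / 4) := by
    refine (hη.setIntegral_mul_le ho (hpc _) (hpi _ (by positivity)) (hp0 _)).trans ?_
    rw [← hconst]
    exact setIntegral_mono_on (hpi _ (by positivity)) (hconsti _) hmeas (hpM _ (by positivity))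
  have hGc : ContinuousOn (fun x => v x ^ (r - 2) * ‖gradient v x‖ ^ 2) Ω :=
    (hpc (r - 2)).mul (hgv.norm.pow 2)
  have hGi := hη.integrableOn_mul ho hGc
  have hZi : IntegrableOn (fun x => η x * ‖gradient (fun y => v y ^ (5 * r / 4)) x‖) Ω :=
    hη.integrableOn_mul ho (continuousOn_gradient ho (hpC _)).norm
  -- Young with ε₁ applied to v^{3r/4} and v^{r/2-1}|∇v|: the square of the first gives X, that of
  -- the second the Dirichlet integral.
  have hZ : ∫ x in Ω, η x * ‖gradient (fun y => v y ^ (5 * r / 4)) x‖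
      ≤ 5 * r / 4 * (ε₁ / 2 * (∫ x in Ω, η x * (v x ^ (r - 2) * ‖gradient v x‖ ^ 2))
        + 1 / (2 * ε₁) * ∫ x in Ω, v x ^ (3 * r / 2)) := by
    have h1 := hpi (3 * r / 2) (by positivity)
    rw [← integral_const_mul, ← integral_const_mul,
      ← integral_add (hGi.const_mul _) (h1.const_mul _), ← integral_const_mul]
    refine setIntegral_mono_on hZi (((hGi.const_mul _).add (h1.const_mul _)).const_mul _) hmeas
      fun x hx => ?_
    have hp := hpos x hx
    rw [norm_gradient_rpow (hvd x hx) hp (by positivity)]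
    have e1 : v x ^ (5 * r / 4 - 1) = v x ^ (3 * r / 4) * v x ^ (r / 2 - 1) := by
      rw [← Real.rpow_add hp]; ring_nf
    have e2 : v x ^ (r - 2) = (v x ^ (r / 2 - 1)) ^ 2 := by
      rw [← Real.rpow_natCast, ← Real.rpow_mul hp.le]; congr 1; push_cast; ring
    have e3 : v x ^ (3 * r / 2) = (v x ^ (3 * r / 4)) ^ 2 := by
      rw [← Real.rpow_natCast, ← Real.rpow_mul hp.le]; congr 1; push_cast; ring
    have hη0 := hη.nonneg x
    have hη1 := hη.le_one x
    rw [e1, e2, e3]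
    set y := v x ^ (3 * r / 4)
    set z := v x ^ (r / 2 - 1) * ‖gradient v x‖ with hz
    have hyz : y * z ≤ ε₁ / 2 * z ^ 2 + 1 / (2 * ε₁) * y ^ 2 := by
      have : ε₁ / 2 * z ^ 2 + 1 / (2 * ε₁) * y ^ 2 - y * z = (ε₁ * z - y) ^ 2 / (2 * ε₁) := by
        field_simp; ring
      have h2 : 0 ≤ (ε₁ * z - y) ^ 2 / (2 * ε₁) := by positivity
      linarith
    have hy2 : η x * (1 / (2 * ε₁) * y ^ 2) ≤ 1 / (2 * ε₁) * y ^ 2 :=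
      mul_le_of_le_one_left (by positivity) hη1
    have h3 := mul_le_mul_of_nonneg_left hyz hη0
    calc η x * (5 * r / 4 * (y * v x ^ (r / 2 - 1)) * ‖gradient v x‖)
        = 5 * r / 4 * (η x * (y * z)) := by rw [hz]; ring
      _ ≤ 5 * r / 4 * (ε₁ / 2 * (η x * z ^ 2) + 1 / (2 * ε₁) * y ^ 2) := by
          refine mul_le_mul_of_nonneg_left ?_ (by positivity)
          linarith
      _ = _ := by rw [hz]; ring
  have hZb : ∫ x in Ω, η x * ‖gradient (fun y => v y ^ (5 * r / 4)) x‖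
      ≤ V * (5 * r / 4 * M ^ (5 * r / 4)) := by
    rw [← hconst]
    refine setIntegral_mono_on hZi (hconsti _) hmeas fun x hx => ?_
    refine (mul_le_of_le_one_left (norm_nonneg _) (hη.le_one x)).trans ?_
    exact norm_gradient_rpow_le (hvd x hx) (hpos x hx) (by linarith) (hM x hx) (hM' x hx)
  have hN : ∫ x in Ω, η x * 1 ≤ V := by
    rw [← mul_one V, ← hconst]
    exact hη.setIntegral_mul_le ho continuousOn_const (hconsti 1) fun _ _ => zero_le_one
  -- the nonlocal source
  have hQ : (∫ x in Ω, v x ^ (s + 1)) * (∫ x in Ω, η x * v x ^ (r - 1))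
      ≤ V * ((1 - 2 / m) * (∫ x in Ω, v x ^ r) + 2 / m * ∫ x in Ω, v x ^ (3 * r / 2)) := by
    have hmul : ∀ x ∈ Ω, v x ^ (s + 1) * v x ^ (r - 1) = v x ^ (r + s) := fun x hx => by
      rw [← Real.rpow_add (hpos x hx)]; ring_nf
    have h1 : IntegrableOn (fun x => v x ^ (s + 1) * v x ^ (r - 1)) Ω :=
      (integrableOn_congr_fun hmul hmeas).2 (hpi _ (by positivity))
    -- Both powers are nondecreasing functions of v, hence vary together; their exponents add up to
    -- r + s.
    have hcheb := setIntegral_mul_setIntegral_le (μ := volume) hmeas hμ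
      (hpi (s + 1) (by positivity)) (hpi (r - 1) (by linarith)) h1 fun x hx y hy => by
        rcases le_total (v x) (v y) with h | h
        · exact mul_nonneg_of_nonpos_of_nonpos
            (sub_nonpos.2 (Real.rpow_le_rpow (hpos x hx).le h (by positivity)))
            (sub_nonpos.2 (Real.rpow_le_rpow (hpos x hx).le h (by linarith)))
        · exact mul_nonneg
            (sub_nonneg.2 (Real.rpow_le_rpow (hpos y hy).le h (by positivity)))
            (sub_nonneg.2 (Real.rpow_le_rpow (hpos y hy).le h (by linarith)))
    refine (mul_le_mul_of_nonneg_left (hη.setIntegral_mul_le ho (hpc (r - 1))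
      (hpi _ (by linarith)) (hp0 _)) (hpI0 _)).trans (hcheb.trans ?_)
    refine mul_le_mul_of_nonneg_left ?_ hV.le
    have i1 := (hpi r hr0.le).const_mul (1 - 2 / m)
    have i2 := (hpi (3 * r / 2) (by positivity)).const_mul (2 / m)
    rw [← integral_const_mul, ← integral_const_mul, ← integral_add i1 i2]
    refine setIntegral_mono_on h1 (i1.add i2) hmeas fun x hx => ?_
    rw [hmul x hx]
    exact rpow_add_le_convex (hpos x hx) hm
  -- the absorption term
  have hB : V ^ ((1 - q) / r) * (∫ x in Ω, v x ^ r) ^ ((r + q - 1) / r)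
      ≤ (∫ x in Ω, η x * v x ^ (r - 1 + q)) + M ^ (r - 1 + q) * δ := by
    have hκ1 : 1 ≤ (r + q - 1) / r := by rw [le_div_iff₀ hr0]; linarith
    have hpw : ∀ x ∈ Ω, (v x ^ r) ^ ((r + q - 1) / r) = v x ^ (r - 1 + q) := fun x hx => by
      rw [← Real.rpow_mul (hpos x hx).le]
      congr 1
      field_simp
      ring
    have hj := rpow_setIntegral_le (μ := volume) hmeas hμ hμ0 hκ1 (hpi r hr0.le)
      ((integrableOn_congr_fun hpw hmeas).2 (hpi _ (by linarith))) (hp0 r)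
    rw [setIntegral_congr_fun hmeas hpw] at hj
    have : 1 - (r + q - 1) / r = (1 - q) / r := by field_simp; ring
    rw [this] at hj
    exact hj.trans (hη.setIntegral_le_add hΩ hηδ (hpc _) (Real.rpow_nonneg hM0.le _)
      (hpMa _ (by linarith)))
  have hL : 0 < V ^ ((1 - q) / r) := Real.rpow_pos_of_pos hV _
  have hc2 := c₂_pos ha hk hm hs0 hV hρ hd hε₁
  have hY := young_absorb (q := q) hb hc2 hL hφpos hr0 (by linarith) (by linarith)
  have hG0 : 0 ≤ ∫ x in Ω, η x * (v x ^ (r - 2) * ‖gradient v x‖ ^ 2) :=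
    setIntegral_nonneg hmeas fun x hx => by
      have := hη.nonneg x
      have := hpos x hx
      positivity
  have hNn : 0 ≤ ∫ x in Ω, η x * 1 := setIntegral_nonneg hmeas fun x hx => by
    have := hη.nonneg x
    positivity
  have hWn : 0 ≤ ∫ x in Ω, η x * v x ^ (5 * r / 4) := setIntegral_nonneg hmeas fun x hx =>
    mul_nonneg (hη.nonneg x) (hp0 _ x hx)
  refine hE.trans ?_
  -- From here on only real algebra remains, with the integrals as unknowns.
  generalize (∫ x in Ω, η x * (v x ^ (r - 2) * ‖gradient v x‖ ^ 2)) = G at *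
  generalize (∫ x in Ω, v x ^ (3 * r / 2)) = X at *
  generalize (∫ x in Ω, v x ^ r) = φ at *
  generalize (∫ x in Ω, η x * v x ^ (5 * r / 4)) = W at *
  generalize (∫ x in Ω, η x * ‖gradient (fun y => v y ^ (5 * r / 4)) x‖) = Z at *
  generalize (∫ x in Ω, η x * 1) = N at *
  generalize (∫ x in Ω, η x * v x ^ (r - 1)) = Q at *
  generalize (∫ x in Ω, v x ^ (s + 1)) = P at *
  generalize (∫ x in Ω, η x * v x ^ (r - 1 + q)) = B at *
  have hbd : (1 + δ) / ρ₀ * (m * k * (3 * W + d * Z) + 3 * κ * N)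
      ≤ m * k / ρ₀ * (3 * (1 / 2 * (φ + X))
        + d * (5 * r / 4 * (ε₁ / 2 * G + 1 / (2 * ε₁) * X))) + C1 * δ + 6 * V / ρ₀ * κ := by
    have h1 : m * k / ρ₀ * (3 * W + d * Z) ≤ m * k / ρ₀ * (3 * (1 / 2 * (φ + X))
        + d * (5 * r / 4 * (ε₁ / 2 * G + 1 / (2 * ε₁) * X))) := by gcongr
    have h2 : m * k / ρ₀ * (3 * W + d * Z) * δ ≤ C1 * δ := by
      rw [hC1]; gcongr
    have h3 : (1 + δ) / ρ₀ * (3 * κ * N) ≤ 2 / ρ₀ * (3 * κ * V) := by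
      gcongr
      linarith
    calc (1 + δ) / ρ₀ * (m * k * (3 * W + d * Z) + 3 * κ * N)
        = m * k / ρ₀ * (3 * W + d * Z) + m * k / ρ₀ * (3 * W + d * Z) * δ
          + (1 + δ) / ρ₀ * (3 * κ * N) := by ring
      _ ≤ _ := by
        have : 2 / ρ₀ * (3 * κ * V) = 6 * V / ρ₀ * κ := by ring
        linarith
  have hcomb : r * ((1 + δ) / ρ₀ * (m * k * (3 * W + d * Z) + 3 * κ * N) + a * P * Q - b * B
        - c / 4 * G)
      ≤ c₁ a k m s V ρ₀ * φ + KX * X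
        + (5 * m * d * k * ε₁ / (2 * ρ₀) - c / (m * s)) * (r ^ 2 / 4 * G)
        - r * b * (V ^ ((1 - q) / r) * φ ^ ((r + q - 1) / r))
        + (r * C1 + r * (b * M ^ (r - 1 + q))) * δ + r * (6 * V / ρ₀) * κ := by
    have h1 := mul_le_mul_of_nonneg_left hQ ha.le
    have h2 := mul_le_mul_of_nonneg_left hB hb.le
    have h3 : (1 + δ) / ρ₀ * (m * k * (3 * W + d * Z) + 3 * κ * N) + a * P * Q - b * B - c / 4 * G
        ≤ (m * k / ρ₀ * (3 * (1 / 2 * (φ + X))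
          + d * (5 * r / 4 * (ε₁ / 2 * G + 1 / (2 * ε₁) * X))) + C1 * δ + 6 * V / ρ₀ * κ)
          + a * (V * ((1 - 2 / m) * φ + 2 / m * X))
          - b * (V ^ ((1 - q) / r) * φ ^ ((r + q - 1) / r)) + b * (M ^ (r - 1 + q) * δ)
          - c / 4 * G := by linarith
    refine (mul_le_mul_of_nonneg_left h3 hr0.le).trans (le_of_eq ?_)
    generalize V ^ ((1 - q) / r) * φ ^ ((r + q - 1) / r) = F
    generalize M ^ (r - 1 + q) = T
    clear_value C1
    simp only [c₁, hKX, hr]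
    field_simp
    ring
  have hKXX := mul_le_mul_of_nonneg_left hX hKXp.le
  have e2 : KX * (1 / 2 * (3 ^ (3 / 2 : ℝ) / ρ₀ ^ (3 / 2 : ℝ))) = c₂ a k m s V ρ₀ d ε₁ := by
    simp only [c₂, hKX]; ring
  have e3 : KX * (√2 * D * (1 / (4 * ε₂ ^ 3))) = c₃ a k m s V ρ₀ d ε₁ ε₂ := by
    simp only [c₃, hKX, hD]; ring
  -- The constant c₄ is the total coefficient of r²G/4: Sobolev remainder plus boundary term minus
  -- the gradient damping, since r(c/4)G = (c/r)(r²G/4).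
  have e4 : KX * (√2 * D * (3 / 4 * ε₂)) + (5 * m * d * k * ε₁ / (2 * ρ₀) - c / (m * s))
      = c₄ a c k m s V ρ₀ d ε₁ ε₂ := by
    simp only [c₄, hKX, hD]; ring
  have e5 : c₅ a b k m q s V ρ₀ d ε₁ ε₂ = c₂ a k m s V ρ₀ d ε₁
      * ((r - 2 * q + 2) / (4 * r - 2 * q + 2))
        * ((b / (3 * c₂ a k m s V ρ₀ d ε₁) * (4 * r - 2 * q + 2) * V ^ ((1 - q) / r))
          ^ (3 * r / (4 * r - 2 * q + 2))) ^ (-((4 * r - 2 * q + 2) / (r - 2 * q + 2)))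
      + c₃ a k m s V ρ₀ d ε₁ ε₂ := by
    simp only [c₅, ε₃, hr, mul_assoc]
  rw [e5]
  have h4 : c₄ a c k m s V ρ₀ d ε₁ ε₂ * (r ^ 2 / 4 * G) ≤ 0 :=
    mul_nonpos_of_nonpos_of_nonneg hc₄ (by positivity)
  have hXe : KX * X ≤ c₂ a k m s V ρ₀ d ε₁ * φ ^ (3 / 2 : ℝ) + c₃ a k m s V ρ₀ d ε₁ ε₂ * φ ^ 3
      + KX * (√2 * D * (3 / 4 * ε₂)) * (r ^ 2 / 4 * G) + KX * C2 * δ := by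
    rw [← e2, ← e3]
    refine hKXX.trans (le_of_eq ?_)
    rw [hC2]
    ring
  have hδκ : (r * C1 + r * (b * M ^ (r - 1 + q))) * δ + r * (6 * V / ρ₀) * κ + KX * C2 * δ
      ≤ (r * C1 + r * (6 * V / ρ₀) + r * (b * M ^ (r - 1 + q)) + KX * C2) * (δ + κ) := by
    have t1 : 0 ≤ r * C1 * κ := by positivity
    have t2 : 0 ≤ r * (6 * V / ρ₀) * δ := by positivity
    have t3 : 0 ≤ r * (b * M ^ (r - 1 + q)) * κ := by positivity
    have t4 : 0 ≤ KX * C2 * κ := by positivity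
    linarith
  rw [← e4, add_mul] at h4
  linarith

end

end PorousMedium

/-! ### From the differential inequality to the blow-up time -/

namespace PorousMedium

noncomputable section

variable {Ω : Set E3} {x₀ : E3} {ρ₀ d : ℝ}

theorem IsOuterUnitNormal.norm_eq_one {x ν : E3} (h : IsOuterUnitNormal Ω x ν) : ‖ν‖ = 1 := by
  obtain ⟨-, ψ, hψ, rfl⟩ := h
  rw [norm_smul, norm_inv, norm_norm, inv_mul_cancel₀ (norm_ne_zero_iff.2 hψ.gradient_ne_zero)]

/-- Subsolutions of the Bernoulli equation `z' = A z + B z³`. -/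
theorem bernoulli_le {z : ℝ → ℝ} {A B τ : ℝ} (hA : 0 < A) (hτ : 0 ≤ τ)
    (hz : ContinuousOn z (Icc 0 τ)) (hpos : ∀ t ∈ Icc 0 τ, 0 < z t)
    (hd : ∀ t ∈ Ioo 0 τ, ∃ z', HasDerivAt z z' t ∧ z' ≤ A * z t + B * z t ^ 3) :
    (z 0 ^ 2)⁻¹ + B / A ≤ ((z τ ^ 2)⁻¹ + B / A) * Real.exp (2 * A * τ) := by
  -- The substitution z⁻² linearises the Bernoulli inequality to (z⁻²)' ≥ -2A z⁻² - 2B; w carries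
  -- its integrating factor and is nondecreasing.
  set w : ℝ → ℝ := fun t => ((z t ^ 2)⁻¹ + B / A) * Real.exp (2 * A * t) with hw
  have hcont : ContinuousOn w (Icc 0 τ) := by
    refine ContinuousOn.mul (ContinuousOn.add ?_ continuousOn_const) (by fun_prop)
    exact (hz.pow 2).inv₀ fun t ht => (pow_pos (hpos t ht) 2).ne'
  have hderiv : ∀ t ∈ Ioo 0 τ, ∃ w', HasDerivAt w w' t ∧ 0 ≤ w' := by
    intro t ht
    obtain ⟨z', hz', hle⟩ := hd t ht
    have hp := hpos t (Ioo_subset_Icc_self ht)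
    have h1 : HasDerivAt (fun t => (z t ^ 2)⁻¹ + B / A) (-(2 * z t * z') / (z t ^ 2) ^ 2) t := by
      have := (hz'.pow 2).inv (pow_pos hp 2).ne'
      simpa using this.add_const (B / A)
    have h2 : HasDerivAt (fun t => Real.exp (2 * A * t)) (Real.exp (2 * A * t) * (2 * A)) t := by
      have := ((hasDerivAt_id t).const_mul (2 * A)).exp
      simpa using this
    refine ⟨_, h1.mul h2, ?_⟩
    have e : -(2 * z t * z') / (z t ^ 2) ^ 2 * Real.exp (2 * A * t)
        + ((z t ^ 2)⁻¹ + B / A) * (Real.exp (2 * A * t) * (2 * A))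
        = 2 * Real.exp (2 * A * t) / z t ^ 3 * (A * z t + B * z t ^ 3 - z') := by
      field_simp
      ring
    rw [e]
    have := sub_nonneg.2 hle
    positivity
  have hmono : MonotoneOn w (Icc 0 τ) := by
    refine monotoneOn_of_deriv_nonneg (convex_Icc 0 τ) hcont ?_ ?_
    · rw [interior_Icc]
      intro t ht
      obtain ⟨w', h, -⟩ := hderiv t ht
      exact h.differentiableAt.differentiableWithinAt
    · rw [interior_Icc]
      intro t ht
      obtain ⟨w', h, h0⟩ := hderiv t ht
      rw [h.deriv]
      exact h0
  have := hmono (left_mem_Icc.2 hτ) (right_mem_Icc.2 hτ) hτ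
  simpa [hw] using this

/-- As τ → T the term φ(τ)⁻² vanishes, leaving φ(0)⁻² + B/A ≤ (B/A)e^{2AT}; taking logarithms
isolates T. -/
theorem bernoulli_lower_bound {φ : ℝ → ℝ} {A B T : ℝ} (hA : 0 < A) (hB : 0 < B) (hT : 0 < T)
    (h : ∀ τ ∈ Ioo 0 T, (φ 0 ^ 2)⁻¹ + B / A ≤ ((φ τ ^ 2)⁻¹ + B / A) * Real.exp (2 * A * τ))
    (hlim : Tendsto φ (𝓝[<] T) atTop) :
    1 / (2 * A) * Real.log (1 + A / B * φ 0 ^ (-2 : ℤ)) ≤ T := by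
  have h1 : Tendsto (fun τ => ((φ τ ^ 2)⁻¹ + B / A) * Real.exp (2 * A * τ)) (𝓝[<] T)
      (𝓝 ((0 + B / A) * Real.exp (2 * A * T))) := by
    refine Tendsto.mul (Tendsto.add ?_ tendsto_const_nhds) ?_
    · exact ((tendsto_pow_atTop two_ne_zero).comp hlim).inv_tendsto_atTop
    · exact ((by fun_prop : Continuous fun τ => Real.exp (2 * A * τ)).tendsto T).mono_left
        nhdsWithin_le_nhds
  have h2 := ge_of_tendsto h1 (by
    filter_upwards [Ioo_mem_nhdsLT hT] with τ hτ using h τ hτ)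
  rw [zero_add] at h2
  have e : φ 0 ^ (-2 : ℤ) = (φ 0 ^ 2)⁻¹ := by
    rw [zpow_neg]; norm_cast
  rw [e, one_div_mul_eq_div, div_le_iff₀ (by positivity), Real.log_le_iff_le_exp (by positivity),
    mul_comm T]
  have h3 := mul_le_mul_of_nonneg_left h2 (show 0 ≤ A / B by positivity)
  have e1 : A / B * ((φ 0 ^ 2)⁻¹ + B / A) = 1 + A / B * (φ 0 ^ 2)⁻¹ := by
    field_simp; ring
  have e2 : A / B * (B / A * Real.exp (2 * A * T)) = Real.exp (2 * A * T) := by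
    field_simp
  rw [e1, e2] at h3
  exact h3

section Solution

variable {a b c k m p q T : ℝ} {g : ℝ → ℝ} {u₀ : E3 → ℝ} {u : E3 → ℝ → ℝ} {Du : E3 → ℝ → E3}

theorem IsC10.nonneg_of_pos (hu : IsC10 Ω T u Du) (hpos : ∀ x ∈ Ω, ∀ t ∈ Ico 0 T, 0 < u x t)
    {x : E3} (hx : x ∈ closure Ω) {t : ℝ} (ht : t ∈ Ico 0 T) : 0 ≤ u x t := by
  refine le_on_closure (s := Ω) (f := fun _ => (0 : ℝ)) (g := fun y => u y t)
    (fun y hy => (hpos y hy t ht).le) continuousOn_const ?_ hx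
  exact hu.continuousOn.comp (f := fun y => (y, t)) (by fun_prop) fun y hy => ⟨hy, ht⟩

theorem isCompact_closure_prod (hΩ : IsAdmissibleDomain Ω x₀ ρ₀ d) (τ : ℝ) :
    IsCompact (closure Ω ×ˢ Icc 0 τ) :=
  hΩ.isBounded.isCompact_closure.prod isCompact_Icc

theorem IsC10.exists_bound (hu : IsC10 Ω T u Du) (hΩ : IsAdmissibleDomain Ω x₀ ρ₀ d) {τ : ℝ}
    (hτ : τ < T) :
    ∃ M : ℝ, 0 < M ∧ ∀ x ∈ closure Ω, ∀ t ∈ Icc 0 τ, u x t ≤ M ∧ ‖Du x t‖ ≤ M := by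
  have hsub : closure Ω ×ˢ Icc 0 τ ⊆ closure Ω ×ˢ Ico 0 T :=
    prod_mono le_rfl (Icc_subset_Ico_right hτ)
  obtain ⟨M₁, h1⟩ := (isCompact_closure_prod hΩ τ).exists_bound_of_continuousOn
    (hu.continuousOn.mono hsub)
  obtain ⟨M₂, h2⟩ := (isCompact_closure_prod hΩ τ).exists_bound_of_continuousOn
    (hu.continuousOn_gradient.mono hsub)
  refine ⟨max 1 (max M₁ M₂), by positivity, fun x hx t ht => ⟨?_, ?_⟩⟩
  · exact (le_abs_self _).trans ((h1 (x, t) ⟨hx, ht⟩).trans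
      ((le_max_left _ _).trans (le_max_right _ _)))
  · exact (h2 (x, t) ⟨hx, ht⟩).trans ((le_max_right _ _).trans (le_max_right _ _))

/-- The boundary condition controls the flux through the level sets of a boundary cutoff. -/
theorem IsC10.exists_flux_bound (hu : IsC10 Ω T u Du) (hΩ : IsAdmissibleDomain Ω x₀ ρ₀ d)
    (hpos : ∀ x ∈ Ω, ∀ t ∈ Ico 0 T, 0 < u x t)
    (hbc : ∀ x ν : E3, IsOuterUnitNormal Ω x ν → ∀ t ∈ Ico 0 T, ⟪Du x t, ν⟫_ℝ = g (u x t))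
    {r β : ℝ} (hm : 0 < m) (hk : 0 < k) (hr : 0 < r) (hrm : 0 < r + m - 2)
    (hβ : r + m - 2 + β = 5 * r / 4) (hg : ∀ ξ : ℝ, 0 ≤ ξ → g ξ ≤ k * ξ ^ β)
    {τ κ : ℝ} (hτ : τ < T) (hκ : 0 < κ) :
    ∃ δ₀ : ℝ, 0 < δ₀ ∧ ∀ δ η, δ ≤ δ₀ → IsBoundaryCutoff Ω x₀ ρ₀ δ η → ∀ t ∈ Icc 0 τ, ∀ x ∈ Ω,
      -(m * u x t ^ (r + m - 2)) * ⟪gradient η x, gradient (fun y => u y t) x⟫_ℝ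
        ≤ ‖gradient η x‖ * (m * k * u x t ^ (5 * r / 4) + κ) := by
  have hsubT : Icc 0 τ ⊆ Ico 0 T := Icc_subset_Ico_right hτ
  have hsub : closure Ω ×ˢ Icc 0 τ ⊆ closure Ω ×ˢ Ico 0 T := prod_mono le_rfl hsubT
  have hK := isCompact_closure_prod hΩ τ
  have huc := hu.continuousOn.mono hsub
  have hDc := hu.continuousOn_gradient.mono hsub
  have hHc : ContinuousOn (fun z : E3 × ℝ => (m * u z.1 z.2 ^ (r + m - 2)) • Du z.1 z.2)
      (closure Ω ×ˢ Icc 0 τ) :=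
    (continuousOn_const.mul (huc.rpow_const fun _ _ => Or.inr hrm.le)).smul hDc
  have hwc : ContinuousOn (fun z : E3 × ℝ => u z.1 z.2 ^ (5 * r / 4)) (closure Ω ×ˢ Icc 0 τ) :=
    huc.rpow_const fun _ _ => Or.inr (by positivity)
  -- The tolerance is used once for the flux field and mk times for u^{5r/4}, for a total of κ.
  have hκ' : 0 < κ / (1 + m * k) := by positivity
  obtain ⟨δ₁, hδ₁, h1⟩ := Metric.uniformContinuousOn_iff.1
    (hK.uniformContinuousOn_of_continuous hHc) _ hκ'
  obtain ⟨δ₂, hδ₂, h2⟩ := Metric.uniformContinuousOn_iff.1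
    (hK.uniformContinuousOn_of_continuous hwc) _ hκ'
  refine ⟨min δ₁ δ₂ / 2, by positivity, fun δ η hδ hη t ht x hx => ?_⟩
  by_cases hx0 : gradient η x = 0
  · simp [hx0]
  obtain ⟨y, ν, hν, hxy, hgr⟩ := hη.exists_normal x hx0
  have hyc : y ∈ closure Ω := frontier_subset_closure hν.1
  have hdist : dist (x, t) (y, t) < min δ₁ δ₂ := by
    rw [Prod.dist_eq]
    have h0 : 0 < min δ₁ δ₂ := lt_min hδ₁ hδ₂
    simp only [dist_self, dist_eq_norm, max_lt_iff]
    refine ⟨?_, h0⟩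
    linarith
  have hd1 := h1 (x, t) ⟨subset_closure hx, ht⟩ (y, t) ⟨hyc, ht⟩ (hdist.trans_le (min_le_left _ _))
  have hd2 := h2 (x, t) ⟨subset_closure hx, ht⟩ (y, t) ⟨hyc, ht⟩ (hdist.trans_le (min_le_right _ _))
  simp only [dist_eq_norm] at hd1 hd2
  have hgu : gradient (fun y => u y t) x = Du x t := (hu.hasGradientAt t (hsubT ht) x hx).gradient
  have hyb : ⟪(m * u y t ^ (r + m - 2)) • Du y t, ν⟫_ℝ ≤ m * k * u y t ^ (5 * r / 4) := by
    rw [real_inner_smul_left, hbc y ν hν t (hsubT ht)]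
    -- On the boundary u may vanish and no sign of β is assumed here, so splitting the power needs u
    -- > 0; at u = 0 both sides are zero.
    rcases (hu.nonneg_of_pos hpos hyc (hsubT ht)).eq_or_lt with h0 | h0
    · rw [← h0, Real.zero_rpow hrm.ne', Real.zero_rpow (by positivity)]
      simp
    · rw [← hβ, Real.rpow_add h0]
      have := mul_le_mul_of_nonneg_left (hg _ h0.le)
        (show 0 ≤ m * u y t ^ (r + m - 2) by positivity)
      linarith
  have hxb : ⟪(m * u x t ^ (r + m - 2)) • Du x t, ν⟫_ℝ
      ≤ m * k * u x t ^ (5 * r / 4) + κ := by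
    have hcs := real_inner_le_norm
      ((m * u x t ^ (r + m - 2)) • Du x t - (m * u y t ^ (r + m - 2)) • Du y t) ν
    rw [inner_sub_left, hν.norm_eq_one, mul_one] at hcs
    have h3 := (abs_le.1 (Real.norm_eq_abs _ ▸ hd2.le)).1
    have h4 : m * k * u y t ^ (5 * r / 4) ≤ m * k * u x t ^ (5 * r / 4)
        + m * k * (κ / (1 + m * k)) := by
      rw [← mul_add]
      exact mul_le_mul_of_nonneg_left (by linarith) (by positivity)
    have h5 : κ / (1 + m * k) + m * k * (κ / (1 + m * k)) = κ := by
      field_simp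
    linarith
  rw [hgu]
  calc -(m * u x t ^ (r + m - 2)) * ⟪gradient η x, Du x t⟫_ℝ
      = ‖gradient η x‖ * ⟪(m * u x t ^ (r + m - 2)) • Du x t, ν⟫_ℝ := by
        conv_lhs => rw [hgr]
        rw [inner_neg_left, real_inner_smul_left, real_inner_smul_left, real_inner_comm]
        ring
    _ ≤ _ := mul_le_mul_of_nonneg_left hxb (norm_nonneg _)

theorem IsC10.continuousOn_setIntegral (hu : IsC10 Ω T u Du) (hΩ : IsAdmissibleDomain Ω x₀ ρ₀ d)
    (hpos : ∀ x ∈ Ω, ∀ t ∈ Ico 0 T, 0 < u x t) {ζ : E3 → ℝ} (hζ : Continuous ζ)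
    (hζ0 : ∀ x, 0 ≤ ζ x) (hζ1 : ∀ x, ζ x ≤ 1) {r τ : ℝ} (hr : 0 ≤ r) (hτ : τ < T) :
    ContinuousOn (fun t => ∫ x in Ω, ζ x * u x t ^ r) (Icc 0 τ) := by
  have := isFiniteMeasure_restrict hΩ
  have hsubT : Icc 0 τ ⊆ Ico 0 T := Icc_subset_Ico_right hτ
  obtain ⟨M, hM0, hM⟩ := hu.exists_bound hΩ hτ
  have hmeas := hΩ.isOpen.measurableSet
  refine continuousOn_of_dominated (bound := fun _ => M ^ r) ?_ ?_ (integrable_const _) ?_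
  · intro t ht
    have : ContinuousOn (fun x => u x t) Ω :=
      hu.continuousOn.comp (f := fun y => (y, t)) (by fun_prop)
        fun y hy => ⟨subset_closure hy, hsubT ht⟩
    exact (hζ.continuousOn.mul (this.rpow_const fun _ _ => Or.inr hr)).aestronglyMeasurable hmeas
  · intro t ht
    filter_upwards [ae_restrict_mem hmeas] with x hx
    have hp := hpos x hx t (hsubT ht)
    have h1 := Real.rpow_nonneg hp.le r
    rw [Real.norm_of_nonneg (mul_nonneg (hζ0 x) h1)]
    exact (mul_le_of_le_one_left h1 (hζ1 x)).trans
      (Real.rpow_le_rpow hp.le (hM x (subset_closure hx) t ht).1 hr)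
  · filter_upwards [ae_restrict_mem hmeas] with x hx
    have : ContinuousOn (fun t => u x t) (Icc 0 τ) :=
      hu.continuousOn.comp (f := fun t => (x, t)) (by fun_prop)
        fun t ht => ⟨subset_closure hx, hsubT ht⟩
    exact continuousOn_const.mul (this.rpow_const fun _ _ => Or.inr hr)

/-- Differentiation under the integral needs a bound on the time derivative, which is available only
on compact subsets of Ω × (0,T); the compact support of ζ supplies one. -/
theorem IsC21.hasDerivAt_setIntegral (hu : IsC21 Ω T u) (hΩ : IsAdmissibleDomain Ω x₀ ρ₀ d)
    (hpos : ∀ x ∈ Ω, ∀ t ∈ Ico 0 T, 0 < u x t) {ζ : E3 → ℝ} (hζ : Continuous ζ)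
    (hζc : HasCompactSupport ζ) (hζs : tsupport ζ ⊆ Ω) (r : ℝ) {t : ℝ} (ht : t ∈ Ioo 0 T) :
    HasDerivAt (fun t => ∫ x in Ω, ζ x * u x t ^ r)
      (∫ x in Ω, ζ x * (r * u x t ^ (r - 1) * deriv (u x) t)) t := by
  have := isFiniteMeasure_restrict hΩ
  have ho := hΩ.isOpen
  have hmeas := ho.measurableSet
  have hIoo : Ioo 0 T ⊆ Ico 0 T := Ioo_subset_Ico_self
  obtain ⟨t₁, ht₁0, ht₁⟩ := exists_between ht.1
  obtain ⟨t₂, ht₂, ht₂T⟩ := exists_between ht.2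
  have hsub : Icc t₁ t₂ ⊆ Ioo 0 T := fun τ hτ => ⟨ht₁0.trans_le hτ.1, hτ.2.trans_lt ht₂T⟩
  have hpowc : ∀ e : ℝ, ContinuousOn (fun z : E3 × ℝ => u z.1 z.2 ^ e) (Ω ×ˢ Ioo 0 T) := fun e =>
    hu.continuousOn.rpow_const fun z hz => Or.inl (hpos z.1 hz.1 z.2 (hIoo hz.2)).ne'
  have hFc : ContinuousOn (fun z : E3 × ℝ => r * u z.1 z.2 ^ (r - 1) * deriv (u z.1) z.2)
      (Ω ×ˢ Ioo 0 T) := (continuousOn_const.mul (hpowc (r - 1))).mul hu.continuousOn_deriv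
  have hslice : ∀ {f : E3 × ℝ → ℝ}, ContinuousOn f (Ω ×ˢ Ioo 0 T) → ∀ τ ∈ Ioo 0 T,
      ContinuousOn (fun x => f (x, τ)) Ω := fun hf τ hτ =>
    hf.comp (f := fun y => (y, τ)) (by fun_prop) fun y hy => ⟨hy, hτ⟩
  obtain ⟨K, hK⟩ := (hζc.isCompact.prod (isCompact_Icc (a := t₁) (b := t₂))).exists_bound_of_continuousOn
    ((hζ.comp continuous_fst).continuousOn.mul (hFc.mono (prod_mono hζs hsub)))
  have hint : ∀ {f : E3 → ℝ}, ContinuousOn f Ω → IntegrableOn (fun x => ζ x * f x) Ω := fun hf =>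
    integrableOn_mul_of_tsupport_subset ho hζ hζc hζs hf
  refine (hasDerivAt_integral_of_dominated_loc_of_deriv_le (s := Icc t₁ t₂)
    (F := fun t x => ζ x * u x t ^ r)
    (F' := fun t x => ζ x * (r * u x t ^ (r - 1) * deriv (u x) t)) (bound := fun _ => max K 0)
    (Icc_mem_nhds ht₁ ht₂) ?_ (hint (hslice (hpowc r) t ht)) ?_ ?_ (integrable_const _) ?_).2
  · filter_upwards [Icc_mem_nhds ht₁ ht₂] with τ hτ
    exact (hint (hslice (hpowc r) τ (hsub hτ))).aestronglyMeasurable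
  · exact (hint (hslice hFc t ht)).aestronglyMeasurable
  · refine Eventually.of_forall fun x τ hτ => ?_
    by_cases hx : x ∈ tsupport ζ
    · exact (hK (x, τ) ⟨hx, hτ⟩).trans (le_max_left _ _)
    · rw [image_eq_zero_of_notMem_tsupport hx, zero_mul, norm_zero]
      exact le_max_right _ _
  · filter_upwards [ae_restrict_mem hmeas] with x hx τ hτ
    have h1 := (hu.differentiableAt_time x hx τ (hsub hτ)).hasDerivAt
    have h2 := (h1.rpow_const (p := r) (Or.inl (hpos x hx τ (hIoo (hsub hτ))).ne')).const_mul (ζ x)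
    exact h2.congr_deriv (by ring)

/-- The integrated form of the differential inequality for the energy of a classical solution. -/
theorem IsClassicalSolution.energy_le (hΩ : IsAdmissibleDomain Ω x₀ ρ₀ d)
    (hsol : IsClassicalSolution Ω a b c m p q g u₀ T u)
    (ha : 0 < a) (hb : 0 < b) (hk : 0 < k) (hq : 3 / 2 < q) (hpq : q < p) (hm : 2 < m)
    {ε₁ ε₂ : ℝ} (hε₁ : 0 < ε₁) (hε₂ : 0 < ε₂)
    (hc₄ : c₄ a c k m (p - 1) (volume.real Ω) ρ₀ d ε₁ ε₂ ≤ 0)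
    (hg : ∀ ξ : ℝ, 0 ≤ ξ → g ξ ≤ k * ξ ^ (m * (p - 1) / 4 - m + 2)) {τ : ℝ} (hτ : τ ∈ Ioo 0 T) :
    let A := c₁ a k m (p - 1) (volume.real Ω) ρ₀
    let B := c₅ a b k m q (p - 1) (volume.real Ω) ρ₀ d ε₁ ε₂
    ((∫ x in Ω, u x 0 ^ (m * (p - 1))) ^ 2)⁻¹ + B / A
      ≤ (((∫ x in Ω, u x τ ^ (m * (p - 1))) ^ 2)⁻¹ + B / A) * Real.exp (2 * A * τ) := by
  intro A B
  obtain ⟨hpos, hC21, hpde, ⟨Du, hC10, hbc⟩, hu0⟩ := hsol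
  have ho := hΩ.isOpen
  have hmeas := ho.measurableSet
  have hV := hΩ.volume_pos
  have hs : 0 < p - 1 := by linarith
  have hm0 : 0 < m := by linarith
  have hA : 0 < A := c₁_pos ha hk hm hs hV hΩ.rho_pos
  have hB : 0 < B := c₅_pos ha hb hk hm hs hV hΩ.rho_pos hΩ.d_pos hε₁ hε₂ (by linarith)
  have hsubT : Icc 0 τ ⊆ Ico 0 T := Icc_subset_Ico_right hτ.2
  obtain ⟨M, hM0, hM⟩ := hC10.exists_bound hΩ hτ.2
  obtain ⟨C, hC0, hC⟩ := hΩ.exists_energy_estimate (c := c) ha hb hk hq hpq hm hM0 hε₁ hε₂ hc₄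
  have hr : 0 < m * (p - 1) := by positivity
  set r := m * (p - 1) with hrdef
  set φ : ℝ → ℝ := fun t => ∫ x in Ω, u x t ^ r with hφ
  have hslice : ∀ t ∈ Icc 0 τ, ContinuousOn (fun x => u x t) Ω := fun t ht =>
    hC10.continuousOn.comp (f := fun y => (y, t)) (by fun_prop)
      fun y hy => ⟨subset_closure hy, hsubT ht⟩
  have hpc : ∀ t ∈ Icc 0 τ, ContinuousOn (fun x => u x t ^ r) Ω := fun t ht =>
    (hslice t ht).rpow_const fun _ _ => Or.inr hr.le
  have hpM : ∀ t ∈ Icc 0 τ, ∀ x ∈ Ω, |u x t ^ r| ≤ M ^ r := fun t ht x hx => by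
    have hp := hpos x hx t (hsubT ht)
    rw [abs_of_nonneg (Real.rpow_nonneg hp.le r)]
    exact Real.rpow_le_rpow hp.le (hM x (subset_closure hx) t ht).1 hr.le
  have hφpos : ∀ t ∈ Icc 0 τ, 0 < φ t := by
    intro t ht
    simp only [hφ]
    rw [setIntegral_pos_iff_support_of_nonneg_ae
      ((ae_restrict_mem hmeas).mono fun x hx => Real.rpow_nonneg (hpos x hx t (hsubT ht)).le _)
      (integrableOn_of_bounded hΩ (hpc t ht) (hpM t ht))]
    have : Function.support (fun x => u x t ^ r) ∩ Ω = Ω :=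
      inter_eq_right.2 fun x hx => (Real.rpow_pos_of_pos (hpos x hx t (hsubT ht)) r).ne'
    rw [this]
    exact ho.measure_pos volume ⟨_, hΩ.mem⟩
  have hφc : ContinuousOn φ (Icc 0 τ) := by
    have := hC10.continuousOn_setIntegral hΩ hpos continuous_const (ζ := fun _ => 1)
      (fun _ => zero_le_one) (fun _ => le_rfl) hr.le hτ.2
    simpa [hφ] using this
  -- The positive minimum μ of φ on [0,τ] turns the additive error into a small change of the linear
  -- coefficient, since 2Cε ≤ (2Cε/μ)φ.
  obtain ⟨tm, htm, hmin⟩ := isCompact_Icc.exists_isMinOn (nonempty_Icc.2 hτ.1.le) hφc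
  have hμ := hφpos tm htm
  set μ := φ tm with hμdef
  have hstep : ∀ ε : ℝ, 0 < ε → ∃ z0 zτ : ℝ, |z0 - φ 0| ≤ M ^ r * ε ∧ |zτ - φ τ| ≤ M ^ r * ε ∧
      (z0 ^ 2)⁻¹ + B / (A + C * (2 * ε) / μ) ≤ ((zτ ^ 2)⁻¹ + B / (A + C * (2 * ε) / μ))
        * Real.exp (2 * (A + C * (2 * ε) / μ) * τ) := by
    intro ε hε
    obtain ⟨δ₀, hδ₀, hflux⟩ := hC10.exists_flux_bound hΩ hpos hbc (m := m) (k := k) (r := r)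
      (β := m * (p - 1) / 4 - m + 2) hm0 hk hr (by linarith) (by rw [hrdef]; ring) hg hτ.2 hε
    set δ := min δ₀ (min ε 1) with hδdef
    have hδ : 0 < δ := by positivity
    have hδε : δ ≤ ε := (min_le_right _ _).trans (min_le_left _ _)
    have hδ1 : δ ≤ 1 := (min_le_right _ _).trans (min_le_right _ _)
    obtain ⟨η, hη, hηδ⟩ := hΩ.exists_cutoff hδ
    set ψ : ℝ → ℝ := fun t => ∫ x in Ω, η x * u x t ^ r with hψ
    have hMr : 0 < M ^ r := Real.rpow_pos_of_pos hM0 r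
    have hψφ : ∀ t ∈ Icc 0 τ, ψ t ≤ φ t := fun t ht =>
      hη.setIntegral_mul_le ho (hpc t ht) (integrableOn_of_bounded hΩ (hpc t ht) (hpM t ht))
        fun x hx => Real.rpow_nonneg (hpos x hx t (hsubT ht)).le _
    have hφψ : ∀ t ∈ Icc 0 τ, φ t ≤ ψ t + M ^ r * δ := fun t ht =>
      hη.setIntegral_le_add hΩ hηδ (hpc t ht) hMr.le (hpM t ht)
    have hAC : A ≤ A + C * (2 * ε) / μ := by
      have : 0 ≤ C * (2 * ε) / μ := by positivity
      linarith
    have habs : ∀ t ∈ Icc 0 τ, |ψ t + M ^ r * δ - φ t| ≤ M ^ r * ε := fun t ht => by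
      rw [abs_of_nonneg (sub_nonneg.2 (hφψ t ht))]
      have := mul_le_mul_of_nonneg_left hδε hMr.le
      linarith [hψφ t ht]
    have h0 : (0 : ℝ) ∈ Icc 0 τ := left_mem_Icc.2 hτ.1.le
    have h1 : τ ∈ Icc 0 τ := right_mem_Icc.2 hτ.1.le
    refine ⟨ψ 0 + M ^ r * δ, ψ τ + M ^ r * δ, habs 0 h0, habs τ h1, ?_⟩
    -- The cutoff energy is raised by M^r δ so that it dominates φ; the right side of the estimate,
    -- written in φ, is then bounded by the same expression in z.
    refine bernoulli_le (z := fun t => ψ t + M ^ r * δ) (hA.trans_le hAC) hτ.1.le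
      ((hC10.continuousOn_setIntegral hΩ hpos hη.contDiff.continuous hη.nonneg hη.le_one hr.le
        hτ.2).add continuousOn_const)
      (fun t ht => (hφpos t ht).trans_le (hφψ t ht)) fun t ht => ?_
    have htI : t ∈ Icc 0 τ := Ioo_subset_Icc_self ht
    have htT : t ∈ Ioo 0 T := ⟨ht.1, ht.2.trans hτ.2⟩
    refine ⟨_, (hC21.hasDerivAt_setIntegral hΩ hpos hη.contDiff.continuous hη.hasCompactSupport
      hη.tsupport_subset r htT).add_const _, ?_⟩
    have hest := hC (fun x => u x t) η δ ε (hC21.contDiffOn_space t htT)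
      (fun x hx => hpos x hx t (hsubT htI)) (fun x hx => (hM x (subset_closure hx) t htI).1)
      (fun x hx => by
        rw [(hC10.hasGradientAt t (hsubT htI) x hx).gradient]
        exact (hM x (subset_closure hx) t htI).2)
      hδ.le hδ1 hε.le hη hηδ (hflux δ η (min_le_left _ _) hη t htI)
    have e : ∫ x in Ω, η x * (r * u x t ^ (r - 1) * deriv (u x) t)
        = ∫ x in Ω, η x * (r * u x t ^ (r - 1) *
          (Laplacian.laplacian (fun y => u y t ^ m) x + a * (∫ y in Ω, u y t ^ p)
            - b * u x t ^ q - c * ‖gradient (fun y => √(u y t)) x‖ ^ 2)) :=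
      setIntegral_congr_fun hmeas fun x hx => by
        simp only [hpde x hx t htT]
    rw [e]
    refine hest.trans ?_
    have hφz := hφψ t htI
    have hφt := hφpos t htI
    have hμφ : μ ≤ φ t := hmin htI
    have h3 : (φ t) ^ 3 ≤ (ψ t + M ^ r * δ) ^ 3 := by gcongr
    have h4 : C * (δ + ε) ≤ C * (2 * ε) / μ * (ψ t + M ^ r * δ) := by
      rw [div_mul_eq_mul_div, le_div_iff₀ hμ]
      have : C * (δ + ε) ≤ C * (2 * ε) := mul_le_mul_of_nonneg_left (by linarith) hC0
      exact mul_le_mul this (hμφ.trans hφz) hμ.le (by positivity)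
    have h5 := mul_le_mul_of_nonneg_left hφz hA.le
    have h6 := mul_le_mul_of_nonneg_left h3 hB.le
    change A * φ t + B * φ t ^ 3 + C * (δ + ε) ≤ _
    linarith
  -- Only the two endpoint values and the perturbed coefficient depend on ε, so the limit ε → 0 can
  -- be taken in the integrated inequality.
  choose! z0 zτ hz0 hzτ hz using hstep
  have hε0 : Tendsto (fun ε : ℝ => M ^ r * ε) (𝓝[>] 0) (𝓝 0) := by
    have : Continuous fun ε : ℝ => M ^ r * ε := by fun_prop
    simpa using (this.tendsto 0).mono_left nhdsWithin_le_nhds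
  have hlimA : Tendsto (fun ε : ℝ => A + C * (2 * ε) / μ) (𝓝[>] 0) (𝓝 A) := by
    have : Continuous fun ε : ℝ => A + C * (2 * ε) / μ := by fun_prop
    simpa using (this.tendsto 0).mono_left nhdsWithin_le_nhds
  have hlim : ∀ (z : ℝ → ℝ) (l : ℝ), (∀ ε, 0 < ε → |z ε - l| ≤ M ^ r * ε) →
      Tendsto z (𝓝[>] 0) (𝓝 l) := by
    intro z l h
    rw [tendsto_iff_dist_tendsto_zero]
    refine squeeze_zero' (Eventually.of_forall fun _ => dist_nonneg) ?_ hε0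
    filter_upwards [self_mem_nhdsWithin] with ε hε using h ε hε
  have hl0 := hlim z0 (φ 0) hz0
  have hlτ := hlim zτ (φ τ) hzτ
  have hφ0 := hφpos 0 (left_mem_Icc.2 hτ.1.le)
  have hφτ := hφpos τ (right_mem_Icc.2 hτ.1.le)
  refine le_of_tendsto_of_tendsto
    (((hl0.pow 2).inv₀ (pow_pos hφ0 2).ne').add (tendsto_const_nhds.div hlimA hA.ne'))
    ((((hlτ.pow 2).inv₀ (pow_pos hφτ 2).ne').add (tendsto_const_nhds.div hlimA hA.ne')).mul
      ((Real.continuous_exp.tendsto _).comp ((hlimA.const_mul 2).mul_const τ))) ?_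
  filter_upwards [self_mem_nhdsWithin] with ε hε using hz ε hε

end Solution

end

end PorousMedium

/-! ### The lower bound for the blow-up time -/

theorem theorem1 (Ω : Set PorousMedium.E3) (x₀ : PorousMedium.E3) (ρ₀ d : ℝ)
    (hΩ : PorousMedium.IsAdmissibleDomain Ω x₀ ρ₀ d)
    (a b c k m p q : ℝ) (ha : 0 < a) (hb : 0 < b) (hc : 0 < c) (hk : 0 < k)
    (hq : 3 / 2 < q) (hpq : q < p) (hm : 2 < m) (hmp : p < 5 → m < 8 / (5 - p)) :
    ∀ ε₁ : ℝ, 0 < ε₁ → ε₁ < 2 * ρ₀ * c / (5 * m ^ 2 * (p - 1) * d * k) →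
      (∃ ε₂ : ℝ, 0 < ε₂ ∧ PorousMedium.c₄ a c k m (p - 1) (volume.real Ω) ρ₀ d ε₁ ε₂ ≤ 0) ∧
      ∀ ε₂ : ℝ, 0 < ε₂ → PorousMedium.c₄ a c k m (p - 1) (volume.real Ω) ρ₀ d ε₁ ε₂ ≤ 0 →
        ∃ c₁ c₅ : ℝ,
          c₁ = PorousMedium.c₁ a k m (p - 1) (volume.real Ω) ρ₀ ∧
          c₅ = PorousMedium.c₅ a b k m q (p - 1) (volume.real Ω) ρ₀ d ε₁ ε₂ ∧
          0 < c₁ ∧ 0 < c₅ ∧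
          ∀ (g : ℝ → ℝ), ContinuousOn g (Ici 0) →
            (∀ ξ : ℝ, 0 ≤ ξ → 0 ≤ g ξ ∧ g ξ ≤ k * ξ ^ (m * (p - 1) / 4 - m + 2)) →
            ∀ (u₀ : PorousMedium.E3 → ℝ), PorousMedium.IsAdmissibleDatum Ω g u₀ →
            ∀ (tstar : ℝ), 0 < tstar →
            ∀ (u : PorousMedium.E3 → ℝ → ℝ),
              PorousMedium.IsClassicalSolution Ω a b c m p q g u₀ tstar u →
              PorousMedium.BlowsUpInLr Ω (m * (p - 1)) tstar u →
              0 < ∫ x in Ω, u₀ x ^ (m * (p - 1)) ∧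
              1 / (2 * c₁) *
                  Real.log (1 + c₁ / c₅ * (∫ x in Ω, u₀ x ^ (m * (p - 1))) ^ (-2 : ℤ))
                ≤ tstar ∧
              Ico 0 (1 / (2 * c₁) *
                  Real.log (1 + c₁ / c₅ * (∫ x in Ω, u₀ x ^ (m * (p - 1))) ^ (-2 : ℤ)))
                ⊆ Ico 0 tstar := by
  intro ε₁ hε₁ hε₁'
  have hs : 0 < p - 1 := by linarith
  have hV := hΩ.volume_pos
  have hρ := hΩ.rho_pos
  have hd := hΩ.d_pos
  refine ⟨PorousMedium.exists_c₄_nonpos ha hk hm hs hV hρ hd hε₁ hε₁', fun ε₂ hε₂ hc₄ => ?_⟩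
  have hc₁ := PorousMedium.c₁_pos ha hk hm hs hV hρ
  have hc₅ := PorousMedium.c₅_pos (q := q) ha hb hk hm hs hV hρ hd hε₁ hε₂ (by linarith)
  refine ⟨_, _, rfl, rfl, hc₁, hc₅, fun g _ hg u₀ hu₀ tstar ht u hsol hblow => ?_⟩
  have hpos := hsol.1
  have hinit := hsol.2.2.2.2
  obtain ⟨Du₀, hC1, -⟩ := hu₀.2.2
  have hmeas := hΩ.isOpen.measurableSet
  have hr : 0 < m * (p - 1) := mul_pos (by linarith) hs
  have hint : IntegrableOn (fun x => u₀ x ^ (m * (p - 1))) Ω :=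
    ((hC1.1.rpow_const fun _ _ => Or.inr hr.le).integrableOn_compact
      hΩ.isBounded.isCompact_closure).mono_set subset_closure
  have hφ0 : 0 < ∫ x in Ω, u₀ x ^ (m * (p - 1)) := by
    rw [setIntegral_pos_iff_support_of_nonneg_ae
      ((ae_restrict_mem hmeas).mono fun x hx => Real.rpow_nonneg (hu₀.1 x hx).le _) hint]
    have : Function.support (fun x => u₀ x ^ (m * (p - 1))) ∩ Ω = Ω :=
      inter_eq_right.2 fun x hx => (Real.rpow_pos_of_pos (hu₀.1 x hx) _).ne'
    rw [this]
    exact hΩ.isOpen.measure_pos volume ⟨_, hΩ.mem⟩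
  have heq : ∫ x in Ω, u x 0 ^ (m * (p - 1)) = ∫ x in Ω, u₀ x ^ (m * (p - 1)) :=
    setIntegral_congr_fun hmeas fun x hx => by simp only [hinit x hx]
  have hT := PorousMedium.bernoulli_lower_bound
    (φ := fun t => ∫ x in Ω, u x t ^ (m * (p - 1))) hc₁ hc₅ ht
    (fun τ hτ => hsol.energy_le hΩ ha hb hk hq hpq hm hε₁ hε₂ hc₄ (fun ξ hξ => (hg ξ hξ).2) hτ)
    hblow
  simp only [heq] at hT
  exact ⟨hφ0, hT, Ico_subset_Ico_right hT⟩
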